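/- Let $\mathfrak g$ be a finite-dimensional complex semisimple Lie algebra with a triangular decomposition $\mathfrak g=\mathfrak n_-\oplus\mathfrak h\oplus\mathfrak n_+$ given by a Cartan subalgebra $\mathfrak h$ and a base of the root system, and let $R_-$ be the set of negative roots. Let $\widetilde{\mathcal O}$ be the category of weight $\mathfrak g$-modules $M$ (i.e. $M=\bigoplus_{\lambda\in\mathfrak h^*}M_\lambda$) with $\dim M_\lambda<\infty$ for all $\lambda$ and with $\{\lambda: M_\lambda\ne0\}\subseteq\bigcup_{i=1}^k(\lambda_i+\mathbb N_0R_-)$ for some $\lambda_1,\dots,\lambda_k\in\mathfrak h^*$. Let $\Delta(\lambda)$ be the Verma module of highest weight $\lambda$, and $\nabla(\lambda)=\Delta(\lambda)^\star$ the dual Verma module, where $M^\star=\bigoplus_\lambda\operatorname{Hom}_{\mathbb C}(M_\lambda,\mathbb C)$ with action $(xf)(m)=f(\theta(x)m)$, and $\theta$ is a Chevalley anti-automorphism of $\mathfrak g$ (an anti-automorphism fixing $\mathfrak h$ pointwise). A Verma (respectively dual Verma) filtration of $M$ is a sequence of submodules $0=M^{(0)}\subseteq M^{(1)}\subseteq M^{(2)}\subseteq\cdots$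 with union $M$, each of whose subquotients $M^{(i+1)}/M^{(i)}$ is zero or isomorphic to some $\Delta(\lambda)$ (respectively $\nabla(\lambda)$). Let $\widetilde{\mathcal F}(\Delta)$ and $\widetilde{\mathcal F}(\nabla)$ be the classes of modules in $\widetilde{\mathcal O}$ that have a Verma, respectively dual Verma, filtration, and let $\widetilde{\mathcal T}=\widetilde{\mathcal F}(\Delta)\cap\widetilde{\mathcal F}(\nabla)$ be the class of tilting modules. Tensor products are over $\mathbb C$, with the diagonal action of $\mathfrak g$. Then for every $M\in\widetilde{\mathcal O}$: 1. if $N\in\widetilde{\mathcal F}(\Delta)$, then $M\otimes N\in\widetilde{\mathcal F}(\Delta)$; 2. if $K\in\widetilde{\mathcal F}(\nabla)$, then $M\otimes K\in\widetilde{\mathcal F}(\nabla)$; 3. if $T\in\widetilde{\mathcal T}$, then $M\otimes T\in\widetilde{\mathcal T}$; 4. if $N\in\widetilde{\mathcal O}$ is free as a $U(\mathfrak n_-)$-module, then so is $M\otimes N$. Moreover: 5. if $M\in\widetilde{\mathcal F}(\Delta)$ and $N\in\widetilde{\mathcal F}(\nabla)$, then $M\otimes N\in\widetilde{\mathcal T}$.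 If $(\lambda_i)_{i\in I}$ and $(\mu_j)_{j\in J}$ are the highest weights, with multiplicities, of the nonzero subquotients of a Verma filtration of $M$ and of a dual Verma filtration of $N$ respectively, then $$M\otimes N\;\cong\;\bigoplus_{(i,j)\in I\times J}\Delta(\lambda_i)\otimes\nabla(\mu_j).$$ -/

import Mathlib

open LieAlgebra LieAlgebra.IsKilling LieModule Module
open scoped TensorProduct DirectSum

noncomputable section

namespace CatO

/-! ### The triangular decomposition

`𝔤` is a finite-dimensional complex semisimple Lie algebra, `H` a Cartan subalgebra, and `b` a base
of the root system of `(𝔤, H)`. -/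

section Triangular

variable {𝔤 : Type*} [LieRing 𝔤] [LieAlgebra ℂ 𝔤] [FiniteDimensional ℂ 𝔤] [IsSemisimple ℂ 𝔤]
  {H : LieSubalgebra ℂ 𝔤} [H.IsCartanSubalgebra]

/-- The sum of the root spaces of the roots in `S`, as a Lie subalgebra, where `S` is a set of roots
closed under addition and containing no pair of opposite roots. -/
def rootSubalgebra (S : Set H.root)
    (hadd : ∀ i ∈ S, ∀ j ∈ S, ∀ k, (rootSystem H).root k =
      (rootSystem H).root i + (rootSystem H).root j → k ∈ S)
    (hneg : ∀ i ∈ S, ∀ j ∈ S, (rootSystem H).root i + (rootSystem H).root j ≠ 0) :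
    LieSubalgebra ℂ 𝔤 where
  __ := ⨆ i ∈ S, (rootSpace H (i.1 : H → ℂ)).toSubmodule
  lie_mem' {x y} hx hy := by
    have key : ∀ i ∈ S, ∀ j ∈ S, ∀ x ∈ rootSpace H (i.1 : H → ℂ),
        ∀ y ∈ rootSpace H (j.1 : H → ℂ),
        ⁅x, y⁆ ∈ ⨆ k ∈ S, (rootSpace H (k.1 : H → ℂ)).toSubmodule := by
      intro i hi j hj x hx y hy
      have hxy := lie_mem_genWeightSpace_of_mem_genWeightSpace hx hy
      by_cases h0 : rootSpace H ((i.1 : H → ℂ) + j.1) = ⊥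
      · have h1 : ⁅x, y⁆ ∈ rootSpace H ((i.1 : H → ℂ) + j.1) := hxy
        rw [h0, LieSubmodule.mem_bot] at h1
        rw [h1]; exact Submodule.zero_mem _
      · let w : Weight ℂ H 𝔤 := ⟨(i.1 : H → ℂ) + j.1, h0⟩
        have hw : w.IsNonZero := by
          intro hz
          apply hneg i hi j hj
          ext t
          exact congrFun (Weight.IsZero.eq hz) t
        let k : H.root := ⟨w, by simpa using hw⟩
        have hk : k ∈ S := hadd i hi j hj k (by ext t; rfl)
        exact Submodule.mem_iSup_of_mem k (Submodule.mem_iSup_of_mem hk hxy)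
    have key2 : ∀ i ∈ S, ∀ x ∈ rootSpace H (i.1 : H → ℂ),
        ⁅x, y⁆ ∈ ⨆ k ∈ S, (rootSpace H (k.1 : H → ℂ)).toSubmodule := by
      intro i hi x hx
      have : (⨆ j ∈ S, (rootSpace H (j.1 : H → ℂ)).toSubmodule) ≤
          (⨆ k ∈ S, (rootSpace H (k.1 : H → ℂ)).toSubmodule).comap
            (toEnd ℂ 𝔤 𝔤 x) :=
        iSup₂_le fun j hj y hy => key i hi j hj x hx y hy
      exact this hy
    have : (⨆ j ∈ S, (rootSpace H (j.1 : H → ℂ)).toSubmodule) ≤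
        (⨆ k ∈ S, (rootSpace H (k.1 : H → ℂ)).toSubmodule).comap
          ((toEnd ℂ 𝔤 𝔤 : 𝔤 →ₗ[ℂ] End ℂ 𝔤).flip y) :=
      iSup₂_le fun j hj x hx => key2 j hj x hx
    exact this hx

/-- `𝔫₊`, the sum of the root spaces of the positive roots. -/
def nPos (b : (rootSystem H).Base) : LieSubalgebra ℂ 𝔤 :=
  rootSubalgebra {i | b.IsPos i}
    (fun _ hi _ hj _ hk => RootPairing.Base.IsPos.add hi hj hk)
    (fun i hi j hj h => by
      have h1 : (rootSystem H).root j =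
          (rootSystem H).root ((rootSystem H).reflectionPerm i i) := by
        rw [RootPairing.root_reflectionPerm, RootPairing.reflection_apply_self]
        exact eq_neg_of_add_eq_zero_right h
      have h2 := (rootSystem H).root.injective h1
      have h3 : b.height ((rootSystem H).reflectionPerm i i) = -b.height i :=
        b.height_reflectionPerm_self i
      rw [← h2] at h3
      have h4 : 0 < b.height i := hi
      have h5 : 0 < b.height j := hj
      omega)

/-- `𝔫₋`, the sum of the root spaces of the negative roots (the roots that are not positive). -/
def nNeg (b : (rootSystem H).Base) : LieSubalgebra ℂ 𝔤 :=
  rootSubalgebra {i | ¬ b.IsPos i}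
    (fun i hi j hj k hk => by
      have h3 := b.height_add hk
      have h4 : ¬ 0 < b.height i := hi
      have h5 : ¬ 0 < b.height j := hj
      have h6 := b.height_ne_zero i
      change ¬ 0 < b.height k
      omega)
    (fun i hi j hj h => by
      have h1 : (rootSystem H).root j =
          (rootSystem H).root ((rootSystem H).reflectionPerm i i) := by
        rw [RootPairing.root_reflectionPerm, RootPairing.reflection_apply_self]
        exact eq_neg_of_add_eq_zero_right h
      have h2 := (rootSystem H).root.injective h1
      have h3 : b.height ((rootSystem H).reflectionPerm i i) = -b.height i :=
        b.height_reflectionPerm_self i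
      rw [← h2] at h3
      have h4 : ¬ 0 < b.height i := hi
      have h5 : ¬ 0 < b.height j := hj
      have h6 := b.height_ne_zero i
      omega)

/-- `ℕ₀R₋`, the set of sums of negative roots. -/
def negCone (b : (rootSystem H).Base) : AddSubmonoid (Dual ℂ H) :=
  AddSubmonoid.closure ((rootSystem H).root '' {i | ¬ b.IsPos i})

end Triangular

/-! ### Weight modules and the category `Õ` -/

section Weights

variable {𝔤 : Type*} [LieRing 𝔤] [LieAlgebra ℂ 𝔤]
  (H : LieSubalgebra ℂ 𝔤) [LieRing.IsNilpotent H]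
  (M : Type*) [AddCommGroup M] [Module ℂ M] [LieRingModule 𝔤 M] [LieModule ℂ 𝔤 M]

/-- `Supp M`, the set of `μ ∈ 𝔥*` with `M_μ ≠ 0`. -/
def supp : Set (Dual ℂ H) := {μ | weightSpace M (μ : H → ℂ) ≠ ⊥}

/-- `M` is a weight module: it is the sum of its weight spaces (such a sum is always direct). -/
def IsWeightModule : Prop :=
  ⨆ μ : Dual ℂ H, (weightSpace M (μ : H → ℂ)).toSubmodule = ⊤

end Weights

section OTilde

variable {𝔤 : Type*} [LieRing 𝔤] [LieAlgebra ℂ 𝔤] [FiniteDimensional ℂ 𝔤] [IsSemisimple ℂ 𝔤]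
  {H : LieSubalgebra ℂ 𝔤} [H.IsCartanSubalgebra]

/-- `M` is an object of the enlarged category `Õ`. -/
structure IsOTilde (b : (rootSystem H).Base)
    (M : Type*) [AddCommGroup M] [Module ℂ M] [LieRingModule 𝔤 M] [LieModule ℂ 𝔤 M] : Prop where
  isWeightModule : IsWeightModule H M
  supp_bounded : ∃ s : Finset (Dual ℂ H), ∀ μ ∈ supp H M, ∃ ν ∈ s, ∃ κ ∈ negCone b, μ = ν + κ
  finiteDimensional : ∀ μ : Dual ℂ H, FiniteDimensional ℂ (weightSpace M (μ : H → ℂ))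

end OTilde

/-! ### Verma modules -/

section Verma

variable {𝔤 : Type*} [LieRing 𝔤] [LieAlgebra ℂ 𝔤] [FiniteDimensional ℂ 𝔤] [IsSemisimple ℂ 𝔤]
  {H : LieSubalgebra ℂ 𝔤} [H.IsCartanSubalgebra]

/-- The left ideal of `U(𝔤)` generated by `𝔫₊` and by the elements `h - μ(h)`, `h ∈ 𝔥`. -/
def vermaIdeal (b : (rootSystem H).Base) (μ : Dual ℂ H) :
    Submodule (UniversalEnvelopingAlgebra ℂ 𝔤) (UniversalEnvelopingAlgebra ℂ 𝔤) :=
  Submodule.span _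
    ({u | ∃ x ∈ nPos b, u = UniversalEnvelopingAlgebra.ι ℂ x} ∪
     {u | ∃ h : H, u = UniversalEnvelopingAlgebra.ι ℂ (h : 𝔤) - algebraMap ℂ _ (μ h)})

/-- The Verma module `Δ(μ)` of highest weight `μ`: the quotient of `U(𝔤)` by the left ideal
`vermaIdeal b μ`, i.e. the module `U(𝔤) ⊗_{U(𝔟)} ℂ_μ` induced from `𝔟 = 𝔥 ⊕ 𝔫₊`. -/
def Verma (b : (rootSystem H).Base) (μ : Dual ℂ H) : Type _ :=
  UniversalEnvelopingAlgebra ℂ 𝔤 ⧸ vermaIdeal b μ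

variable (b : (rootSystem H).Base) (μ : Dual ℂ H)

instance : AddCommGroup (Verma b μ) :=
  inferInstanceAs (AddCommGroup (UniversalEnvelopingAlgebra ℂ 𝔤 ⧸ vermaIdeal b μ))

instance : Module (UniversalEnvelopingAlgebra ℂ 𝔤) (Verma b μ) :=
  inferInstanceAs (Module (UniversalEnvelopingAlgebra ℂ 𝔤)
    (UniversalEnvelopingAlgebra ℂ 𝔤 ⧸ vermaIdeal b μ))

instance : Module ℂ (Verma b μ) :=
  inferInstanceAs (Module ℂ (UniversalEnvelopingAlgebra ℂ 𝔤 ⧸ vermaIdeal b μ))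

instance : IsScalarTower ℂ (UniversalEnvelopingAlgebra ℂ 𝔤) (Verma b μ) :=
  inferInstanceAs (IsScalarTower ℂ (UniversalEnvelopingAlgebra ℂ 𝔤)
    (UniversalEnvelopingAlgebra ℂ 𝔤 ⧸ vermaIdeal b μ))

instance : LieRingModule 𝔤 (Verma b μ) where
  bracket x v := UniversalEnvelopingAlgebra.ι ℂ x • v
  add_lie x y v := by
    rw [map_add, add_smul]
  lie_add x v w := smul_add _ v w
  leibniz_lie x y v := by
    change UniversalEnvelopingAlgebra.ι ℂ x • UniversalEnvelopingAlgebra.ι ℂ y • v =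
      UniversalEnvelopingAlgebra.ι ℂ ⁅x, y⁆ • v +
      UniversalEnvelopingAlgebra.ι ℂ y • UniversalEnvelopingAlgebra.ι ℂ x • v
    let := LieRing.ofAssociativeRing (A := UniversalEnvelopingAlgebra ℂ 𝔤)
    rw [LieHom.map_lie, LieRing.of_associative_ring_bracket, sub_smul, mul_smul, mul_smul,
      sub_add_cancel]

instance : LieModule ℂ 𝔤 (Verma b μ) where
  smul_lie c x v := by
    change UniversalEnvelopingAlgebra.ι ℂ (c • x) • v = c • UniversalEnvelopingAlgebra.ι ℂ x • v
    rw [map_smul, smul_assoc]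
  lie_smul c x v := smul_algebra_smul_comm c (UniversalEnvelopingAlgebra.ι ℂ x) v

end Verma

/-! ### Chevalley anti-automorphisms

The definition, and a proof that they exist: a base of the root system yields Chevalley generators
`e_i`, `f_i`, `h_i`, and the Lie subalgebra of `𝔤 × 𝔤` generated by the pairs `(e_i, f_i)` and
`(f_i, e_i)` is the graph of an automorphism `σ`; then `-σ` is a Chevalley anti-automorphism. -/

/-- A Chevalley anti-automorphism of `𝔤` relative to the Cartan subalgebra `H`: an
anti-automorphism of `𝔤` that fixes `H` pointwise. (It then exchanges the root spaces of `α` and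
`-α` for every root `α`, and for every simple root `α` it exchanges `e` and `f` in a suitably
scaled `𝔰𝔩₂`-triple `(h, e, f)` for `α`.) -/
structure ChevalleyAntiAut {𝔤 : Type*} [LieRing 𝔤] [LieAlgebra ℂ 𝔤]
    (H : LieSubalgebra ℂ 𝔤) where
  /-- the underlying linear bijection -/
  toLinearEquiv : 𝔤 ≃ₗ[ℂ] 𝔤
  map_lie : ∀ x y : 𝔤, toLinearEquiv ⁅x, y⁆ = ⁅toLinearEquiv y, toLinearEquiv x⁆
  map_cartan : ∀ h ∈ H, toLinearEquiv h = h

section Generators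

variable {𝔤 : Type*} [LieRing 𝔤] [LieAlgebra ℂ 𝔤] [FiniteDimensional ℂ 𝔤] [IsSemisimple ℂ 𝔤]
  {H : LieSubalgebra ℂ 𝔤} [H.IsCartanSubalgebra]

lemma mem_of_rootSpace_add {S : LieSubalgebra ℂ 𝔤} {α β γ : Weight ℂ H 𝔤} (hα : α.IsNonZero)
    (hγ : γ.IsNonZero) (h : (γ : H → ℂ) = α + β)
    (hαS : ∀ x ∈ rootSpace H (α : H → ℂ), x ∈ S) (hβS : ∀ x ∈ rootSpace H (β : H → ℂ), x ∈ S) :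
    ∀ x ∈ rootSpace H (γ : H → ℂ), x ∈ S := by
  obtain ⟨x, hx, x_ne0⟩ := (chainTop α β).exists_ne_zero
  obtain ⟨c, e, f, isSl2, he, hf⟩ := exists_isSl2Triple_of_weight_isNonZero hα
  obtain rfl := isSl2.h_eq_coroot hα he hf
  have prim : isSl2.HasPrimitiveVectorWith x (chainLength α β : ℂ) :=
    have := lie_mem_genWeightSpace_of_mem_genWeightSpace he hx
    ⟨x_ne0, (chainLength_smul _ _ hx).symm, by rwa [genWeightSpace_add_chainTop _ _ hα] at this⟩
  have h1 : 1 ≤ chainTopCoeff α β := by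
    have := (rootSpace_zsmul_add_ne_bot_iff α β hα 1).mp (by
      rw [one_smul, ← h]; exact γ.genWeightSpace_ne_bot)
    exact_mod_cast this.1
  have h2 := chainTopCoeff_le_chainLength α β
  obtain ⟨j, hj⟩ := Nat.exists_eq_add_of_le' h1
  have m1 := toEnd_pow_apply_mem hf hx (j + 1)
  have m0 := toEnd_pow_apply_mem hf hx j
  have e1 : (j + 1) • (-(α : H → ℂ)) + (chainTop α β : H → ℂ) = β := by
    rw [coe_chainTop', hj]; module
  have e0 : j • (-(α : H → ℂ)) + (chainTop α β : H → ℂ) = γ := by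
    rw [coe_chainTop', hj, h]; module
  rw [e1] at m1
  rw [e0] at m0
  have hne := prim.pow_toEnd_f_ne_zero_of_eq_nat rfl (i := j) (by omega)
  have hE := prim.lie_e_pow_succ_toEnd_f j
  have hS : (toEnd ℂ 𝔤 𝔤 f ^ j) x ∈ S := by
    have h3 : ⁅e, (toEnd ℂ 𝔤 𝔤 f ^ (j+1)) x⁆ ∈ S := S.lie_mem (hαS e he) (hβS _ m1)
    rw [hE] at h3
    refine (S.toSubmodule.smul_mem_iff ?_).mp h3
    have : (chainLength α β : ℂ) - j ≠ 0 := by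
      rw [sub_ne_zero]; norm_cast; omega
    exact mul_ne_zero (by exact_mod_cast Nat.succ_ne_zero j) this
  intro y hy
  obtain ⟨c, hc⟩ := (finrank_eq_one_iff_of_nonzero'
    (⟨_, m0⟩ : rootSpace H (γ : H → ℂ)) (by simpa [Subtype.ext_iff] using hne)).mp
    (finrank_rootSpace_eq_one γ hγ) ⟨y, hy⟩
  have : y = c • (toEnd ℂ 𝔤 𝔤 f ^ j) x := (congrArg Subtype.val hc).symm
  rw [this]; exact S.smul_mem c hS

lemma eq_top_of_simple_rootSpaces {S : LieSubalgebra ℂ 𝔤} (b : (rootSystem H).Base)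
    (h1 : ∀ i ∈ b.support, ∀ x ∈ rootSpace H (i.1 : H → ℂ), x ∈ S)
    (h2 : ∀ i ∈ b.support, ∀ x ∈ rootSpace H (-(i.1 : H → ℂ)), x ∈ S) : S = ⊤ := by
  have hnz : ∀ i : H.root, i.1.IsNonZero := fun i => H.isNonZero_coe_root i
  have hpos : ∀ i : H.root, b.IsPos i → (∀ x ∈ rootSpace H (i.1 : H → ℂ), x ∈ S) ∧
      (∀ x ∈ rootSpace H (-(i.1 : H → ℂ)), x ∈ S) := by
    intro i hi
    refine hi.induction_on_add (p := fun i => (∀ x ∈ rootSpace H (i.1 : H → ℂ), x ∈ S) ∧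
      (∀ x ∈ rootSpace H (-(i.1 : H → ℂ)), x ∈ S)) (fun i hi => ⟨h1 i hi, h2 i hi⟩) ?_
    intro i j k hk ⟨hi1, hi2⟩ hj
    have hk' : (k.1 : H → ℂ) = j.1 + i.1 := by
      ext t
      have := LinearMap.congr_fun hk t
      simpa [add_comm] using this
    constructor
    · exact mem_of_rootSpace_add (hnz j) (hnz k) hk' (h1 j hj) hi1
    · have := mem_of_rootSpace_add (S := S) (α := -j.1) (β := -i.1) (γ := -k.1) (hnz j).neg
        (hnz k).neg (by simp only [Weight.coe_neg, hk']; abel)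
        (by simpa using h2 j hj) (by simpa using hi2)
      simpa using this
  let := (rootSystem H).indexNeg
  have hroot : ∀ i : H.root, ∀ x ∈ rootSpace H (i.1 : H → ℂ), x ∈ S := by
    intro i
    rcases RootPairing.Base.IsPos.or_neg b i with hi | hi
    · exact (hpos i hi).1
    · have h3 := (hpos _ hi).2
      have : -(((-i : H.root).1 : H → ℂ)) = (i.1 : H → ℂ) := by
        have h4 := (rootSystem H).root_reflectionPerm i i
        rw [RootPairing.reflection_apply_self] at h4
        ext t
        have h5 := LinearMap.congr_fun h4 t
        have h6 : ((-i : H.root).1 : H → ℂ) t = - (i.1 : H → ℂ) t := h5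
        change -((-i : H.root).1 : H → ℂ) t = _
        rw [h6, neg_neg]
      rwa [this] at h3
  have hcoroot : ∀ i : H.root, ((coroot i.1 : H) : 𝔤) ∈ S := by
    intro i
    obtain ⟨c, e, f, isSl2, he, hf⟩ := exists_isSl2Triple_of_weight_isNonZero (hnz i)
    rw [← isSl2.h_eq_coroot (hnz i) he hf, ← isSl2.lie_e_f]
    rcases RootPairing.Base.IsPos.or_neg b i with hi | hi
    · exact S.lie_mem (hroot i e he) ((hpos i hi).2 f hf)
    · refine S.lie_mem (hroot i e he) ((hroot (-i)) f ?_)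
      have : (((-i : H.root).1 : H → ℂ)) = -(i.1 : H → ℂ) := by
        have h4 := (rootSystem H).root_reflectionPerm i i
        rw [RootPairing.reflection_apply_self] at h4
        ext t
        exact LinearMap.congr_fun h4 t
      rwa [this]
  have hH : ∀ x ∈ H, x ∈ S := by
    intro x hx
    have h3 : (⟨x, hx⟩ : H) ∈ Submodule.span ℂ (Set.range (rootSystem H).coroot) := by
      rw [RootPairing.IsRootSystem.span_coroot_eq_top (P := rootSystem H)]; trivial
    have h4 : Submodule.span ℂ (Set.range (rootSystem H).coroot) ≤
        S.toSubmodule.comap H.toSubmodule.subtype := by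
      rw [Submodule.span_le]
      rintro _ ⟨i, rfl⟩
      exact hcoroot i
    exact h4 h3
  rw [eq_top_iff]
  intro y _
  have hy : y ∈ (⨆ χ : Weight ℂ H 𝔤, rootSpace H (χ : H → ℂ)) := by
    rw [iSup_genWeightSpace_eq_top']; trivial
  induction hy using LieSubmodule.iSup_induction' with
  | mem χ y hy =>
    by_cases hχ : χ.IsZero
    · apply hH
      rw [hχ.eq] at hy
      have : y ∈ (rootSpace H (0 : H → ℂ)) := hy
      rw [rootSpace_zero_eq] at this
      exact this
    · exact hroot ⟨χ, by simpa using hχ⟩ y hy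
  | zero => exact S.zero_mem
  | add y z _ _ hy hz => exact S.add_mem (hy trivial) (hz trivial)

theorem exists_basis (b : (rootSystem H).Base) : Nonempty (LieAlgebra.Basis b.support H) := by
  have hnz : ∀ i : H.root, i.1.IsNonZero := fun i => H.isNonZero_coe_root i
  choose c e f isSl2 he hf using
    fun i : b.support => exists_isSl2Triple_of_weight_isNonZero (hnz i.1)
  have hc : ∀ i : b.support, c i = ((coroot i.1.1 : H) : 𝔤) :=
    fun i => (isSl2 i).h_eq_coroot (hnz i.1) (he i) (hf i)
  have hA : ∀ i j : b.support, ((b.cartanMatrix i j : ℤ) : ℂ) = (i.1.1 : H → ℂ) (coroot j.1.1) := by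
    intro i j
    have := b.algebraMap_cartanMatrixIn_apply ℤ i j
    simpa using this
  have hspan : Submodule.span ℂ (Set.range c) = H.toSubmodule := by
    have h1 : Set.range c = H.toSubmodule.subtype '' (Set.range b.toCoweightBasis) := by
      rw [← Set.range_comp]
      congr 1; ext i; simp [hc]
    rw [h1, ← Submodule.map_span, Module.Basis.span_eq, Submodule.map_top, Submodule.range_subtype]
  have hcomm : ∀ i j, ⁅c i, c j⁆ = 0 := by
    intro i j
    have : ⁅(coroot i.1.1 : H), (coroot j.1.1 : H)⁆ = 0 := trivial_lie_zero _ _ _ _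
    rw [hc, hc]; exact congrArg Subtype.val this
  refine ⟨{ A := b.cartanMatrix, h := c, e := e, f := f, sl2 := isSl2, lie_h_h := hcomm,
            nondegen := b.cartanMatrix_nondegenerate,
            cartan_eq_lieSpan := ?_, span_ef := ?_, linInd := ?_, lie_h_e := ?_, lie_h_f := ?_,
            lie_e_f_ne := ?_ }⟩
  · rw [← LieSubalgebra.toSubmodule_inj, LieSubalgebra.coe_lieSpan_eq_span_of_forall_lie_eq_zero,
      hspan]
    rintro _ ⟨i, rfl⟩ _ ⟨j, rfl⟩
    exact hcomm i j
  · refine eq_top_of_simple_rootSpaces b ?_ ?_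
    · intro i hi x hx
      obtain ⟨t, ht⟩ := (finrank_eq_one_iff_of_nonzero'
        (⟨_, he ⟨i, hi⟩⟩ : rootSpace H (i.1 : H → ℂ))
        (by simpa [Subtype.ext_iff] using (isSl2 ⟨i, hi⟩).e_ne_zero)).mp
        (finrank_rootSpace_eq_one i.1 (hnz i)) ⟨x, hx⟩
      have : x = t • e ⟨i, hi⟩ := (congrArg Subtype.val ht).symm
      rw [this]
      exact LieSubalgebra.smul_mem _ _ (LieSubalgebra.subset_lieSpan (.inl ⟨_, rfl⟩))
    · intro i hi x hx
      obtain ⟨t, ht⟩ := (finrank_eq_one_iff_of_nonzero'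
        (⟨_, hf ⟨i, hi⟩⟩ : rootSpace H ((-i.1 : Weight ℂ H 𝔤) : H → ℂ))
        (by simpa [Subtype.ext_iff] using (isSl2 ⟨i, hi⟩).f_ne_zero)).mp
        (finrank_rootSpace_eq_one (-i.1) (hnz i).neg) ⟨x, hx⟩
      have : x = t • f ⟨i, hi⟩ := (congrArg Subtype.val ht).symm
      rw [this]
      exact LieSubalgebra.smul_mem _ _ (LieSubalgebra.subset_lieSpan (.inr ⟨_, rfl⟩))
  · have h1 : c = H.toSubmodule.subtype ∘ b.toCoweightBasis := by ext i; simp [hc]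
    rw [h1]
    exact b.toCoweightBasis.linearIndependent.map' _ (Submodule.ker_subtype _)
  · intro i j
    have h1 := lie_eq_smul_of_mem_rootSpace (he i) (coroot j.1.1)
    have h2 : ⁅c j, e i⁆ = (i.1.1 : H → ℂ) (coroot j.1.1) • e i := by rw [hc]; exact h1
    rw [h2, ← hA, Int.cast_smul_eq_zsmul]
  · intro i j
    have h1 := lie_eq_smul_of_mem_rootSpace (hf i) (coroot j.1.1)
    have h2 : ⁅c j, f i⁆ = (-(i.1.1 : H → ℂ)) (coroot j.1.1) • f i := by rw [hc]; exact h1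
    rw [h2, Pi.neg_apply, ← hA, neg_smul, Int.cast_smul_eq_zsmul, neg_smul]
  · intro i j hij
    have h1 : ⁅e i, f j⁆ ∈ rootSpace H ((i.1.1 : H → ℂ) + -(j.1.1 : H → ℂ)) :=
      lie_mem_genWeightSpace_of_mem_genWeightSpace (he i) (hf j)
    by_contra hne
    have h0 : rootSpace H ((i.1.1 : H → ℂ) + -(j.1.1 : H → ℂ)) ≠ ⊥ := by
      intro h0
      rw [h0, LieSubmodule.mem_bot] at h1
      exact hne h1
    let w : Weight ℂ H 𝔤 := ⟨_, h0⟩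
    have hw : w.IsNonZero := by
      intro hz
      apply hij
      apply Subtype.ext
      apply (rootSystem H).root.injective
      ext t
      have h3 : (i.1.1 : H → ℂ) t + -(j.1.1 : H → ℂ) t = 0 := congrFun (Weight.IsZero.eq hz) t
      exact add_neg_eq_zero.mp h3
    refine b.sub_notMem_range_root i.2 j.2 ⟨⟨w, by simpa using hw⟩, ?_⟩
    ext t
    exact (sub_eq_add_neg _ _).symm

end Generators

section Graph

variable {𝔤 : Type*} [LieRing 𝔤] [LieAlgebra ℂ 𝔤] {H : LieSubalgebra ℂ 𝔤}
  {ι : Type*} [Finite ι] (B : LieAlgebra.Basis ι H)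

/-- The Lie subalgebra of `𝔤 × 𝔤` generated by the pairs `(e, f)` and `(f, e)`. -/
def graphAlgebra : LieSubalgebra ℂ (𝔤 × 𝔤) :=
  LieSubalgebra.lieSpan ℂ _ (Set.range (fun i => (B.e i, B.f i)) ∪ Set.range fun i => (B.f i, B.e i))

lemma swap_mem_graphAlgebra {x y : 𝔤} (h : (x, y) ∈ graphAlgebra B) : (y, x) ∈ graphAlgebra B := by
  have h1 : graphAlgebra B ≤ (graphAlgebra B).comap (LieEquiv.prodComm ℂ 𝔤 𝔤).toLieHom := by
    conv_lhs => rw [graphAlgebra]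
    rw [LieSubalgebra.lieSpan_le]
    rintro _ (⟨i, rfl⟩ | ⟨i, rfl⟩)
    · exact LieSubalgebra.subset_lieSpan (.inr ⟨i, rfl⟩)
    · exact LieSubalgebra.subset_lieSpan (.inl ⟨i, rfl⟩)
  exact h1 h

lemma exists_mem_graphAlgebra (x : 𝔤) : ∃ y, (x, y) ∈ graphAlgebra B := by
  have h : (graphAlgebra B).map (LieHom.fst ℂ 𝔤 𝔤) = ⊤ := by
    rw [eq_top_iff, ← B.span_ef, LieSubalgebra.lieSpan_le]
    rintro _ (⟨i, rfl⟩ | ⟨i, rfl⟩)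
    · exact ⟨(B.e i, B.f i), LieSubalgebra.subset_lieSpan (.inl ⟨i, rfl⟩), rfl⟩
    · exact ⟨(B.f i, B.e i), LieSubalgebra.subset_lieSpan (.inr ⟨i, rfl⟩), rfl⟩
  have hx : x ∈ (graphAlgebra B).map (LieHom.fst ℂ 𝔤 𝔤) := by rw [h]; trivial
  obtain ⟨⟨a, y⟩, hy, rfl⟩ := hx
  exact ⟨y, hy⟩

lemma graph_ef (i : ι) : (B.e i, B.f i) ∈ graphAlgebra B :=
  LieSubalgebra.subset_lieSpan (.inl ⟨i, rfl⟩)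

lemma graph_fe (i : ι) : (B.f i, B.e i) ∈ graphAlgebra B :=
  LieSubalgebra.subset_lieSpan (.inr ⟨i, rfl⟩)

lemma graph_h (i : ι) : (B.h i, -B.h i) ∈ graphAlgebra B := by
  have := (graphAlgebra B).lie_mem (graph_ef B i) (graph_fe B i)
  rw [LieAlgebra.Prod.bracket_apply] at this
  simpa [(B.sl2 i).lie_e_f, (B.sl2 i).symm.lie_e_f] using this

/-- The elements of the graph algebra coming from `H`. -/
def graphCartan : LieSubalgebra ℂ (graphAlgebra B) :=
  LieSubalgebra.lieSpan ℂ _ (Set.range fun i => ⟨(B.h i, -B.h i), graph_h B i⟩)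

/-- The distinguished basis of the graph algebra. -/
def graphBasis : LieAlgebra.Basis ι (graphCartan B) where
  A := B.A
  h i := ⟨(B.h i, -B.h i), graph_h B i⟩
  e i := ⟨(B.e i, B.f i), graph_ef B i⟩
  f i := ⟨(B.f i, B.e i), graph_fe B i⟩
  cartan_eq_lieSpan := rfl
  span_ef := by
    refine Eq.trans ?_ (LieSubalgebra.lieSpan_lieSpan_coe_preimage (R := ℂ)
      (s := Set.range (fun i => (B.e i, B.f i)) ∪ Set.range fun i => (B.f i, B.e i)))
    congr 1
    ext ⟨x, hx⟩
    simp only [Set.mem_union, Set.mem_range, Subtype.ext_iff]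
    rfl
  linInd := .of_comp (graphAlgebra B).toSubmodule.subtype <| .of_comp (LinearMap.fst ℂ 𝔤 𝔤) B.linInd
  nondegen := B.nondegen
  sl2 i :=
    { h_ne_zero := by simp [Subtype.ext_iff, (B.sl2 i).h_ne_zero]
      lie_e_f := by
        simp [Subtype.ext_iff, (B.sl2 i).lie_e_f, (B.sl2 i).symm.lie_e_f]
      lie_h_e_nsmul := by
        simp [Subtype.ext_iff, (B.sl2 i).lie_h_e_nsmul, (B.sl2 i).lie_h_f_nsmul]
      lie_h_f_nsmul := by
        simp [Subtype.ext_iff, (B.sl2 i).lie_h_e_nsmul, (B.sl2 i).lie_h_f_nsmul] }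
  lie_h_h i j := by simp [Subtype.ext_iff, B.lie_h_h]
  lie_h_e i j := by simp [Subtype.ext_iff, B.lie_h_e, B.lie_h_f]
  lie_h_f i j := by simp [Subtype.ext_iff, B.lie_h_e, B.lie_h_f]
  lie_e_f_ne i j hij := by
    have h1 := B.lie_e_f_ne i j hij
    have h2 : ⁅B.f i, B.e j⁆ = 0 := by rw [← lie_skew, B.lie_e_f_ne j i hij.symm, neg_zero]
    simp [Subtype.ext_iff, h1, h2]

lemma graphCartan_eq {x : graphAlgebra B} (hx : x ∈ graphCartan B) :
    (x : 𝔤 × 𝔤).1 ∈ H ∧ (x : 𝔤 × 𝔤).2 = -(x : 𝔤 × 𝔤).1 := by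
  have h1 : x ∈ (graphCartan B).toSubmodule := hx
  rw [(graphBasis B).coe_cartan_eq_span] at h1
  clear hx
  induction h1 using Submodule.span_induction with
  | mem x hx =>
    obtain ⟨i, rfl⟩ := hx
    exact ⟨(B.h' i).2, rfl⟩
  | zero => exact ⟨H.zero_mem, neg_zero.symm⟩
  | add x y _ _ hx hy =>
    refine ⟨H.add_mem hx.1 hy.1, ?_⟩
    change x.1.2 + y.1.2 = -(x.1.1 + y.1.1)
    rw [hx.2, hy.2, neg_add]
  | smul c x _ hx =>
    refine ⟨H.smul_mem c hx.1, ?_⟩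
    change c • x.1.2 = -(c • x.1.1)
    rw [hx.2, smul_neg]

/-- The elements `y` with `(0, y)` in the graph algebra form an ideal. -/
def graphIdeal : LieIdeal ℂ 𝔤 where
  carrier := {y | ((0 : 𝔤), y) ∈ graphAlgebra B}
  add_mem' {x y} hx hy := by simpa using (graphAlgebra B).add_mem hx hy
  zero_mem' := (graphAlgebra B).zero_mem
  smul_mem' c x hx := by simpa using (graphAlgebra B).smul_mem c hx
  lie_mem {x y} hy := by
    obtain ⟨z, hz⟩ := exists_mem_graphAlgebra B x
    simpa using (graphAlgebra B).lie_mem (swap_mem_graphAlgebra B hz) hy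

variable [FiniteDimensional ℂ 𝔤] [IsSemisimple ℂ 𝔤] [H.IsCartanSubalgebra]

lemma graphIdeal_inf {y : 𝔤} (hy : ((0 : 𝔤), y) ∈ graphAlgebra B) (hyH : y ∈ H) : y = 0 := by
  have := Fintype.ofFinite ι
  have := (graphBasis B).isCartanSubalgebra
  have h1 : (⟨(0, y), hy⟩ : graphAlgebra B) ∈ (graphCartan B).normalizer := by
    rw [LieSubalgebra.mem_normalizer_iff]
    intro k hk
    obtain ⟨h2, h3⟩ := graphCartan_eq B hk
    have h4 : ⁅(⟨(0, y), hy⟩ : graphAlgebra B), k⁆ = 0 := by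
      apply Subtype.ext
      change (⁅(0 : 𝔤), k.1.1⁆, ⁅y, k.1.2⁆) = 0
      have h5 : ⁅(⟨y, hyH⟩ : H), (⟨k.1.1, h2⟩ : H)⁆ = 0 := trivial_lie_zero _ _ _ _
      have h6 : ⁅y, k.1.1⁆ = 0 := congrArg Subtype.val h5
      rw [h3, zero_lie, lie_neg, h6, neg_zero]
      rfl
    rw [h4]; exact (graphCartan B).zero_mem
  rw [LieSubalgebra.IsCartanSubalgebra.self_normalizing] at h1
  have h2 : y = -0 := (graphCartan_eq B h1).2
  simpa using h2

lemma graphIdeal_eq_bot {y : 𝔤} (hy : ((0 : 𝔤), y) ∈ graphAlgebra B) : y = 0 := by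
  have h1 := lieIdeal_eq_inf_cartan_sup_biSup_rootSpace (H := H) (graphIdeal B)
  have h2 : ((graphIdeal B).restr H ⊓ H.toLieSubmodule) = ⊥ := by
    rw [eq_bot_iff]
    rintro x ⟨hx1, hx2⟩
    exact (LieSubmodule.mem_bot _).mpr (graphIdeal_inf B hx1 hx2)
  have h3 : ∀ α : H.root, ¬ rootSpace H (α.1 : H → ℂ) ≤ (graphIdeal B).restr H := by
    intro α hα
    have h4 := (graphIdeal B).corootSubmodule_le hα (coe_coroot_mem_corootSubmodule α.1)
    have h5 := graphIdeal_inf B h4 (coroot α.1).2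
    have h6 : coroot α.1 = 0 := Subtype.ext h5
    exact H.isNonZero_coe_root α (coroot_eq_zero_iff.mp h6)
  have h4 : (graphIdeal B).restr H = ⊥ := by
    rw [h1, h2, bot_sup_eq, eq_bot_iff]
    exact iSup₂_le fun α hα => absurd hα (h3 α)
  have h5 : y ∈ (graphIdeal B).restr H := hy
  rwa [h4, LieSubmodule.mem_bot] at h5

lemma graph_unique {x y z : 𝔤} (hy : (x, y) ∈ graphAlgebra B) (hz : (x, z) ∈ graphAlgebra B) :
    y = z := by
  have h := (graphAlgebra B).sub_mem hy hz
  rw [Prod.mk_sub_mk, sub_self] at h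
  exact sub_eq_zero.mp (graphIdeal_eq_bot B h)

end Graph

section Existence

variable {𝔤 : Type*} [LieRing 𝔤] [LieAlgebra ℂ 𝔤] [FiniteDimensional ℂ 𝔤] [IsSemisimple ℂ 𝔤]
  {H : LieSubalgebra ℂ 𝔤} [H.IsCartanSubalgebra]

/-- Chevalley anti-automorphisms exist. -/
theorem nonempty_chevalleyAntiAut (b : (rootSystem H).Base) : Nonempty (ChevalleyAntiAut H) := by
  obtain ⟨B⟩ := exists_basis b
  choose g hg using exists_mem_graphAlgebra B
  have key : ∀ {x y}, (x, y) ∈ graphAlgebra B → g x = y := fun h => graph_unique B (hg _) h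
  have hadd : ∀ x y, g (x + y) = g x + g y :=
    fun x y => key (by simpa using (graphAlgebra B).add_mem (hg x) (hg y))
  have hsmul : ∀ (c : ℂ) x, g (c • x) = c • g x :=
    fun c x => key (by simpa using (graphAlgebra B).smul_mem c (hg x))
  have hlie : ∀ x y, g ⁅x, y⁆ = ⁅g x, g y⁆ :=
    fun x y => key (by simpa using (graphAlgebra B).lie_mem (hg x) (hg y))
  have hinv : ∀ x, g (g x) = x := fun x => key (swap_mem_graphAlgebra B (hg x))
  have hneg : ∀ x, g (-x) = -g x := fun x => key (by simpa using (graphAlgebra B).neg_mem (hg x))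
  have hH : ∀ x ∈ H, g x = -x := by
    intro x hx
    have h1 : x ∈ H.toSubmodule := hx
    rw [B.coe_cartan_eq_span] at h1
    clear hx
    induction h1 using Submodule.span_induction with
    | mem x hx =>
      obtain ⟨i, rfl⟩ := hx
      exact key (graph_h B i)
    | zero => rw [neg_zero]; exact key (graphAlgebra B).zero_mem
    | add x y _ _ hx hy => rw [hadd, hx, hy, neg_add]
    | smul c x _ hx => rw [hsmul, hx, smul_neg]
  refine ⟨{ toLinearEquiv :=
              { toFun := fun x => -g x
                invFun := fun x => -g x
                map_add' := fun x y => by rw [hadd, neg_add]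
                map_smul' := fun c x => by rw [hsmul, RingHom.id_apply, smul_neg]
                left_inv := fun x => by dsimp only; rw [hneg, neg_neg, hinv]
                right_inv := fun x => by dsimp only; rw [hneg, neg_neg, hinv] }
            map_lie := fun x y => ?_
            map_cartan := fun h hh => ?_ }⟩
  · change -g ⁅x, y⁆ = ⁅-g y, -g x⁆
    rw [hlie, neg_lie, lie_neg, neg_neg, lie_skew]
  · change -g h = h
    rw [hH h hh, neg_neg]

end Existence

/-! ### The restricted duality `⋆` -/

section Duality

variable {𝔤 : Type*} [LieRing 𝔤] [LieAlgebra ℂ 𝔤] [FiniteDimensional ℂ 𝔤] [IsSemisimple ℂ 𝔤]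
  {H : LieSubalgebra ℂ 𝔤} [H.IsCartanSubalgebra]

/-- The linear functionals on `M` that vanish on all but finitely many weight spaces. If `M` is a
weight module, this is the direct sum over `μ ∈ 𝔥*` of the spaces `Hom(M_μ, ℂ)`, a functional on
`M_μ` being extended by zero to the other weight spaces. -/
def finiteFunctionals (H : LieSubalgebra ℂ 𝔤) [H.IsCartanSubalgebra]
    (M : Type*) [AddCommGroup M] [Module ℂ M] [LieRingModule 𝔤 M] [LieModule ℂ 𝔤 M] :
    Submodule ℂ (Dual ℂ M) where
  carrier := {f | {μ : Dual ℂ H | ∃ m ∈ weightSpace M (μ : H → ℂ), f m ≠ 0}.Finite}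
  zero_mem' := by simp
  add_mem' {f g} hf hg := (hf.union hg).subset fun μ ⟨m, hm, h⟩ => by
    by_contra hc
    simp only [Set.mem_union, Set.mem_ofPred_eq, not_or, not_exists, not_and, not_not] at hc
    exact h (by rw [LinearMap.add_apply, hc.1 m hm, hc.2 m hm, add_zero])
  smul_mem' c f hf := hf.subset fun μ ⟨m, hm, h⟩ =>
    ⟨m, hm, fun h0 => h (by rw [LinearMap.smul_apply, h0, smul_zero])⟩

variable {M : Type*} [AddCommGroup M] [Module ℂ M] [LieRingModule 𝔤 M] [LieModule ℂ 𝔤 M]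

lemma comp_toEnd_mem_finiteFunctionals {f : Dual ℂ M} (hf : f ∈ finiteFunctionals H M) (y : 𝔤) :
    f ∘ₗ toEnd ℂ 𝔤 M y ∈ finiteFunctionals H M := by
  have hy : y ∈ (⨆ χ : Weight ℂ H 𝔤, rootSpace H (χ : H → ℂ)) := by
    rw [iSup_genWeightSpace_eq_top']; trivial
  induction hy using LieSubmodule.iSup_induction' with
  | mem χ y hy =>
    refine Set.Finite.subset (hf.image fun μ => μ - χ.toLinear) ?_
    rintro μ ⟨m, hm, h⟩
    refine ⟨μ + χ.toLinear, ⟨⁅y, m⁆, ?_, h⟩, by simp⟩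
    rw [mem_weightSpace] at hm ⊢
    intro t
    have h1 := lie_eq_smul_of_mem_rootSpace hy t
    have h2 : ⁅(t : 𝔤), m⁆ = μ t • m := hm t
    change ⁅(t : 𝔤), ⁅y, m⁆⁆ = _
    have h3 : ⁅(t : 𝔤), y⁆ = χ t • y := h1
    rw [leibniz_lie, h3, h2, lie_smul, smul_lie, ← add_smul, add_comm]
    rfl
  | zero => simp
  | add y z _ _ hy hz =>
    rw [map_add, LinearMap.comp_add]
    exact add_mem hy hz

/-- The restricted dual `M^⋆` attached to a Chevalley anti-automorphism `θ`, on which `𝔤` acts by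
`(x f)(m) = f(θ(x) m)`. -/
def StarDual (_θ : ChevalleyAntiAut H) (M : Type*) [AddCommGroup M] [Module ℂ M]
    [LieRingModule 𝔤 M] [LieModule ℂ 𝔤 M] : Type _ :=
  finiteFunctionals H M

variable (θ : ChevalleyAntiAut H)

instance : AddCommGroup (StarDual θ M) := inferInstanceAs (AddCommGroup (finiteFunctionals H M))

instance : Module ℂ (StarDual θ M) := inferInstanceAs (Module ℂ (finiteFunctionals H M))

instance : LieRingModule 𝔤 (StarDual θ M) where
  bracket x f := ⟨f.1 ∘ₗ toEnd ℂ 𝔤 M (θ.toLinearEquiv x),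
    comp_toEnd_mem_finiteFunctionals f.2 _⟩
  add_lie x y f := by
    apply Subtype.ext; ext m
    change f.1 ⁅θ.toLinearEquiv (x + y), m⁆ =
      f.1 ⁅θ.toLinearEquiv x, m⁆ + f.1 ⁅θ.toLinearEquiv y, m⁆
    rw [map_add, add_lie, map_add]
  lie_add x f g := by
    apply Subtype.ext; ext m; rfl
  leibniz_lie x y f := by
    apply Subtype.ext; ext m
    change f.1 ⁅θ.toLinearEquiv y, ⁅θ.toLinearEquiv x, m⁆⁆ =
      f.1 ⁅θ.toLinearEquiv ⁅x, y⁆, m⁆ + f.1 ⁅θ.toLinearEquiv x, ⁅θ.toLinearEquiv y, m⁆⁆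
    rw [θ.map_lie, lie_lie, map_sub, sub_add_cancel]

instance : LieModule ℂ 𝔤 (StarDual θ M) where
  smul_lie c x f := by
    apply Subtype.ext; ext m
    change f.1 ⁅θ.toLinearEquiv (c • x), m⁆ = c • f.1 ⁅θ.toLinearEquiv x, m⁆
    rw [map_smul, smul_lie, map_smul]
  lie_smul c x f := by
    apply Subtype.ext; ext m; rfl

/-- The dual Verma module `∇(μ) = Δ(μ)^⋆`. -/
abbrev DualVerma (b : (rootSystem H).Base) (θ : ChevalleyAntiAut H) (μ : Dual ℂ H) : Type _ :=
  StarDual θ (Verma b μ)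

end Duality

/-! ### Filtrations -/

section Filtrations

variable {𝔤 : Type*} [LieRing 𝔤] [LieAlgebra ℂ 𝔤]

/-- A (possibly infinite) filtration `0 = M₀ ⊆ M₁ ⊆ M₂ ⊆ ⋯` with union `M`, each of whose
subquotients `M_{i+1} / M_i` either vanishes or is isomorphic to a member of the family `X`. -/
structure Filtration {Λ : Type*} (X : Λ → Type*)
    [∀ μ, AddCommGroup (X μ)] [∀ μ, Module ℂ (X μ)]
    [∀ μ, LieRingModule 𝔤 (X μ)] [∀ μ, LieModule ℂ 𝔤 (X μ)]
    (M : Type*) [AddCommGroup M] [Module ℂ M] [LieRingModule 𝔤 M] [LieModule ℂ 𝔤 M] where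
  /-- the terms of the filtration -/
  step : ℕ → LieSubmodule ℂ 𝔤 M
  step_zero : step 0 = ⊥
  monotone : Monotone step
  exhaustive : ∀ m : M, ∃ i, m ∈ step i
  /-- the indices of the nonzero subquotients -/
  proper : Set ℕ
  /-- the labels of the nonzero subquotients -/
  label : proper → Λ
  step_eq : ∀ i ∉ proper, step (i + 1) = step i
  subquotient : ∀ i : proper, Nonempty
    ((step (i + 1) ⧸ (step i).comap (step (i + 1)).incl) ≃ₗ⁅ℂ, 𝔤⁆ X (label i))

end Filtrations

section FTilde

variable {𝔤 : Type*} [LieRing 𝔤] [LieAlgebra ℂ 𝔤] [FiniteDimensional ℂ 𝔤] [IsSemisimple ℂ 𝔤]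
  {H : LieSubalgebra ℂ 𝔤} [H.IsCartanSubalgebra] (b : (rootSystem H).Base)
  (θ : ChevalleyAntiAut H)
  (M : Type*) [AddCommGroup M] [Module ℂ M] [LieRingModule 𝔤 M] [LieModule ℂ 𝔤 M]

/-- `M` is an object of `F̃(Δ)`: it is in `Õ` and has a Verma filtration. -/
def IsVermaFiltered : Prop :=
  IsOTilde b M ∧ Nonempty (Filtration (𝔤 := 𝔤) (Verma b) M)

/-- `M` is an object of `F̃(∇)`: it is in `Õ` and has a dual Verma filtration. -/
def IsDualVermaFiltered : Prop :=
  IsOTilde b M ∧ Nonempty (Filtration (𝔤 := 𝔤) (DualVerma b θ) M)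

/-- `M` is a tilting module in `Õ`. -/
def IsTilting : Prop := IsVermaFiltered b M ∧ IsDualVermaFiltered b θ M

end FTilde

/-- `M` is free as a module over `U(𝔞)`, where `𝔞` is a Lie subalgebra of `𝔤`. -/
def IsFreeOver {𝔤 : Type*} [LieRing 𝔤] [LieAlgebra ℂ 𝔤] (𝔞 : LieSubalgebra ℂ 𝔤)
    (M : Type*) [AddCommGroup M] [Module ℂ M] [LieRingModule 𝔤 M] [LieModule ℂ 𝔤 M] : Prop :=
  letI : Module (UniversalEnvelopingAlgebra ℂ 𝔞) M :=
    Module.compHom M (UniversalEnvelopingAlgebra.lift ℂ (toEnd ℂ 𝔞 M)).toRingHom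
  Module.Free (UniversalEnvelopingAlgebra ℂ 𝔞) M

end CatO

end

noncomputable section

namespace CatO

universe w

/-! ### Modules over enveloping algebras -/

section Enveloping

variable {L : Type*} [LieRing L] [LieAlgebra ℂ L]
  {M : Type*} [AddCommGroup M] [Module ℂ M] [LieRingModule L M] [LieModule ℂ L M]
  {N : Type*} [AddCommGroup N] [Module ℂ N] [LieRingModule L N] [LieModule ℂ L N]

/-! The proof turns both filtration conditions into freeness over `U(𝔫₋)`. A module of `Õ` has a
Verma filtration exactly when it is free over `U(𝔫₋)` (`isVermaFiltered_iff`), and a dual Verma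
filtration exactly when its restricted dual is free over `U(𝔫₋)` (`isDualVermaFiltered_iff`).
Freeness survives tensoring with an arbitrary module by the tensor identity `N ⊗ M ≅ N ⊗ M_triv` for
free `N` (`lieFree_tensor`). Since `(M ⊗ N)^⋆ ≅ M^⋆ ⊗ N^⋆` in `Õ` (`nonempty_star_tensor`), the four
closure properties and the tilting part of the fifth follow at once.

From filtration to freeness: a Verma module is free of rank one over `U(𝔫₋)`, proved by letting `𝔤`
act on `U(𝔫₋)` itself (`exists_model`, `verma_bijective`). Lifts of the highest weight vectors of
the subquotients then form a basis. For a dual Verma filtration the same is done with the decreasing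
filtration of the restricted dual by annihilators, one weight space at a time.

From freeness to filtration: a free module `D` of `Õ` has a `U(𝔫₋)`-basis of weight vectors that lie
in generalized eigenspaces of the Casimir operator (`exists_goodBasis`). It consists of bases of
complements of `𝔫₋ D`, and a Nakayama argument gives independence. A positive root vector moves a
basis element into the span of those with the same eigenvalue and strictly greater height. Sets of
labels closed under this relation therefore span submodules, and adding one label adds one Verma
module. The eigenvalue attached to a basis element of weight `λ` must be `(λ, λ + 2ρ)`, which takes
a given value at only finitely many weights of `D`. So every block is finite and the labels can be
numbered by `ℕ` compatibly with the order, in either direction. Greater heights first gives a Verma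
filtration of `D`. Lesser heights first, applied to `D = M^⋆`, gives a dual Verma filtration of `M`
by taking annihilators. In that direction the Casimir operator is essential, because weights extend
infinitely far downwards.

The direct sum decomposition is a splitting statement. If `0 → X → Y → Z → 0` is exact in `Õ`, `Z`
has a Verma filtration and `X^⋆` is free over `U(𝔫₋)`, then the sequence splits
(`Filtration.exists_section`). A section over `𝔫₋` of `Y^⋆ → X^⋆` allows highest weight vectors of
`Z` to be lifted to `Y` (`IsHighest.exists_lift`), and Verma modules map out of such vectors.
Tensored with `N`, each step of a Verma filtration of `M` has quotient `Δ(λ) ⊗ N`, which is Verma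
filtered, and a kernel whose dual is free. Hence `M ⊗ N` is the direct sum of the `Δ(λᵢ) ⊗ N`. The
same argument along the filtration of `N` breaks up each `Δ(λᵢ) ⊗ N`. -/

variable (L) in
/-- The enveloping algebra over `ℂ`. -/
abbrev Env : Type _ := UniversalEnvelopingAlgebra ℂ L

variable (L M) in
/-- The action of the enveloping algebra on a Lie module. -/
def uact : Env L →ₐ[ℂ] End ℂ M := UniversalEnvelopingAlgebra.lift ℂ (toEnd ℂ L M)

variable (L M) in
/-- A Lie module as a module over the enveloping algebra. -/
abbrev uModule : Module (Env L) M :=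
  Module.compHom M (UniversalEnvelopingAlgebra.lift ℂ (toEnd ℂ L M)).toRingHom

variable (L M) in
/-- `M` is free over the enveloping algebra of `L`. -/
def LieFree : Prop :=
  letI := uModule L M
  Module.Free (Env L) M

/-- The canonical map from `L` to its enveloping algebra. -/
abbrev env (x : L) : Env L := UniversalEnvelopingAlgebra.ι ℂ x

@[simp]
lemma uact_env (x : L) (m : M) : uact L M (env x) m = ⁅x, m⁆ := by
  rw [uact, UniversalEnvelopingAlgebra.lift_ι_apply]; rfl

lemma uact_env_mul (x : L) (u : Env L) (m : M) :
    uact L M (env x * u) m = ⁅x, uact L M u m⁆ := by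
  rw [map_mul, Module.End.mul_apply, uact_env]

/-- The universal property gives an algebra map into `S` that restricts to the inclusion of `L`;
composed with `S ⊆ Env L` it is the identity by uniqueness. -/
lemma env_subalgebra_eq_top (S : Subalgebra ℂ (Env L)) (h : ∀ x : L, env x ∈ S) : S = ⊤ := by
  let := LieRing.ofAssociativeRing (A := Env L)
  let := LieRing.ofAssociativeRing (A := S)
  let f : L →ₗ⁅ℂ⁆ S :=
    { toFun := fun x => ⟨env x, h x⟩
      map_add' := fun x y => by ext; simp [env]
      map_smul' := fun c x => by ext; simp [env]
      map_lie' := fun {x y} => by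
        apply Subtype.ext
        change env ⁅x, y⁆ = env x * env y - env y * env x
        rw [env, LieHom.map_lie, LieRing.of_associative_ring_bracket] }
  have h1 : S.val.comp (UniversalEnvelopingAlgebra.lift ℂ f) = AlgHom.id ℂ (Env L) := by
    apply UniversalEnvelopingAlgebra.hom_ext
    ext x
    change S.val (UniversalEnvelopingAlgebra.lift ℂ f (env x)) = env x
    rw [UniversalEnvelopingAlgebra.lift_ι_apply]
    rfl
  rw [eq_top_iff]
  intro u _
  have h2 := DFunLike.congr_fun h1 u
  rw [AlgHom.id_apply] at h2
  rw [← h2]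
  exact (UniversalEnvelopingAlgebra.lift ℂ f u).2

/-- A subspace of the enveloping algebra that contains `1` and is stable under left multiplication
by `L` is everything. -/
lemma env_eq_top (P : Submodule ℂ (Env L)) (h1 : (1 : Env L) ∈ P)
    (h : ∀ (x : L) (u : Env L), u ∈ P → env x * u ∈ P) (u : Env L) : u ∈ P := by
  -- The elements whose left multiplication preserves `P` form a subalgebra containing `L`, hence
  -- everything; apply one of them to `1`.
  let S : Subalgebra ℂ (Env L) :=
    { carrier := {a | ∀ v ∈ P, a * v ∈ P}
      mul_mem' := fun {a b} ha hb v hv => by rw [mul_assoc]; exact ha _ (hb _ hv)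
      add_mem' := fun {a b} ha hb v hv => by rw [add_mul]; exact P.add_mem (ha _ hv) (hb _ hv)
      algebraMap_mem' := fun c v hv => by
        rw [← Algebra.smul_def]; exact P.smul_mem c hv }
  have hS : S = ⊤ := env_subalgebra_eq_top S fun x v hv => h x v hv
  have : u ∈ S := by rw [hS]; trivial
  simpa using this 1 h1

lemma map_uact (f : M →ₗ[ℂ] N) (hf : ∀ (x : L) m, f ⁅x, m⁆ = ⁅x, f m⁆) (u : Env L) (m : M) :
    f (uact L M u m) = uact L N u (f m) := by
  refine env_eq_top
    (LinearMap.ker (((LinearMap.llcomp ℂ M M N f) ∘ₗ (uact L M).toLinearMap) -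
      ((LinearMap.lcomp ℂ N f) ∘ₗ (uact L N).toLinearMap))) ?_ ?_ u |>
    fun h => sub_eq_zero.mp (LinearMap.congr_fun (LinearMap.mem_ker.mp h) m)
  · rw [LinearMap.mem_ker]
    ext m
    simp
  · intro x u hu
    rw [LinearMap.mem_ker] at hu ⊢
    ext m
    have h1 := sub_eq_zero.mp (LinearMap.congr_fun hu m)
    change f (uact L M u m) = uact L N u (f m) at h1
    change f (uact L M (env x * u) m) - uact L N (env x * u) (f m) = 0
    rw [uact_env_mul, uact_env_mul, hf, h1, sub_self]

/-- A subspace stable under `L` is stable under the enveloping algebra. -/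
lemma uact_mem (P : Submodule ℂ M) (h : ∀ (x : L), ∀ m ∈ P, ⁅x, m⁆ ∈ P) (u : Env L) {m : M}
    (hm : m ∈ P) : uact L M u m ∈ P := by
  refine env_eq_top (P.comap ((uact L M).toLinearMap.flip m)) ?_ ?_ u
  · simpa using hm
  · intro x u hu
    change uact L M (env x * u) m ∈ P
    rw [uact_env_mul]
    exact h x _ hu

/-- A linear map commuting with `L` is linear over the enveloping algebra. -/
def toULinear (f : M →ₗ[ℂ] N) (hf : ∀ (x : L) m, f ⁅x, m⁆ = ⁅x, f m⁆) :
    letI := uModule L M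
    letI := uModule L N
    M →ₗ[Env L] N :=
  letI := uModule L M
  letI := uModule L N
  { toFun := f
    map_add' := f.map_add
    map_smul' := fun u m => map_uact f hf u m }

/-- A map linear over the enveloping algebra is a morphism of Lie modules. -/
def ofULinear (f : letI := uModule L M; letI := uModule L N; M →ₗ[Env L] N) : M →ₗ⁅ℂ,L⁆ N :=
  letI := uModule L M
  letI := uModule L N
  { toFun := f
    map_add' := f.map_add
    map_smul' := fun c m => by
      have h : ∀ (P : Type _) [AddCommGroup P] [Module ℂ P] [LieRingModule L P]
          [LieModule ℂ L P] (p : P), c • p = uact L P (algebraMap ℂ _ c) p := by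
        intro P _ _ _ _ p
        rw [AlgHom.commutes]; rfl
      rw [RingHom.id_apply, h M]
      refine (f.map_smul (algebraMap ℂ _ c) m).trans ?_
      change uact L N (algebraMap ℂ _ c) (f m) = _
      rw [AlgHom.commutes]; rfl
    map_lie' := fun {x m} => by
      have h := f.map_smul (env x) m
      change f (uact L M (env x) m) = uact L N (env x) (f m) at h
      rwa [uact_env, uact_env] at h }

lemma LieFree.of_equiv (e : M ≃ₗ[ℂ] N) (he : ∀ (x : L) m, e ⁅x, m⁆ = ⁅x, e m⁆)
    (h : LieFree L M) : LieFree L N := by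
  let := uModule L M
  let := uModule L N
  have : Module.Free (Env L) M := h
  exact Module.Free.of_equiv
    (LinearEquiv.ofBijective (toULinear e.toLinearMap he) e.bijective)

/-- Free modules are projective. Applied to restricted duals over `𝔫₋`, this supplies the section
used to lift highest weight vectors. -/
lemma LieFree.exists_section (hN : LieFree L N) (f : M →ₗ⁅ℂ,L⁆ N) (hf : Function.Surjective f) :
    ∃ s : N →ₗ⁅ℂ,L⁆ M, ∀ n, f (s n) = n := by
  let := uModule L M
  let := uModule L N
  have : Module.Free (Env L) N := hN
  obtain ⟨s, hs⟩ := Module.projective_lifting_property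
    (toULinear f.toLinearMap fun x m => f.map_lie x m) LinearMap.id hf
  exact ⟨ofULinear s, fun n => LinearMap.congr_fun hs n⟩

/-- The combination of a family of elements with coefficients in the enveloping algebra. -/
def ucomb {I : Type*} (v : I → M) : (I →₀ Env L) →ₗ[ℂ] M :=
  Finsupp.lsum ℂ fun i => (uact L M).toLinearMap.flip (v i)

lemma ucomb_apply {I : Type*} (v : I → M) (r : I →₀ Env L) :
    ucomb v r = r.sum fun i u => uact L M u (v i) := rfl

@[simp]
lemma ucomb_single {I : Type*} (v : I → M) (i : I) (u : Env L) :
    ucomb v (Finsupp.single i u) = uact L M u (v i) := by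
  simp [ucomb]

lemma LieFree.of_bijective {I : Type*} (v : I → M)
    (h : Function.Bijective (ucomb (L := L) v)) : LieFree L M := by
  let := uModule L M
  have h1 : ∀ r, Finsupp.linearCombination (Env L) v r = ucomb v r := fun r => rfl
  exact Module.Free.of_equiv (LinearEquiv.ofBijective (Finsupp.linearCombination (Env L) v) h)

lemma LieFree.exists_bijective {M : Type w} [AddCommGroup M] [Module ℂ M] [LieRingModule L M]
    [LieModule ℂ L M] (h : LieFree L M) :
    ∃ (I : Type w) (v : I → M), Function.Bijective (ucomb (L := L) v) := by
  let := uModule L M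
  have : Module.Free (Env L) M := h
  let b := Module.Free.chooseBasis (Env L) M
  refine ⟨Module.Free.ChooseBasisIndex (Env L) M, b, ?_⟩
  have h1 : (ucomb (L := L) b : _ → M) = b.repr.symm := by
    ext r
    rw [Module.Basis.repr_symm_apply]; rfl
  rw [h1]
  exact b.repr.symm.bijective

/-- The augmentation: every element of the enveloping algebra is a scalar plus an element of
`L · U(L)`. -/
lemma env_eq_algebraMap_add (u : Env L) : ∃ c : ℂ,
    u - algebraMap ℂ _ c ∈ Submodule.span ℂ {w | ∃ (x : L) (v : Env L), w = env x * v} := by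
  have := env_eq_top (L := L) (LinearMap.range (Algebra.linearMap ℂ (Env L)) ⊔
    Submodule.span ℂ {w | ∃ (x : L) (v : Env L), w = env x * v}) ?_ ?_ u
  · obtain ⟨_, ⟨c, rfl⟩, w, hw, rfl⟩ := Submodule.mem_sup.mp this
    exact ⟨c, by simpa using hw⟩
  · exact Submodule.mem_sup_left ⟨1, by simp⟩
  · intro x u _
    exact Submodule.mem_sup_right (Submodule.subset_span ⟨x, u, rfl⟩)

/-- A version of Nakayama's lemma: a generating family of a free module is a basis if the
coefficients of its relations lie in the first step of a separated filtration. -/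
lemma ucomb_injective_of_filtration (hM : LieFree L M) {I : Type*} (v : I → M)
    (hv : Function.Surjective (ucomb (L := L) v)) (G : ℕ → AddSubgroup (Env L))
    (hG0 : G 0 = ⊤)
    (hmul : ∀ k, ∀ a ∈ G k, ∀ b ∈ G 1, a * b ∈ G (k + 1)) (hG : ∀ a, (∀ k, a ∈ G k) → a = 0)
    (hker : ∀ r, ucomb (L := L) v r = 0 → ∀ i, r i ∈ G 1) :
    Function.Injective (ucomb (L := L) v) := by
  let := uModule L M
  have : Module.Free (Env L) M := hM
  let p : (I →₀ Env L) →ₗ[Env L] M := Finsupp.linearCombination (Env L) v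
  have hp : ∀ r, p r = ucomb v r := fun r => rfl
  obtain ⟨s, hs⟩ := Module.projective_lifting_property p LinearMap.id (fun m => hv m)
  -- A projector onto the kernel of `p`. It sends each basis vector to a relation, so its matrix
  -- entries lie in `G 1`. A relation `r` satisfies `r = e r`, so entries in `G k` are automatically
  -- in `G (k + 1)`.
  let e : (I →₀ Env L) →ₗ[Env L] (I →₀ Env L) := LinearMap.id - s ∘ₗ p
  have hpe : ∀ r, p (e r) = 0 := by
    intro r
    have h1 := LinearMap.congr_fun hs (p r)
    change p (s (p r)) = p r at h1
    change p (r - s (p r)) = 0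
    rw [map_sub, h1, sub_self]
  rw [injective_iff_map_eq_zero]
  intro r hr
  have her : e r = r := by
    change r - s (p r) = r
    rw [hp, hr, map_zero, sub_zero]
  have key : ∀ k i, r i ∈ G k := by
    intro k
    induction k with
    | zero => intro i; rw [hG0]; trivial
    | succ k ih =>
      intro i
      rw [← her]
      have h2 : e r = r.sum fun j a => a • e (Finsupp.single j 1) := by
        conv_lhs => rw [← Finsupp.sum_single r]
        rw [map_finsuppSum]
        refine Finsupp.sum_congr fun j _ => ?_
        rw [← map_smul, Finsupp.smul_single, smul_eq_mul, mul_one]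
      rw [h2, Finsupp.sum, Finsupp.finsetSum_apply]
      refine sum_mem fun j _ => ?_
      rw [Finsupp.smul_apply, smul_eq_mul]
      exact hmul k _ (ih j) _ (hker _ (hpe _) i)
  ext i
  exact hG _ fun k => key k i

end Enveloping

/-! ### Tensor products with free modules -/

section TensorFree

variable {L : Type*} [LieRing L] [LieAlgebra ℂ L]
  {M : Type*} [AddCommGroup M] [Module ℂ M]
  {N : Type*} [AddCommGroup N] [Module ℂ N] [LieRingModule L N] [LieModule ℂ L N]
  {Z : Type*} [AddCommGroup Z] [Module ℂ Z] [LieRingModule L Z] [LieModule ℂ L Z]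

lemma lieHom_ext_of_surjective {I : Type*} {v : I → N}
    (hv : Function.Surjective (ucomb (L := L) v)) (f g : N →ₗ⁅ℂ,L⁆ Z)
    (h : ∀ i, f (v i) = g (v i)) : f = g := by
  ext n
  obtain ⟨r, rfl⟩ := hv n
  induction r using Finsupp.induction_linear with
  | zero => simp
  | add a b ha hb => rw [map_add, map_add, map_add, ha, hb]
  | single i u =>
    rw [ucomb_single]
    have hf := map_uact (f : N →ₗ[ℂ] Z) (fun x m => f.map_lie x m) u (v i)
    have hg := map_uact (g : N →ₗ[ℂ] Z) (fun x m => g.map_lie x m) u (v i)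
    rw [LieModuleHom.coe_toLinearMap] at hf hg
    rw [hf, hg, h]

lemma exists_lieHom_of_bijective {I : Type*} {v : I → N}
    (hv : Function.Bijective (ucomb (L := L) v)) (z : I → Z) :
    ∃ f : N →ₗ⁅ℂ,L⁆ Z, ∀ i, f (v i) = z i := by
  let := uModule L N
  let := uModule L Z
  let e := LinearEquiv.ofBijective (Finsupp.linearCombination (Env L) v) hv
  refine ⟨ofULinear (Finsupp.linearCombination (Env L) z ∘ₗ e.symm.toLinearMap), fun i => ?_⟩
  have h1 : e.symm (v i) = Finsupp.single i 1 := by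
    rw [LinearEquiv.symm_apply_eq]
    change v i = Finsupp.linearCombination (Env L) v (Finsupp.single i 1)
    rw [Finsupp.linearCombination_single, one_smul]
  change Finsupp.linearCombination (Env L) z (e.symm (v i)) = z i
  rw [h1, Finsupp.linearCombination_single, one_smul]

/-- With a trivial second factor the enveloping algebra acts on the first factor only, so products
of a `U(L)`-basis and a `ℂ`-basis form a basis. -/
lemma lieFree_tensor_trivial (hN : LieFree L N) :
    LieFree L (N ⊗[ℂ] TrivialLieModule ℂ L M) := by
  let := uModule L N
  have : Module.Free (Env L) N := hN
  have : IsScalarTower ℂ (Env L) N := ⟨fun c u n => by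
    change uact L N (c • u) n = c • uact L N u n
    rw [map_smul]; rfl⟩
  let b := Module.Free.chooseBasis (Env L) N
  let c := Module.Free.chooseBasis ℂ (TrivialLieModule ℂ L M)
  let B := b.tensorProduct c
  apply LieFree.of_bijective B
  have h1 : ∀ (u : Env L) (n : N) (m : TrivialLieModule ℂ L M),
      uact L (N ⊗[ℂ] TrivialLieModule ℂ L M) u (n ⊗ₜ m) = (uact L N u n) ⊗ₜ m := by
    intro u n m
    have := map_uact ((TensorProduct.mk ℂ N (TrivialLieModule ℂ L M)).flip m) (L := L)
      (fun x n => by simp [LieModule.IsTrivial.trivial]) u n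
    exact this.symm
  have h2 : (ucomb (L := L) B : _ → N ⊗[ℂ] TrivialLieModule ℂ L M) = B.repr.symm := by
    ext r
    rw [Module.Basis.repr_symm_apply, ucomb_apply, Finsupp.linearCombination_apply]
    refine Finsupp.sum_congr fun i _ => ?_
    rw [Module.Basis.tensorProduct_apply, h1, TensorProduct.smul_tmul']
    rfl
  rw [h2]
  exact B.repr.symm.bijective

variable [LieRingModule L M] [LieModule ℂ L M]

/-- The tensor identity `N ⊗ M ≅ N ⊗ M_triv`. By freeness of `N`, equivariant maps from `N` into a
Hom space are given by arbitrary values on the basis `v`. The prescriptions `v i ⊗ m ↦ v i ⊗ m` in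
both directions therefore extend to morphisms, which are mutually inverse because they are so on `v
i ⊗ m`. -/
lemma lieFree_tensor_of_left (hN : LieFree L N) : LieFree L (N ⊗[ℂ] M) := by
  obtain ⟨I, v, hv⟩ := hN.exists_bijective
  let T := TrivialLieModule ℂ L M
  let t : M ≃ₗ[ℂ] T := (TrivialLieModule.equiv ℂ L M).symm
  obtain ⟨φ, hφ⟩ := exists_lieHom_of_bijective hv (Z := T →ₗ[ℂ] N ⊗[ℂ] M)
    fun i => TensorProduct.mk ℂ N M (v i) ∘ₗ t.symm.toLinearMap
  obtain ⟨ψ, hψ⟩ := exists_lieHom_of_bijective hv (Z := M →ₗ[ℂ] N ⊗[ℂ] T)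
    fun i => TensorProduct.mk ℂ N T (v i) ∘ₗ t.toLinearMap
  let Φ := TensorProduct.LieModule.liftLie ℂ L N T (N ⊗[ℂ] M) φ
  let Ψ := TensorProduct.LieModule.liftLie ℂ L N M (N ⊗[ℂ] T) ψ
  have hΦ : ∀ i m, Φ (v i ⊗ₜ m) = v i ⊗ₜ t.symm m := fun i m => by
    simp only [Φ]
    rw [TensorProduct.LieModule.liftLie_apply, hφ]; rfl
  have hΨ : ∀ i m, Ψ (v i ⊗ₜ m) = v i ⊗ₜ t m := fun i m => by
    simp only [Ψ]
    rw [TensorProduct.LieModule.liftLie_apply, hψ]; rfl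
  have h1 : Ψ.comp Φ = LieModuleHom.id := by
    apply (TensorProduct.LieModule.liftLie ℂ L N T (N ⊗[ℂ] T)).symm.injective
    apply lieHom_ext_of_surjective hv.2
    intro i
    ext m
    rw [← TensorProduct.LieModule.liftLie_apply, ← TensorProduct.LieModule.liftLie_apply,
      LinearEquiv.apply_symm_apply, LinearEquiv.apply_symm_apply]
    rw [LieModuleHom.comp_apply, hΦ, hΨ, LinearEquiv.apply_symm_apply, LieModuleHom.id_apply]
  have h2 : Φ.comp Ψ = LieModuleHom.id := by
    apply (TensorProduct.LieModule.liftLie ℂ L N M (N ⊗[ℂ] M)).symm.injective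
    apply lieHom_ext_of_surjective hv.2
    intro i
    ext m
    rw [← TensorProduct.LieModule.liftLie_apply, ← TensorProduct.LieModule.liftLie_apply,
      LinearEquiv.apply_symm_apply, LinearEquiv.apply_symm_apply]
    rw [LieModuleHom.comp_apply, hΨ, hΦ, LinearEquiv.symm_apply_apply, LieModuleHom.id_apply]
  let e : (N ⊗[ℂ] T) ≃ₗ[ℂ] (N ⊗[ℂ] M) := LinearEquiv.ofLinearMap Φ.toLinearMap Ψ.toLinearMap
    (by ext1; ext n m; exact DFunLike.congr_fun h2 (n ⊗ₜ m))
    (by ext1; ext n m; exact DFunLike.congr_fun h1 (n ⊗ₜ m))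
  exact (lieFree_tensor_trivial hN).of_equiv e fun x m => Φ.map_lie x m

/-- The tensor product of any module with a free module is free. -/
theorem lieFree_tensor (hN : LieFree L N) : LieFree L (M ⊗[ℂ] N) :=
  (lieFree_tensor_of_left hN).of_equiv (TensorProduct.comm ℂ N M) fun x t => by
    induction t using TensorProduct.induction_on with
    | zero => simp
    | tmul n m => simp [add_comm]
    | add a b ha hb => rw [lie_add, map_add, ha, hb, map_add, lie_add]

end TensorFree

section Restriction

variable {𝔤 : Type*} [LieRing 𝔤] [LieAlgebra ℂ 𝔤] (𝔞 : LieSubalgebra ℂ 𝔤)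
  {M : Type*} [AddCommGroup M] [Module ℂ M] [LieRingModule 𝔤 M] [LieModule ℂ 𝔤 M]
  {N : Type*} [AddCommGroup N] [Module ℂ N] [LieRingModule 𝔤 N] [LieModule ℂ 𝔤 N]

/-- Two actions of `𝔞` on the tensor product meet here: the restriction of the diagonal action of
`𝔤`, and the diagonal action of `𝔞`. They agree by definition, so the identity map transports
freeness. -/
theorem isFreeOver_tensor (hN : LieFree 𝔞 N) : LieFree 𝔞 (M ⊗[ℂ] N) := by
  have h := lieFree_tensor (M := M) hN
  refine @LieFree.of_equiv 𝔞 _ _ (M ⊗[ℂ] N) _ _ TensorProduct.LieModule.lieRingModule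
    TensorProduct.LieModule.lieModule (M ⊗[ℂ] N) _ _ _ _ (LinearEquiv.refl ℂ _) ?_ h
  intro x m
  rfl

end Restriction

/-! ### Induced modules without the Poincaré–Birkhoff–Witt theorem -/

section Induced

attribute [local instance 100] LieRing.ofAssociativeRing

variable {𝔤 : Type*} [LieRing 𝔤] [LieAlgebra ℂ 𝔤] (A : LieSubalgebra ℂ 𝔤)

lemma env_lie {L : Type*} [LieRing L] [LieAlgebra ℂ L] (x y : L) :
    env ⁅x, y⁆ = env x * env y - env y * env x := by
  rw [env, LieHom.map_lie, LieRing.of_associative_ring_bracket]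

/-- The action of `A` on `Hom(𝔤, U(A))`, where `A` acts on `U(A)` by left multiplication. -/
def homAction : A →ₗ⁅ℂ⁆ End ℂ (𝔤 →ₗ[ℂ] Env A) where
  toFun y :=
    { toFun := fun f => LinearMap.mulLeft ℂ (env y) ∘ₗ f - f ∘ₗ toEnd ℂ 𝔤 𝔤 (y : 𝔤)
      map_add' := fun f g => by ext x; simp [mul_add]; abel
      map_smul' := fun c f => by ext x; simp [smul_sub] }
  map_add' y z := by ext f x; simp [env, add_mul]; abel
  map_smul' c y := by ext f x; simp [env, smul_sub]
  map_lie' {y z} := by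
    ext f x
    simp only [LieRing.of_associative_ring_bracket, LinearMap.sub_apply, Module.End.mul_apply,
      LinearMap.coe_mk, AddHom.coe_mk, LinearMap.comp_apply, LinearMap.mulLeft_apply,
      toEnd_apply_apply, LieSubalgebra.coe_bracket, lie_lie, map_sub, env_lie, sub_mul, mul_assoc]
    abel

lemma homAction_apply (y : A) (f : 𝔤 →ₗ[ℂ] Env A) (x : 𝔤) :
    homAction A y f x = env y * f x - f ⁅(y : 𝔤), x⁆ := rfl

variable (pr : 𝔤 →ₗ[ℂ] A) (χ : 𝔤 →ₗ[ℂ] ℂ)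

/-- The operator by which `x : 𝔤` acts on the model `U(A)` of an induced module. -/
def modelAction : 𝔤 →ₗ[ℂ] End ℂ (Env A) :=
  -- The required rule `x·(y u) = y (x·u) - [y, x]·u` for `y ∈ A` says that `u ↦ (x ↦ x·u)` is
  -- equivariant from `U(A)` to `Hom(𝔤, U(A))` with the action `homAction`. It is thus determined by
  -- the value at `u = 1`, which is taken to be `x ↦ pr x + χ x`.
  ((LinearMap.applyₗ
    ((UniversalEnvelopingAlgebra.ι ℂ : A →ₗ⁅ℂ⁆ Env A).toLinearMap ∘ₗ pr +
      (Algebra.linearMap ℂ (Env A)) ∘ₗ χ)) ∘ₗ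
    (UniversalEnvelopingAlgebra.lift ℂ (homAction A)).toLinearMap).flip

lemma modelAction_one (x : 𝔤) :
    modelAction A pr χ x 1 = env (pr x) + algebraMap ℂ _ (χ x) := by
  simp only [modelAction, LinearMap.flip_apply, LinearMap.comp_apply, AlgHom.toLinearMap_apply,
    map_one, LinearMap.applyₗ_apply_apply]
  rfl

lemma modelAction_mul (x : 𝔤) (y : A) (u : Env A) :
    modelAction A pr χ x (env y * u) =
      env y * modelAction A pr χ x u - modelAction A pr χ ⁅(y : 𝔤), x⁆ u := by
  simp only [modelAction, LinearMap.flip_apply, LinearMap.comp_apply, AlgHom.toLinearMap_apply,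
    map_mul, LinearMap.applyₗ_apply_apply, Module.End.mul_apply]
  rw [UniversalEnvelopingAlgebra.lift_ι_apply, homAction_apply]

variable {A pr χ} (hpr : ∀ a : A, pr a = a) (hχ : ∀ a : A, χ a = 0)
include hpr hχ

lemma modelAction_coe (a : A) (u : Env A) : modelAction A pr χ a u = env a * u := by
  have key : ∀ u : Env A, u ∈ (⨅ a : A, LinearMap.ker (modelAction A pr χ a -
      LinearMap.mulLeft ℂ (env a))) := by
    refine env_eq_top _ ?_ ?_
    · rw [Submodule.mem_iInf]
      intro a
      rw [LinearMap.mem_ker, LinearMap.sub_apply, modelAction_one, hpr, hχ]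
      simp
    · intro y u hu
      rw [Submodule.mem_iInf] at hu ⊢
      have hu' : ∀ a : A, modelAction A pr χ a u = env a * u :=
        fun a => sub_eq_zero.mp (LinearMap.mem_ker.mp (hu a))
      intro a
      rw [LinearMap.mem_ker, LinearMap.sub_apply, modelAction_mul, hu', ← LieSubalgebra.coe_bracket,
        hu', env_lie]
      simp only [LinearMap.mulLeft_apply]
      noncomm_ring
  exact sub_eq_zero.mp (LinearMap.mem_ker.mp ((Submodule.mem_iInf _).mp (key u) a))

/-- Both sides obey the same commutation rule with left multiplication by `A`, so it suffices to
take `u = 1`. There `𝔤` is split as `A ⊕ ker pr`. If one argument lies in `A` the identity is the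
defining rule; if both lie in `ker pr`, they act on `1` by scalars and `χ` kills their bracket. -/
lemma modelAction_lie (hB : ∀ x y, pr x = 0 → pr y = 0 → pr ⁅x, y⁆ = 0)
    (hχB : ∀ x y, pr x = 0 → pr y = 0 → χ ⁅x, y⁆ = 0) (x y : 𝔤) (u : Env A) :
    modelAction A pr χ ⁅x, y⁆ u = modelAction A pr χ x (modelAction A pr χ y u) -
      modelAction A pr χ y (modelAction A pr χ x u) := by
  set D := modelAction A pr χ with hD
  have hA : ∀ (x : 𝔤) (a : A), D ⁅x, (a : 𝔤)⁆ 1 = D x (D a 1) - D a (D x 1) := by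
    intro x a
    rw [hD, modelAction_coe hpr hχ, modelAction_mul, modelAction_coe hpr hχ, sub_sub_cancel_left,
      ← lie_skew, map_neg, LinearMap.neg_apply]
  have hBB : ∀ x y, pr x = 0 → pr y = 0 → D ⁅x, y⁆ 1 = D x (D y 1) - D y (D x 1) := by
    intro x y hx hy
    have h1 : ∀ z, pr z = 0 → D z 1 = χ z • (1 : Env A) := by
      intro z hz
      rw [hD, modelAction_one, hz, env, map_zero, zero_add, Algebra.algebraMap_eq_smul_one]
    rw [h1 _ (hB x y hx hy), hχB x y hx hy, h1 x hx, h1 y hy, map_smul, map_smul, h1 x hx, h1 y hy,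
      smul_smul, smul_smul, mul_comm, sub_self, zero_smul]
  have hone : ∀ x y, D ⁅x, y⁆ 1 = D x (D y 1) - D y (D x 1) := by
    intro x y
    have hx : x = (pr x : 𝔤) + (x - pr x) := by abel
    have hy : y = (pr y : 𝔤) + (y - pr y) := by abel
    have hx0 : pr (x - pr x) = 0 := by rw [map_sub, hpr, sub_self]
    have hy0 : pr (y - pr y) = 0 := by rw [map_sub, hpr, sub_self]
    have e1 := hA x (pr y)
    have e2 := hA (y - pr y) (pr x)
    have e3 := hBB _ _ hx0 hy0
    have e4 : ⁅x, y⁆ = ⁅x, (pr y : 𝔤)⁆ - ⁅y - pr y, (pr x : 𝔤)⁆ + ⁅x - pr x, y - pr y⁆ := by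
      rw [← lie_skew (y - pr y : 𝔤) (pr x : 𝔤)]
      simp only [lie_sub, sub_lie]
      abel
    rw [e4, map_add, map_sub, LinearMap.add_apply, LinearMap.sub_apply, e1, e2, e3]
    simp only [map_sub, LinearMap.sub_apply]
    abel
  have key : ∀ u : Env A, u ∈ (⨅ x : 𝔤, ⨅ y : 𝔤, LinearMap.ker (D ⁅x, y⁆ -
      (D x ∘ₗ D y - D y ∘ₗ D x))) := by
    refine env_eq_top _ ?_ ?_
    · simp only [Submodule.mem_iInf, LinearMap.mem_ker, LinearMap.sub_apply, LinearMap.comp_apply]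
      intro x y
      rw [hone, sub_self]
    · intro z u hu
      simp only [Submodule.mem_iInf, LinearMap.mem_ker, LinearMap.sub_apply, LinearMap.comp_apply]
        at hu ⊢
      have hu' : ∀ x y, D ⁅x, y⁆ u = D x (D y u) - D y (D x u) :=
        fun x y => sub_eq_zero.mp (hu x y)
      have hm : ∀ (x : 𝔤) (v : Env A), D x (env z * v) = env z * D x v - D ⁅(z : 𝔤), x⁆ v :=
        fun x v => modelAction_mul A pr χ x z v
      intro x y
      simp only [hm, map_sub, hu', mul_sub, leibniz_lie (z : 𝔤) x y, map_add, LinearMap.add_apply]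
      abel
  have := key u
  simp only [Submodule.mem_iInf, LinearMap.mem_ker, LinearMap.sub_apply, LinearMap.comp_apply]
    at this
  exact sub_eq_zero.mp (this x y)

/-- If `𝔤 = A ⊕ B` is a decomposition into subalgebras, a character of `B` makes `U(A)` a
`𝔤`-module on which `A` acts by left multiplication. -/
lemma exists_model (hB : ∀ x y, pr x = 0 → pr y = 0 → pr ⁅x, y⁆ = 0)
    (hχB : ∀ x y, pr x = 0 → pr y = 0 → χ ⁅x, y⁆ = 0) :
    ∃ ρ : Env 𝔤 →ₐ[ℂ] End ℂ (Env A), (∀ (a : A) (u : Env A), ρ (env (a : 𝔤)) u = env a * u) ∧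
      ∀ x, pr x = 0 → ρ (env x) 1 = algebraMap ℂ _ (χ x) := by
  let f : 𝔤 →ₗ⁅ℂ⁆ End ℂ (Env A) :=
    { modelAction A pr χ with
      map_lie' := fun {x y} => by
        ext u
        exact modelAction_lie hpr hχ hB hχB x y u }
  refine ⟨UniversalEnvelopingAlgebra.lift ℂ f, fun a u => ?_, fun x hx => ?_⟩
  · rw [UniversalEnvelopingAlgebra.lift_ι_apply]
    exact modelAction_coe hpr hχ a u
  · rw [UniversalEnvelopingAlgebra.lift_ι_apply]
    refine (modelAction_one A pr χ x).trans ?_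
    rw [hx, env, map_zero, zero_add]

end Induced

/-! ### Heights and the triangular decomposition -/

section TriangularFacts

variable {𝔤 : Type*} [LieRing 𝔤] [LieAlgebra ℂ 𝔤] [FiniteDimensional ℂ 𝔤] [IsSemisimple ℂ 𝔤]
  {H : LieSubalgebra ℂ 𝔤} [H.IsCartanSubalgebra] (b : (rootSystem H).Base)

/-- Simple roots form a basis of `𝔥*`, so some element of `𝔥` takes the value `1` on all of them. -/
lemma exists_height_element : ∃ t : H, ∀ i : H.root, (rootSystem H).root i t = b.height i := by
  have : b.support.Nonempty ∨ ¬ b.support.Nonempty := em _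
  let φ : Dual ℂ (Dual ℂ H) := b.toWeightBasis.constr ℂ fun _ => (1 : ℂ)
  have hφ : ∀ i ∈ b.support, φ ((rootSystem H).root i) = 1 := by
    intro i hi
    have := b.toWeightBasis.constr_basis ℂ (fun _ => (1 : ℂ)) ⟨i, hi⟩
    rwa [RootPairing.Base.toWeightBasis_apply] at this
  refine ⟨(evalEquiv ℂ H).symm φ, fun i => ?_⟩
  have h1 : ∀ f : Dual ℂ H, f ((evalEquiv ℂ H).symm φ) = φ f := fun f =>
    apply_evalEquiv_symm_apply ℂ H f φ
  rw [h1]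
  obtain ⟨f, -, -, hf⟩ := b.exists_root_eq_sum_int i
  rw [b.height_eq_sum hf, hf, map_sum, Int.cast_sum]
  refine Finset.sum_congr rfl fun j hj => ?_
  rw [map_zsmul, hφ j hj, zsmul_eq_mul, mul_one]

/-- An element of the Cartan subalgebra on which roots take the value of their height. -/
def heightElement : H := (exists_height_element b).choose

lemma root_heightElement (i : H.root) :
    (rootSystem H).root i (heightElement b) = b.height i :=
  (exists_height_element b).choose_spec i

/-- The height of a weight. -/
def ht : Dual ℂ H →ₗ[ℝ] ℝ :=
  -- Weights are arbitrary complex functionals; the real part makes heights comparable.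
  Complex.reLm ∘ₗ ((Dual.eval ℂ H (heightElement b)).restrictScalars ℝ)

lemma ht_root (i : H.root) : ht b ((rootSystem H).root i) = b.height i := by
  change ((rootSystem H).root i (heightElement b)).re = _
  rw [root_heightElement]; simp

lemma ht_root_neg {i : H.root} (hi : ¬ b.IsPos i) : ht b ((rootSystem H).root i) ≤ -1 := by
  rw [ht_root]
  have h1 := b.height_ne_zero i
  have h2 : ¬ 0 < b.height i := hi
  have : b.height i ≤ -1 := by omega
  exact_mod_cast this

lemma ht_root_pos {i : H.root} (hi : b.IsPos i) : 1 ≤ ht b ((rootSystem H).root i) := by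
  rw [ht_root]
  have h2 : 0 < b.height i := hi
  exact_mod_cast h2

variable {b}

lemma root_mem_negCone {i : H.root} (hi : ¬ b.IsPos i) : (rootSystem H).root i ∈ negCone b :=
  AddSubmonoid.subset_closure ⟨i, hi, rfl⟩

lemma eq_zero_or_of_mem_negCone {κ : Dual ℂ H} (h : κ ∈ negCone b) :
    κ = 0 ∨ ∃ i : H.root, ¬ b.IsPos i ∧ ∃ κ' ∈ negCone b, κ = (rootSystem H).root i + κ' := by
  induction h using AddSubmonoid.closure_induction_left with
  | zero => exact .inl rfl
  | add_left x hx y hy _ =>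
    obtain ⟨i, hi, rfl⟩ := hx
    exact .inr ⟨i, hi, y, hy, rfl⟩

lemma ht_nonpos_of_mem_negCone {κ : Dual ℂ H} (h : κ ∈ negCone b) : ht b κ ≤ 0 := by
  induction h using AddSubmonoid.closure_induction_left with
  | zero => simp
  | add_left x hx y hy ih =>
    obtain ⟨i, hi, rfl⟩ := hx
    rw [map_add]
    linarith [ht_root_neg b hi]

lemma ht_le_of_mem_negCone {κ : Dual ℂ H} (h : κ ∈ negCone b) (h0 : κ ≠ 0) : ht b κ ≤ -1 := by
  obtain rfl | ⟨i, hi, κ', hκ', rfl⟩ := eq_zero_or_of_mem_negCone h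
  · exact absurd rfl h0
  · rw [map_add]
    linarith [ht_root_neg b hi, ht_nonpos_of_mem_negCone hκ']

-- There are finitely many negative roots and each lowers the height by at least `1`, so a bound on
-- the height bounds the number of summands.
variable (b) in
lemma finite_negCone_ht_ge (c : ℝ) : {κ | κ ∈ negCone b ∧ c ≤ ht b κ}.Finite := by
  suffices h : ∀ n : ℕ, {κ | κ ∈ negCone b ∧ -(n : ℝ) ≤ ht b κ}.Finite by
    obtain ⟨n, hn⟩ := exists_nat_ge (-c)
    exact (h n).subset fun κ hκ => ⟨hκ.1, by linarith [hκ.2]⟩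
  intro n
  induction n with
  | zero =>
    refine (Set.finite_singleton (0 : Dual ℂ H)).subset fun κ hκ => ?_
    by_contra h0
    have h1 := ht_le_of_mem_negCone hκ.1 h0
    have h2 := hκ.2
    simp only [Nat.cast_zero, neg_zero] at h2
    linarith
  | succ n ih =>
    refine ((Set.finite_singleton (0 : Dual ℂ H)).union
      (Set.Finite.image2 (fun i κ => (rootSystem H).root i + κ) (Set.finite_univ (α := H.root))
        ih)).subset fun κ hκ => ?_
    obtain rfl | ⟨i, hi, κ', hκ', rfl⟩ := eq_zero_or_of_mem_negCone hκ.1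
    · exact .inl rfl
    · refine .inr ⟨i, trivial, κ', ⟨hκ', ?_⟩, rfl⟩
      have h1 := hκ.2
      rw [map_add] at h1
      push_cast at h1
      linarith [ht_root_neg b hi]

lemma mem_rootSpace_iff (i : H.root) (x : 𝔤) : x ∈ rootSpace H (i.1 : H → ℂ) ↔
    ∀ t : H, ⁅(t : 𝔤), x⁆ = (rootSystem H).root i t • x := by
  constructor
  · intro hx t
    exact lie_eq_smul_of_mem_rootSpace hx t
  · intro h
    apply weightSpace_le_genWeightSpace
    rw [mem_weightSpace]
    exact h

lemma mem_nNeg {i : H.root} (hi : ¬ b.IsPos i) {x : 𝔤} (hx : x ∈ rootSpace H (i.1 : H → ℂ)) :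
    x ∈ nNeg b :=
  Submodule.mem_iSup_of_mem (p := fun i => ⨆ (_ : i ∈ {i | ¬ b.IsPos i}),
    (rootSpace H (i.1 : H → ℂ)).toSubmodule) i (Submodule.mem_iSup_of_mem hi hx)

lemma mem_nPos {i : H.root} (hi : b.IsPos i) {x : 𝔤} (hx : x ∈ rootSpace H (i.1 : H → ℂ)) :
    x ∈ nPos b :=
  Submodule.mem_iSup_of_mem (p := fun i => ⨆ (_ : i ∈ {i | b.IsPos i}),
    (rootSpace H (i.1 : H → ℂ)).toSubmodule) i (Submodule.mem_iSup_of_mem hi hx)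

lemma nNeg_le {P : Submodule ℂ 𝔤}
    (h : ∀ i, ¬ b.IsPos i → ∀ x ∈ rootSpace H (i.1 : H → ℂ), x ∈ P) : ∀ x ∈ nNeg b, x ∈ P := by
  have : (nNeg b).toSubmodule ≤ P := iSup₂_le fun i hi x hx => h i hi x hx
  exact this

lemma nPos_le {P : Submodule ℂ 𝔤}
    (h : ∀ i, b.IsPos i → ∀ x ∈ rootSpace H (i.1 : H → ℂ), x ∈ P) : ∀ x ∈ nPos b, x ∈ P := by
  have : (nPos b).toSubmodule ≤ P := iSup₂_le fun i hi x hx => h i hi x hx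
  exact this

omit [IsSemisimple ℂ 𝔤] in
lemma eq_top_of_triangular {P : Submodule ℂ 𝔤} (hH : ∀ x ∈ H, x ∈ P)
    (h : ∀ i : H.root, ∀ x ∈ rootSpace H (i.1 : H → ℂ), x ∈ P) (y : 𝔤) : y ∈ P := by
  have hy : y ∈ (⨆ χ : Weight ℂ H 𝔤, rootSpace H (χ : H → ℂ)) := by
    rw [iSup_genWeightSpace_eq_top']; trivial
  induction hy using LieSubmodule.iSup_induction' with
  | mem χ y hy =>
    by_cases hχ : χ.IsZero
    · apply hH
      rw [hχ.eq] at hy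
      have : y ∈ (rootSpace H (0 : H → ℂ)) := hy
      rw [rootSpace_zero_eq] at this
      exact this
    · exact h ⟨χ, by simpa using hχ⟩ y hy
  | zero => exact P.zero_mem
  | add y z _ _ hy hz => exact P.add_mem hy hz

variable (b) in
/-- The subspace `𝔥 ⊕ 𝔫₊`. -/
def borel : Submodule ℂ 𝔤 := H.toSubmodule ⊔ (nPos b).toSubmodule

lemma lie_mem_nPos_of_mem_cartan (t : H) {x : 𝔤} (hx : x ∈ nPos b) : ⁅(t : 𝔤), x⁆ ∈ nPos b := by
  refine nPos_le (P := (nPos b).toSubmodule.comap (toEnd ℂ 𝔤 𝔤 (t : 𝔤))) ?_ x hx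
  intro i hi x hx
  change ⁅(t : 𝔤), x⁆ ∈ nPos b
  rw [(mem_rootSpace_iff i x).mp hx]
  exact (nPos b).smul_mem _ (mem_nPos hi hx)

lemma lie_mem_nNeg_of_mem_cartan (t : H) {x : 𝔤} (hx : x ∈ nNeg b) : ⁅(t : 𝔤), x⁆ ∈ nNeg b := by
  refine nNeg_le (P := (nNeg b).toSubmodule.comap (toEnd ℂ 𝔤 𝔤 (t : 𝔤))) ?_ x hx
  intro i hi x hx
  change ⁅(t : 𝔤), x⁆ ∈ nNeg b
  rw [(mem_rootSpace_iff i x).mp hx]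
  exact (nNeg b).smul_mem _ (mem_nNeg hi hx)

lemma cartan_lie (s t : H) : ⁅(s : 𝔤), (t : 𝔤)⁆ = 0 := by
  have : ⁅s, t⁆ = 0 := trivial_lie_zero _ _ _ _
  exact congrArg Subtype.val this

lemma lie_mem_nPos_of_mem_borel {x y : 𝔤} (hx : x ∈ borel b) (hy : y ∈ borel b) :
    ⁅x, y⁆ ∈ nPos b := by
  obtain ⟨s, hs, e, he, rfl⟩ := Submodule.mem_sup.mp hx
  obtain ⟨t, ht, f, hf, rfl⟩ := Submodule.mem_sup.mp hy
  have h1 : ⁅s, t⁆ = 0 := cartan_lie ⟨s, hs⟩ ⟨t, ht⟩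
  have h2 : ⁅s, f⁆ ∈ nPos b := lie_mem_nPos_of_mem_cartan ⟨s, hs⟩ hf
  have h3 : ⁅t, e⁆ ∈ nPos b := lie_mem_nPos_of_mem_cartan ⟨t, ht⟩ he
  have h4 : ⁅e, t⁆ ∈ nPos b := by
    rw [← lie_skew]; exact (nPos b).neg_mem h3
  have h5 : ⁅e, f⁆ ∈ nPos b := (nPos b).lie_mem he hf
  rw [add_lie, lie_add, lie_add, h1, zero_add]
  exact (nPos b).add_mem h2 ((nPos b).add_mem h4 h5)

variable (b) in
lemma isCompl_nNeg_borel : IsCompl (nNeg b).toSubmodule (borel b) := by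
  constructor
  · have hind := iSupIndep_genWeightSpace' ℂ H 𝔤
    rw [← LieSubmodule.iSupIndep_toSubmodule] at hind
    -- The weights of `𝔤` are split into the negative roots and the rest, zero included; root spaces
    -- over disjoint sets of weights are independent.
    let S : Set (Weight ℂ H 𝔤) := {χ | ∃ i : H.root, ¬ b.IsPos i ∧ i.1 = χ}
    refine (hind.disjoint_biSup_biSup (s := S) (t := Sᶜ) disjoint_compl_right).mono ?_ ?_
    · refine iSup₂_le fun i hi => ?_
      exact le_iSup₂_of_le (f := fun (χ : Weight ℂ H 𝔤) (_ : χ ∈ S) =>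
        (rootSpace H (χ : H → ℂ)).toSubmodule) i.1 ⟨i, hi, rfl⟩ le_rfl
    · refine sup_le ?_ (iSup₂_le fun i hi => ?_)
      · intro x hx
        have hx0 : x ∈ rootSpace H (0 : H → ℂ) := by
          rw [rootSpace_zero_eq]; exact hx
        by_cases h0 : rootSpace H (0 : H → ℂ) = ⊥
        · rw [h0, LieSubmodule.mem_bot] at hx0
          rw [hx0]; exact Submodule.zero_mem _
        · let χ : Weight ℂ H 𝔤 := ⟨0, h0⟩
          have hχ : χ ∈ Sᶜ := by
            rintro ⟨i, -, hi⟩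
            apply H.isNonZero_coe_root i
            rw [hi]; rfl
          exact Submodule.mem_iSup_of_mem χ (Submodule.mem_iSup_of_mem hχ hx0)
      · have hχ : i.1 ∈ Sᶜ := by
          rintro ⟨j, hj, hij⟩
          have : j = i := Subtype.ext hij
          exact hj (this ▸ hi)
        exact le_iSup₂_of_le (f := fun (χ : Weight ℂ H 𝔤) (_ : χ ∈ Sᶜ) =>
          (rootSpace H (χ : H → ℂ)).toSubmodule) i.1 hχ le_rfl
  · rw [codisjoint_iff, eq_top_iff]
    intro y _
    refine eq_top_of_triangular (H := H) (fun x hx => ?_) (fun i x hx => ?_) y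
    · exact Submodule.mem_sup_right (Submodule.mem_sup_left hx)
    · by_cases hi : b.IsPos i
      · exact Submodule.mem_sup_right (Submodule.mem_sup_right (mem_nPos hi hx))
      · exact Submodule.mem_sup_left (mem_nNeg hi hx)

/-- The element `t_μ` of the Cartan subalgebra that represents `μ` via the Killing form. -/
def tElt (μ : Dual ℂ H) : H := (cartanEquivDual H).symm μ

lemma killingForm_tElt (μ : Dual ℂ H) (t : H) : killingForm ℂ 𝔤 (tElt μ : 𝔤) t = μ t := by
  have := LinearEquiv.apply_symm_apply (cartanEquivDual H) μ
  exact LinearMap.congr_fun this t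

omit [IsSemisimple ℂ 𝔤] in
lemma killingForm_cartan_rootSpace (t : H) (i : H.root) {x : 𝔤}
    (hx : x ∈ rootSpace H (i.1 : H → ℂ)) : killingForm ℂ 𝔤 (t : 𝔤) x = 0 := by
  have ht : (t : 𝔤) ∈ rootSpace H (0 : H → ℂ) := by rw [rootSpace_zero_eq]; exact t.2
  refine killingForm_apply_eq_zero_of_mem_rootSpace_of_add_ne_zero ℂ 𝔤 H ht hx ?_
  rw [zero_add]
  exact H.isNonZero_coe_root i

lemma killingForm_cartan_nPos (t : H) {x : 𝔤} (hx : x ∈ nPos b) :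
    killingForm ℂ 𝔤 (t : 𝔤) x = 0 :=
  nPos_le (P := LinearMap.ker (killingForm ℂ 𝔤 (t : 𝔤)))
    (fun i _ _ hx => killingForm_cartan_rootSpace t i hx) x hx

lemma killingForm_cartan_nNeg (t : H) {x : 𝔤} (hx : x ∈ nNeg b) :
    killingForm ℂ 𝔤 (t : 𝔤) x = 0 :=
  nNeg_le (P := LinearMap.ker (killingForm ℂ 𝔤 (t : 𝔤)))
    (fun i _ _ hx => killingForm_cartan_rootSpace t i hx) x hx

end TriangularFacts

/-! ### The structure of Verma modules -/

section VermaFacts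

variable {𝔤 : Type*} [LieRing 𝔤] [LieAlgebra ℂ 𝔤] [FiniteDimensional ℂ 𝔤] [IsSemisimple ℂ 𝔤]
  {H : LieSubalgebra ℂ 𝔤} [H.IsCartanSubalgebra] (b : (rootSystem H).Base) (μ : Dual ℂ H)
  {M : Type*} [AddCommGroup M] [Module ℂ M] [LieRingModule 𝔤 M] [LieModule ℂ 𝔤 M]

/-- A highest weight vector of weight `μ` (possibly zero). -/
structure IsHighest (m : M) : Prop where
  cartan : ∀ t : H, ⁅(t : 𝔤), m⁆ = μ t • m
  nPos : ∀ x ∈ nPos b, ⁅x, m⁆ = 0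

/-- The generator of a Verma module. -/
def vermaGen : Verma b μ := Submodule.Quotient.mk (1 : Env 𝔤)

/-- The projection of the enveloping algebra onto a Verma module. -/
def vermaMk : Env 𝔤 →ₗ[ℂ] Verma b μ := ((vermaIdeal b μ).mkQ).restrictScalars ℂ

lemma vermaMk_surjective : Function.Surjective (vermaMk b μ) :=
  Submodule.Quotient.mk_surjective _

variable {b μ} in
lemma vermaMk_eq_zero {u : Env 𝔤} (hu : u ∈ vermaIdeal b μ) : vermaMk b μ u = 0 :=
  (Submodule.Quotient.mk_eq_zero _).mpr hu

lemma uact_verma (u : Env 𝔤) (v : Verma b μ) : uact 𝔤 (Verma b μ) u v = u • v := by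
  refine env_eq_top (LinearMap.ker ((uact 𝔤 (Verma b μ)).toLinearMap.flip v -
    (LinearMap.toSpanSingleton (Env 𝔤) _ v).restrictScalars ℂ)) ?_ ?_ u |>
    fun h => sub_eq_zero.mp (LinearMap.mem_ker.mp h)
  · rw [LinearMap.mem_ker]; simp
  · intro x u hu
    have hu' : uact 𝔤 (Verma b μ) u v = u • v := sub_eq_zero.mp (LinearMap.mem_ker.mp hu)
    rw [LinearMap.mem_ker]
    change uact 𝔤 (Verma b μ) (env x * u) v - (env x * u) • v = 0
    rw [uact_env_mul, hu', mul_smul]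
    exact sub_self _

lemma uact_vermaGen (u : Env 𝔤) : uact 𝔤 (Verma b μ) u (vermaGen b μ) = vermaMk b μ u := by
  rw [uact_verma]
  exact congrArg (vermaMk b μ) (mul_one u)

lemma isHighest_vermaGen : IsHighest b μ (vermaGen b μ) where
  cartan t := by
    have h1 : env (t : 𝔤) - algebraMap ℂ _ (μ t) ∈ vermaIdeal b μ :=
      Submodule.subset_span (.inr ⟨t, rfl⟩)
    have h2 := vermaMk_eq_zero h1
    rw [map_sub, sub_eq_zero] at h2
    rw [← uact_env, uact_vermaGen, h2, Algebra.algebraMap_eq_smul_one, map_smul]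
    rfl
  nPos x hx := by
    rw [← uact_env, uact_vermaGen]
    exact vermaMk_eq_zero (Submodule.subset_span (.inl ⟨x, hx, rfl⟩))

variable {b μ}

lemma verma_hom_ext {f g : Verma b μ →ₗ⁅ℂ,𝔤⁆ M} (h : f (vermaGen b μ) = g (vermaGen b μ)) :
    f = g := by
  ext v
  obtain ⟨u, rfl⟩ := vermaMk_surjective b μ v
  rw [← uact_vermaGen]
  have hf := map_uact (f : Verma b μ →ₗ[ℂ] M) (fun x m => f.map_lie x m) u (vermaGen b μ)
  have hg := map_uact (g : Verma b μ →ₗ[ℂ] M) (fun x m => g.map_lie x m) u (vermaGen b μ)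
  rw [LieModuleHom.coe_toLinearMap] at hf hg
  rw [hf, hg, h]

/-- Stated for an arbitrary representation `ρ` because it serves twice: for a Lie module in the
universal property, and for the model on `U(𝔫₋)`. -/
lemma vermaIdeal_le_ker {A : Type*} [AddCommGroup A] [Module ℂ A] (ρ : Env 𝔤 →ₐ[ℂ] End ℂ A)
    {m : A} (hH : ∀ t : H, ρ (env (t : 𝔤)) m = μ t • m) (hn : ∀ x ∈ nPos b, ρ (env x) m = 0)
    {u : Env 𝔤} (hu : u ∈ vermaIdeal b μ) : ρ u m = 0 := by
  induction hu using Submodule.span_induction with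
  | mem u hu =>
    rcases hu with ⟨x, hx, rfl⟩ | ⟨t, rfl⟩
    · exact hn x hx
    · rw [map_sub, LinearMap.sub_apply, AlgHom.commutes]
      exact sub_eq_zero.mpr (hH t)
  | zero => simp
  | add u v _ _ hu hv => rw [map_add, LinearMap.add_apply, hu, hv, add_zero]
  | smul a u _ hu => rw [smul_eq_mul, map_mul, Module.End.mul_apply, hu, map_zero]

/-- The universal property of Verma modules. -/
lemma exists_verma_hom {m : M} (hm : IsHighest b μ m) :
    ∃ f : Verma b μ →ₗ⁅ℂ,𝔤⁆ M, f (vermaGen b μ) = m := by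
  let φ : Env 𝔤 →ₗ[ℂ] M := (uact 𝔤 M).toLinearMap.flip m
  have hφ : (vermaIdeal b μ).restrictScalars ℂ ≤ LinearMap.ker φ := fun u hu =>
    vermaIdeal_le_ker (uact 𝔤 M) (fun t => by rw [uact_env, hm.cartan])
      (fun x hx => by rw [uact_env, hm.nPos x hx]) hu
  let f : Verma b μ →ₗ[ℂ] M := Submodule.liftQ ((vermaIdeal b μ).restrictScalars ℂ) φ hφ
  have hf : ∀ u : Env 𝔤, f (vermaMk b μ u) = uact 𝔤 M u m :=
    fun u => rfl
  refine ⟨{ f with map_lie' := fun {x v} => ?_ }, ?_⟩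
  · obtain ⟨u, rfl⟩ := vermaMk_surjective b μ v
    change f ⁅x, vermaMk b μ u⁆ = ⁅x, f (vermaMk b μ u)⁆
    rw [hf, ← uact_env_mul, ← hf]
    rfl
  · change f (vermaMk b μ 1) = m
    rw [hf, map_one]; rfl

variable (b μ) in
/-- The Verma module is generated by its highest weight vector over `U(𝔫₋)`. -/
lemma verma_surjective :
    Function.Surjective fun u => uact (nNeg b) (Verma b μ) u (vermaGen b μ) := by
  let φ : Env (nNeg b) →ₗ[ℂ] Verma b μ := (uact (nNeg b) (Verma b μ)).toLinearMap.flip (vermaGen b μ)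
  have hφ : ∀ u, φ u = uact (nNeg b) (Verma b μ) u (vermaGen b μ) := fun u => rfl
  have hneg : ∀ x ∈ nNeg b, ∀ v ∈ LinearMap.range φ, ⁅x, v⁆ ∈ LinearMap.range φ := by
    rintro x hx _ ⟨u, rfl⟩
    refine ⟨env ⟨x, hx⟩ * u, ?_⟩
    rw [hφ, uact_env_mul]; rfl
  have hone : vermaGen b μ ∈ LinearMap.range φ := ⟨1, by rw [hφ, map_one]; rfl⟩
  -- Stability under all `x : 𝔤` is proved simultaneously, since moving `x` past `y ∈ 𝔫₋` produces
  -- `⁅x, y⁆`.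
  have key : ∀ (u : Env (nNeg b)), ∀ x : 𝔤, ⁅x, φ u⁆ ∈ LinearMap.range φ := by
    intro u
    let P : Submodule ℂ (Env (nNeg b)) :=
      ⨅ x : 𝔤, (LinearMap.range φ).comap ((toEnd ℂ 𝔤 (Verma b μ) x) ∘ₗ φ)
    have hP : ∀ u, u ∈ P ↔ ∀ x : 𝔤, ⁅x, φ u⁆ ∈ LinearMap.range φ := fun u => by
      rw [Submodule.mem_iInf]; rfl
    rw [← hP]
    refine env_eq_top P ?_ ?_ u
    · rw [hP]
      intro x
      have h1 : φ 1 = vermaGen b μ := by rw [hφ, map_one]; rfl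
      rw [h1]
      refine eq_top_of_triangular (H := H)
        (P := (LinearMap.range φ).comap
          ((toEnd ℂ 𝔤 (Verma b μ) : 𝔤 →ₗ[ℂ] End ℂ (Verma b μ)).flip (vermaGen b μ))) ?_ ?_ x
      · intro t ht
        change ⁅t, vermaGen b μ⁆ ∈ LinearMap.range φ
        rw [(isHighest_vermaGen b μ).cartan ⟨t, ht⟩]
        exact Submodule.smul_mem _ _ hone
      · intro i x hx
        change ⁅x, vermaGen b μ⁆ ∈ LinearMap.range φ
        by_cases hi : b.IsPos i
        · rw [(isHighest_vermaGen b μ).nPos x (mem_nPos hi hx)]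
          exact Submodule.zero_mem _
        · exact hneg x (mem_nNeg hi hx) _ hone
    · intro y u hu
      rw [hP] at hu ⊢
      intro x
      have h1 : φ (env y * u) = ⁅(y : 𝔤), φ u⁆ := by rw [hφ, uact_env_mul]; rfl
      rw [h1, leibniz_lie]
      exact Submodule.add_mem _ (hu _) (hneg y y.2 _ (hu x))
  intro v
  obtain ⟨u, rfl⟩ := vermaMk_surjective b μ v
  have := uact_mem (L := 𝔤) (LinearMap.range φ) (by rintro x _ ⟨w, rfl⟩; exact key w x) u hone
  rw [uact_vermaGen] at this
  exact this

variable (b μ) in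
/-- The Verma module is free of rank one over `U(𝔫₋)`. -/
theorem verma_bijective :
    Function.Bijective fun u => uact (nNeg b) (Verma b μ) u (vermaGen b μ) := by
  refine ⟨?_, verma_surjective b μ⟩
  have hc := isCompl_nNeg_borel b
  let pr : 𝔤 →ₗ[ℂ] nNeg b := Submodule.projectionOnto (nNeg b).toSubmodule (borel b) hc
  have hker : ∀ x, pr x = 0 ↔ x ∈ borel b := fun x =>
    Submodule.projectionOnto_apply_eq_zero_iff hc
  have hpr : ∀ a : nNeg b, pr a = a := fun a => Submodule.projectionOnto_apply_left hc a
  -- The Killing form paired with `t_μ` extends `μ` from `𝔥` to `𝔤` by zero on `𝔫₊` and `𝔫₋`; it is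
  -- the character through which `𝔥 ⊕ 𝔫₊` acts on `1` in the model.
  obtain ⟨ρ, hρ1, hρ2⟩ := exists_model (pr := pr) (χ := killingForm ℂ 𝔤 (tElt μ : 𝔤)) hpr
    (fun a => killingForm_cartan_nNeg _ a.2)
    (fun x y hx hy => by
      rw [hker] at hx hy ⊢
      exact Submodule.mem_sup_right (lie_mem_nPos_of_mem_borel hx hy))
    (fun x y hx hy => by
      rw [hker] at hx hy
      exact killingForm_cartan_nPos _ (lie_mem_nPos_of_mem_borel hx hy))
  have hle : (vermaIdeal b μ).restrictScalars ℂ ≤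
      LinearMap.ker (ρ.toLinearMap.flip (1 : Env (nNeg b))) := fun u hu =>
    vermaIdeal_le_ker ρ (fun t => by
      rw [hρ2 _ ((hker _).mpr (Submodule.mem_sup_left t.2)), killingForm_tElt,
        Algebra.algebraMap_eq_smul_one])
      (fun x hx => by
        rw [hρ2 _ ((hker _).mpr (Submodule.mem_sup_right hx)), killingForm_cartan_nPos _ hx,
          map_zero]) hu
  let f : Verma b μ →ₗ[ℂ] Env (nNeg b) := Submodule.liftQ ((vermaIdeal b μ).restrictScalars ℂ) _ hle
  have hf : ∀ u : Env 𝔤, f (vermaMk b μ u) = ρ u 1 :=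
    fun u => rfl
  have hx : ∀ (x : nNeg b) v, f ⁅x, v⁆ = env x * f v := by
    intro x v
    obtain ⟨u, rfl⟩ := vermaMk_surjective b μ v
    have h1 : ⁅x, vermaMk b μ u⁆ = vermaMk b μ (env (x : 𝔤) * u) := rfl
    refine (congrArg f h1).trans ?_
    rw [hf, hf, map_mul, Module.End.mul_apply, hρ1]
  -- The map `f` onto the model is a left inverse of `u ↦ u · vermaGen`, because `𝔫₋` acts on the
  -- model by left multiplication.
  have key : ∀ u : Env (nNeg b), f (uact (nNeg b) (Verma b μ) u (vermaGen b μ)) = u := by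
    intro u
    refine env_eq_top (LinearMap.ker (f ∘ₗ (uact (nNeg b) (Verma b μ)).toLinearMap.flip
      (vermaGen b μ) - LinearMap.id)) ?_ ?_ u |>
      fun h => sub_eq_zero.mp (LinearMap.mem_ker.mp h)
    · rw [LinearMap.mem_ker]
      change f (uact (nNeg b) (Verma b μ) 1 (vermaGen b μ)) - 1 = 0
      rw [map_one, Module.End.one_apply, sub_eq_zero]
      refine (hf 1).trans ?_
      rw [map_one ρ, Module.End.one_apply]
    · intro x u hu
      have hu' : f (uact (nNeg b) (Verma b μ) u (vermaGen b μ)) = u :=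
        sub_eq_zero.mp (LinearMap.mem_ker.mp hu)
      rw [LinearMap.mem_ker]
      change f (uact (nNeg b) (Verma b μ) (env x * u) (vermaGen b μ)) - env x * u = 0
      rw [uact_env_mul, hx, hu', sub_self]
  exact Function.LeftInverse.injective key

end VermaFacts

/-! ### Weight modules -/

section WeightModules

variable {𝔤 : Type*} [LieRing 𝔤] [LieAlgebra ℂ 𝔤]
  {H : LieSubalgebra ℂ 𝔤}
  {M : Type*} [AddCommGroup M] [Module ℂ M] [LieRingModule 𝔤 M] [LieModule ℂ 𝔤 M]
  {N : Type*} [AddCommGroup N] [Module ℂ N] [LieRingModule 𝔤 N] [LieModule ℂ 𝔤 N]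

variable (M) in
/-- The weight space of weight `μ`, as a subspace. -/
abbrev wt (μ : Dual ℂ H) : Submodule ℂ M := (weightSpace M (μ : H → ℂ)).toSubmodule

lemma mem_wt {μ : Dual ℂ H} {m : M} : m ∈ wt M μ ↔ ∀ t : H, ⁅(t : 𝔤), m⁆ = μ t • m :=
  mem_weightSpace (μ : H → ℂ) m

lemma mem_supp {μ : Dual ℂ H} : μ ∈ supp H M ↔ wt M μ ≠ ⊥ := by
  rw [supp, Set.mem_ofPred_eq, Ne, Ne, ← LieSubmodule.toSubmodule_eq_bot]

lemma wt_eq_bot {μ : Dual ℂ H} (h : μ ∉ supp H M) : wt M μ = ⊥ := by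
  rw [mem_supp] at h; exact not_not.mp h

lemma mem_supp_of_mem {μ : Dual ℂ H} {m : M} (hm : m ∈ wt M μ) (h0 : m ≠ 0) : μ ∈ supp H M := by
  rw [mem_supp]
  intro h
  rw [h, Submodule.mem_bot] at hm
  exact h0 hm

lemma map_mem_wt (f : M →ₗ⁅ℂ,𝔤⁆ N) {μ : Dual ℂ H} {m : M} (hm : m ∈ wt M μ) : f m ∈ wt N μ := by
  rw [mem_wt] at hm ⊢
  intro t
  rw [← LieModuleHom.map_lie, hm, map_smul]

/-- A subspace stable under the Cartan subalgebra contains the weight components of its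
elements. -/
lemma mem_of_sum_mem {P : Submodule ℂ M} (hP : ∀ t : H, ∀ m ∈ P, ⁅(t : 𝔤), m⁆ ∈ P)
    (s : Finset (Dual ℂ H)) (m : Dual ℂ H → M) (hm : ∀ μ ∈ s, m μ ∈ wt M μ)
    (hs : ∑ μ ∈ s, m μ ∈ P) : ∀ μ ∈ s, m μ ∈ P := by
  classical
  induction s using Finset.induction_on generalizing m with
  | empty => simp
  | insert ν s hν ih =>
    have hs' : ∀ μ ∈ s, m μ ∈ P := by
      intro μ hμ
      have hne : μ ≠ ν := fun h => hν (h ▸ hμ)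
      -- The operator `t - ν(t)` kills the component of weight `ν` and rescales the one of weight
      -- `μ` by a nonzero factor, so the induction hypothesis applies to `s`.
      obtain ⟨t, ht⟩ : ∃ t, μ t ≠ ν t := by
        by_contra! h
        exact hne (LinearMap.ext h)
      have h1 : ∑ κ ∈ s, (κ t - ν t) • m κ ∈ P := by
        have h2 := P.sub_mem (hP t _ hs) (P.smul_mem (ν t) hs)
        have h3 : ⁅(t : 𝔤), ∑ κ ∈ insert ν s, m κ⁆ - ν t • ∑ κ ∈ insert ν s, m κ =
            ∑ κ ∈ s, (κ t - ν t) • m κ := by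
          rw [lie_sum, Finset.smul_sum, ← Finset.sum_sub_distrib, Finset.sum_insert hν,
            mem_wt.mp (hm ν (Finset.mem_insert_self _ _)), sub_self, zero_add]
          refine Finset.sum_congr rfl fun κ hκ => ?_
          rw [mem_wt.mp (hm κ (Finset.mem_insert_of_mem hκ)), sub_smul]
        rwa [h3] at h2
      have h4 := ih (fun κ => (κ t - ν t) • m κ)
        (fun κ hκ => Submodule.smul_mem _ _ (hm κ (Finset.mem_insert_of_mem hκ))) h1 μ hμ
      exact (P.smul_mem_iff (sub_ne_zero.mpr ht)).mp h4
    intro μ hμ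
    rcases Finset.mem_insert.mp hμ with rfl | hμ
    · rw [Finset.sum_insert hν] at hs
      have := P.sub_mem hs (P.sum_mem hs')
      rwa [add_sub_cancel_right] at this
    · exact hs' μ hμ

lemma iSupIndep_wt : iSupIndep fun μ : Dual ℂ H => wt M μ := by
  rw [iSupIndep_iff_finsetSum_eq_zero_imp_eq_zero]
  intro s f hf hs μ hμ
  simpa using mem_of_sum_mem (P := (⊥ : Submodule ℂ M)) (by simp) s f hf (by simpa using hs) μ hμ

lemma IsWeightModule.exists_finsupp (hM : IsWeightModule H M) (m : M) :
    ∃ f : Dual ℂ H →₀ M, (∀ μ, f μ ∈ wt M μ) ∧ f.sum (fun _ x => x) = m := by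
  have : m ∈ ⨆ μ : Dual ℂ H, wt M μ := by
    rw [show ⨆ μ : Dual ℂ H, wt M μ = ⊤ from hM]; trivial
  exact (Submodule.mem_iSup_iff_exists_finsupp _ _).mp this

lemma IsWeightModule.isInternal (hM : IsWeightModule H M) [DecidableEq (Dual ℂ H)] :
    DirectSum.IsInternal fun μ : Dual ℂ H => wt M μ :=
  DirectSum.isInternal_submodule_of_iSupIndep_of_iSup_eq_top iSupIndep_wt hM

lemma IsWeightModule.induction (hM : IsWeightModule H M) {P : Submodule ℂ M}
    (h : ∀ μ : Dual ℂ H, ∀ m ∈ wt M μ, m ∈ P) (m : M) : m ∈ P := by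
  have h1 : ⨆ μ : Dual ℂ H, wt M μ ≤ P := iSup_le fun μ m hm => h μ m hm
  rw [show ⨆ μ : Dual ℂ H, wt M μ = ⊤ from hM] at h1
  exact h1 trivial

lemma IsWeightModule.ext (hM : IsWeightModule H M) {V : Type*} [AddCommGroup V] [Module ℂ V]
    {f g : M →ₗ[ℂ] V} (h : ∀ μ : Dual ℂ H, ∀ m ∈ wt M μ, f m = g m) : f = g := by
  ext m
  exact hM.induction (P := LinearMap.eqLocus f g) h m

lemma IsWeightModule.exists_linearMap (hM : IsWeightModule H M) {V : Type*} [AddCommGroup V]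
    [Module ℂ V] (φ : ∀ μ : Dual ℂ H, wt M μ →ₗ[ℂ] V) :
    ∃ f : M →ₗ[ℂ] V, ∀ (μ : Dual ℂ H) (m : M) (hm : m ∈ wt M μ), f m = φ μ ⟨m, hm⟩ := by
  classical
  let e := LinearEquiv.ofBijective (DirectSum.coeLinearMap fun μ : Dual ℂ H => wt M μ)
    hM.isInternal
  refine ⟨DirectSum.toModule ℂ _ _ φ ∘ₗ e.symm.toLinearMap, fun μ m hm => ?_⟩
  have h1 : e.symm m = DirectSum.lof ℂ _ (fun μ : Dual ℂ H => wt M μ) μ ⟨m, hm⟩ := by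
    rw [LinearEquiv.symm_apply_eq]
    exact (DirectSum.coeLinearMap_lof (fun μ : Dual ℂ H => wt M μ) μ ⟨m, hm⟩).symm
  rw [LinearMap.comp_apply, LinearEquiv.coe_coe, h1, DirectSum.toModule_lof]

/-- Extension by zero of a linear map defined on a weight space. -/
lemma IsWeightModule.exists_extension (hM : IsWeightModule H M) {V : Type*} [AddCommGroup V]
    [Module ℂ V] (μ : Dual ℂ H) (φ : wt M μ →ₗ[ℂ] V) :
    ∃ f : M →ₗ[ℂ] V, (∀ (m : M) (hm : m ∈ wt M μ), f m = φ ⟨m, hm⟩) ∧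
      ∀ ν, ν ≠ μ → ∀ m ∈ wt M ν, f m = 0 := by
  classical
  obtain ⟨f, hf⟩ := hM.exists_linearMap (V := V)
    (fun ν => if h : ν = μ then φ ∘ₗ (LinearEquiv.ofEq _ _ (by rw [h])).toLinearMap else 0)
  refine ⟨f, fun m hm => ?_, fun ν hν m hm => ?_⟩
  · rw [hf μ m hm, dif_pos rfl]; rfl
  · rw [hf ν m hm, dif_neg hν]; rfl

/-- Independent spaces cannot strictly contain subspaces that already exhaust the module. This is
how weight spaces of quotients, tensor products and Verma modules are identified with explicit
subspaces. -/
lemma eq_of_iSupIndep_of_le {ι : Type*} {A B : ι → Submodule ℂ M} (hB : iSupIndep B)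
    (hle : ∀ i, A i ≤ B i) (hA : ⨆ i, A i = ⊤) (i : ι) : B i = A i := by
  refine le_antisymm (fun m hm => ?_) (hle i)
  have h1 : m ∈ ⨆ j, A j := by rw [hA]; trivial
  have h2 : m ∈ A i ⊔ ⨆ (j) (_ : j ≠ i), B j := by
    have h3 : ⨆ j, A j ≤ A i ⊔ ⨆ (j) (_ : j ≠ i), B j := by
      refine iSup_le fun j => ?_
      by_cases hj : j = i
      · subst hj; exact le_sup_left
      · exact le_sup_of_le_right (le_iSup₂_of_le j hj (hle j))
    exact h3 h1
  obtain ⟨a, ha, c, hc, rfl⟩ := Submodule.mem_sup.mp h2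
  have h4 : c ∈ B i := by
    have := (B i).sub_mem hm (hle i ha)
    rwa [add_sub_cancel_left] at this
  have h5 : c = 0 := by
    have := (hB i).le_bot (⟨h4, hc⟩ : c ∈ B i ⊓ ⨆ (j) (_ : j ≠ i), B j)
    simpa using this
  rw [h5, add_zero]; exact ha

lemma wt_eq_of_iSup_eq_top {A : Dual ℂ H → Submodule ℂ M} (hle : ∀ μ, A μ ≤ wt M μ)
    (hA : ⨆ μ, A μ = ⊤) (μ : Dual ℂ H) : wt M μ = A μ :=
  eq_of_iSupIndep_of_le iSupIndep_wt hle hA μ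

lemma isWeightModule_of_le {A : Dual ℂ H → Submodule ℂ M} (hle : ∀ μ, A μ ≤ wt M μ)
    (hA : ⨆ μ, A μ = ⊤) : IsWeightModule H M :=
  eq_top_iff.mpr (hA ▸ iSup_mono hle)

lemma mem_wt_of_injective {f : M →ₗ⁅ℂ,𝔤⁆ N} (hf : Function.Injective f) {μ : Dual ℂ H} {m : M}
    (hm : f m ∈ wt N μ) : m ∈ wt M μ := by
  rw [mem_wt] at hm ⊢
  intro t
  apply hf
  rw [LieModuleHom.map_lie, hm, map_smul]

lemma IsWeightModule.of_injective (hN : IsWeightModule H N) {f : M →ₗ⁅ℂ,𝔤⁆ N}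
    (hf : Function.Injective f) : IsWeightModule H M := by
  refine eq_top_iff.mpr fun m _ => ?_
  obtain ⟨g, hg, hgm⟩ := hN.exists_finsupp (f m)
  have h1 := mem_of_sum_mem (H := H) (P := LinearMap.range (f : M →ₗ[ℂ] N))
    (by rintro t _ ⟨x, rfl⟩; exact ⟨⁅(t : 𝔤), x⁆, f.map_lie _ _⟩) g.support g (fun μ _ => hg μ)
    ⟨m, hgm.symm⟩
  have h2 : ∀ μ, ∃ x ∈ wt M μ, f x = g μ := by
    intro μ
    by_cases hμ : μ ∈ g.support
    · obtain ⟨x, hx⟩ := h1 μ hμ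
      exact ⟨x, mem_wt_of_injective hf (by rw [show f x = g μ from hx]; exact hg μ), hx⟩
    · exact ⟨0, Submodule.zero_mem _, by rw [map_zero, Finsupp.notMem_support_iff.mp hμ]⟩
  choose x hx hxg using h2
  have h3 : m = ∑ μ ∈ g.support, x μ := by
    apply hf
    rw [← hgm, map_sum, Finsupp.sum]
    exact Finset.sum_congr rfl fun μ _ => (hxg μ).symm
  rw [h3]
  exact Submodule.sum_mem _ fun μ _ => Submodule.mem_iSup_of_mem μ (hx μ)

lemma wt_eq_map_of_surjective (hM : IsWeightModule H M) {f : M →ₗ⁅ℂ,𝔤⁆ N}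
    (hf : Function.Surjective f) (μ : Dual ℂ H) :
    wt N μ = (wt M μ).map (f : M →ₗ[ℂ] N) := by
  refine wt_eq_of_iSup_eq_top (A := fun μ => (wt M μ).map (f : M →ₗ[ℂ] N)) ?_ ?_ μ
  · rintro μ _ ⟨m, hm, rfl⟩
    exact map_mem_wt f hm
  · rw [← Submodule.map_iSup, show ⨆ μ : Dual ℂ H, wt M μ = ⊤ from hM, Submodule.map_top]
    exact LinearMap.range_eq_top.mpr hf

lemma IsWeightModule.of_surjective (hM : IsWeightModule H M) {f : M →ₗ⁅ℂ,𝔤⁆ N}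
    (hf : Function.Surjective f) : IsWeightModule H N := by
  refine isWeightModule_of_le (A := fun μ => (wt M μ).map (f : M →ₗ[ℂ] N)) ?_ ?_
  · rintro μ _ ⟨m, hm, rfl⟩
    exact map_mem_wt f hm
  · rw [← Submodule.map_iSup, show ⨆ μ : Dual ℂ H, wt M μ = ⊤ from hM, Submodule.map_top]
    exact LinearMap.range_eq_top.mpr hf

lemma tmul_mem_wt {μ ν : Dual ℂ H} {m : M} {n : N} (hm : m ∈ wt M μ) (hn : n ∈ wt N ν) :
    m ⊗ₜ[ℂ] n ∈ wt (M ⊗[ℂ] N) (μ + ν) := by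
  rw [mem_wt] at hm hn ⊢
  intro t
  rw [TensorProduct.LieModule.lie_tmul_right, hm, hn, LinearMap.add_apply, add_smul,
    TensorProduct.smul_tmul', TensorProduct.tmul_smul, TensorProduct.smul_tmul']

/-- The weight space of a tensor product in terms of the weight spaces of the factors. -/
def tensorWt (M N : Type*) [AddCommGroup M] [Module ℂ M] [LieRingModule 𝔤 M] [LieModule ℂ 𝔤 M]
    [AddCommGroup N] [Module ℂ N] [LieRingModule 𝔤 N] [LieModule ℂ 𝔤 N] (μ : Dual ℂ H) :
    Submodule ℂ (M ⊗[ℂ] N) :=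
  ⨆ ν : Dual ℂ H, Submodule.map₂ (TensorProduct.mk ℂ M N) (wt M ν) (wt N (μ - ν))

lemma tensorWt_le (μ : Dual ℂ H) : tensorWt M N μ ≤ wt (M ⊗[ℂ] N) μ := by
  refine iSup_le fun ν => Submodule.map₂_le.mpr fun m hm n hn => ?_
  have := tmul_mem_wt hm hn
  rwa [add_sub_cancel] at this

lemma iSup_tensorWt (hM : IsWeightModule H M) (hN : IsWeightModule H N) :
    ⨆ μ : Dual ℂ H, tensorWt M N μ = ⊤ := by
  rw [eq_top_iff]
  intro t _
  induction t using TensorProduct.induction_on with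
  | zero => exact Submodule.zero_mem _
  | add a b ha hb => exact Submodule.add_mem _ (ha trivial) (hb trivial)
  | tmul m n =>
    refine hM.induction (P := (⨆ μ : Dual ℂ H, tensorWt M N μ).comap
      ((TensorProduct.mk ℂ M N).flip n)) (fun ν m hm => ?_) m
    refine hN.induction (P := (⨆ μ : Dual ℂ H, tensorWt M N μ).comap
      (TensorProduct.mk ℂ M N m)) (fun κ n hn => ?_) n
    refine Submodule.mem_iSup_of_mem (ν + κ) (Submodule.mem_iSup_of_mem ν ?_)
    refine Submodule.apply_mem_map₂ _ hm ?_
    rwa [add_sub_cancel_left]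

lemma IsWeightModule.tensor (hM : IsWeightModule H M) (hN : IsWeightModule H N) :
    IsWeightModule H (M ⊗[ℂ] N) :=
  isWeightModule_of_le tensorWt_le (iSup_tensorWt hM hN)

lemma wt_tensor (hM : IsWeightModule H M) (hN : IsWeightModule H N) (μ : Dual ℂ H) :
    wt (M ⊗[ℂ] N) μ = tensorWt M N μ :=
  wt_eq_of_iSup_eq_top tensorWt_le (iSup_tensorWt hM hN) μ

end WeightModules

/-! ### The category `Õ`: heights, tensor products, Verma modules -/

section OTildeFacts

variable {𝔤 : Type*} [LieRing 𝔤] [LieAlgebra ℂ 𝔤] [FiniteDimensional ℂ 𝔤] [IsSemisimple ℂ 𝔤]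
  {H : LieSubalgebra ℂ 𝔤} [H.IsCartanSubalgebra] {b : (rootSystem H).Base}
  {M : Type*} [AddCommGroup M] [Module ℂ M] [LieRingModule 𝔤 M] [LieModule ℂ 𝔤 M]
  {N : Type*} [AddCommGroup N] [Module ℂ N] [LieRingModule 𝔤 N] [LieModule ℂ 𝔤 N]

lemma lie_mem_wt {i : H.root} {x : 𝔤} (hx : x ∈ rootSpace H (i.1 : H → ℂ)) {μ : Dual ℂ H} {m : M}
    (hm : m ∈ wt M μ) : ⁅x, m⁆ ∈ wt M ((rootSystem H).root i + μ) := by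
  rw [mem_wt] at hm ⊢
  intro t
  rw [leibniz_lie, (mem_rootSpace_iff i x).mp hx, hm, lie_smul, smul_lie, ← add_smul]
  rfl

lemma IsOTilde.of_injective (hN : IsOTilde b N) (f : M →ₗ⁅ℂ,𝔤⁆ N)
    (hf : Function.Injective f) : IsOTilde b M := by
  obtain ⟨h1, ⟨s, hs⟩, h3⟩ := hN
  refine ⟨h1.of_injective hf, ⟨s, fun μ hμ => hs μ ?_⟩, fun μ => ?_⟩
  · rw [mem_supp, Submodule.ne_bot_iff] at hμ
    obtain ⟨m, hm, hm0⟩ := hμ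
    exact mem_supp_of_mem (map_mem_wt f hm) (fun h => hm0 (hf (by rw [h, map_zero])))
  · have := h3 μ
    let g : wt M μ →ₗ[ℂ] wt N μ := (f : M →ₗ[ℂ] N).restrict fun m hm => map_mem_wt f hm
    exact FiniteDimensional.of_injective g fun x y h => Subtype.ext (hf (congrArg Subtype.val h))

lemma IsOTilde.of_surjective (hM : IsOTilde b M) (f : M →ₗ⁅ℂ,𝔤⁆ N)
    (hf : Function.Surjective f) : IsOTilde b N := by
  obtain ⟨h1, ⟨s, hs⟩, h3⟩ := hM
  refine ⟨h1.of_surjective hf, ⟨s, fun μ hμ => hs μ ?_⟩, fun μ => ?_⟩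
  · rw [mem_supp, wt_eq_map_of_surjective h1 hf] at hμ
    rw [mem_supp]
    rintro h
    rw [h, Submodule.map_bot] at hμ
    exact hμ rfl
  · have := h3 μ
    have h4 : FiniteDimensional ℂ (wt N μ) := by
      rw [wt_eq_map_of_surjective h1 hf]
      infer_instance
    exact h4

lemma IsOTilde.of_equiv (hM : IsOTilde b M) (e : M ≃ₗ⁅ℂ,𝔤⁆ N) : IsOTilde b N :=
  hM.of_surjective e.toLieModuleHom e.surjective

lemma IsOTilde.exists_ht_le (hM : IsOTilde b M) : ∃ C : ℝ, ∀ μ ∈ supp H M, ht b μ ≤ C := by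
  obtain ⟨s, hs⟩ := hM.supp_bounded
  obtain ⟨C, hC⟩ := (s.image (ht b)).bddAbove
  refine ⟨C, fun μ hμ => ?_⟩
  obtain ⟨ν, hν, κ, hκ, rfl⟩ := hs μ hμ
  have h1 := hC (Finset.mem_coe.mpr (Finset.mem_image_of_mem (ht b) hν))
  rw [map_add]
  linarith [ht_nonpos_of_mem_negCone hκ]

lemma IsOTilde.finite_ht_ge (hM : IsOTilde b M) (c : ℝ) :
    {μ | μ ∈ supp H M ∧ c ≤ ht b μ}.Finite := by
  obtain ⟨s, hs⟩ := hM.supp_bounded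
  refine (s.finite_toSet.biUnion fun ν _ =>
    (finite_negCone_ht_ge b (c - ht b ν)).image fun κ => ν + κ).subset ?_
  rintro μ ⟨hμ, hc⟩
  obtain ⟨ν, hν, κ, hκ, rfl⟩ := hs μ hμ
  rw [map_add] at hc
  exact Set.mem_biUnion hν ⟨κ, ⟨hκ, by linarith⟩, rfl⟩

/-- Descending induction on the height of weights. -/
lemma IsOTilde.ht_induction (hM : IsOTilde b M) {Q : Dual ℂ H → Prop}
    (h0 : ∀ μ ∉ supp H M, Q μ) (h : ∀ μ, (∀ ν, ht b μ + 1 ≤ ht b ν → Q ν) → Q μ)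
    (μ : Dual ℂ H) : Q μ := by
  obtain ⟨C, hC⟩ := hM.exists_ht_le
  suffices key : ∀ (n : ℕ) μ, C - n < ht b μ → Q μ by
    obtain ⟨n, hn⟩ := exists_nat_gt (C - ht b μ)
    exact key n μ (by linarith)
  intro n
  induction n with
  | zero =>
    intro μ hμ
    refine h0 μ fun h1 => ?_
    have := hC μ h1
    simp only [Nat.cast_zero, sub_zero] at hμ
    linarith
  | succ n ih =>
    intro μ hμ
    refine h μ fun ν hν => ih ν ?_
    push_cast at hμ
    linarith

lemma IsOTilde.tensor (hM : IsOTilde b M) (hN : IsOTilde b N) : IsOTilde b (M ⊗[ℂ] N) := by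
  classical
  have hw := wt_tensor hM.isWeightModule hN.isWeightModule
  have hbot : ∀ μ ν : Dual ℂ H, ¬ (ν ∈ supp H M ∧ μ - ν ∈ supp H N) →
      Submodule.map₂ (TensorProduct.mk ℂ M N) (wt M ν) (wt N (μ - ν)) = ⊥ := by
    intro μ ν h
    by_cases h1 : ν ∈ supp H M
    · rw [wt_eq_bot (fun h2 => h ⟨h1, h2⟩), Submodule.map₂_bot_right]
    · rw [wt_eq_bot h1, Submodule.map₂_bot_left]
  refine ⟨hM.isWeightModule.tensor hN.isWeightModule, ?_, fun μ => ?_⟩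
  · obtain ⟨s, hs⟩ := hM.supp_bounded
    obtain ⟨t, ht⟩ := hN.supp_bounded
    refine ⟨Finset.image₂ (· + ·) s t, fun μ hμ => ?_⟩
    rw [mem_supp, hw] at hμ
    obtain ⟨ν, hν⟩ : ∃ ν, ν ∈ supp H M ∧ μ - ν ∈ supp H N := by
      by_contra! hc
      refine hμ (iSup_eq_bot.mpr fun ν => hbot μ ν fun h => hc ν h.1 h.2)
    obtain ⟨α, hα, κ, hκ, h1⟩ := hs _ hν.1
    obtain ⟨α', hα', κ', hκ', h2⟩ := ht _ hν.2
    refine ⟨α + α', Finset.mem_image₂_of_mem hα hα', κ + κ', add_mem hκ hκ', ?_⟩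
    rw [← add_sub_cancel ν μ, h2, h1]; abel
  -- If `M_ν ⊗ N_{μ-ν}` is nonzero then `ht (μ - ν) ≤ C`, so `ht ν ≥ ht μ - C`, which leaves
  -- finitely many `ν`.
  · obtain ⟨C, hC⟩ := hN.exists_ht_le
    have hfin := hM.finite_ht_ge (ht b μ - C)
    have h1 : wt (M ⊗[ℂ] N) μ ≤ ⨆ ν ∈ hfin.toFinset,
        Submodule.map₂ (TensorProduct.mk ℂ M N) (wt M ν) (wt N (μ - ν)) := by
      rw [hw]
      refine iSup_le fun ν => ?_
      by_cases h : ν ∈ supp H M ∧ μ - ν ∈ supp H N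
      · have h2 := hC _ h.2
        rw [map_sub] at h2
        exact le_iSup₂_of_le (f := fun ν (_ : ν ∈ hfin.toFinset) =>
          Submodule.map₂ (TensorProduct.mk ℂ M N) (wt M ν) (wt N (μ - ν))) ν
          (by rw [Set.Finite.mem_toFinset]; exact ⟨h.1, by linarith⟩) le_rfl
      · rw [hbot μ ν h]; exact bot_le
    have h2 : (⨆ ν ∈ hfin.toFinset,
        Submodule.map₂ (TensorProduct.mk ℂ M N) (wt M ν) (wt N (μ - ν))).FG := by
      refine Submodule.fg_biSup _ _ fun ν _ => ?_
      have f1 : (wt M ν).FG := Module.Finite.iff_fg.mp (hM.finiteDimensional ν)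
      have f2 : (wt N (μ - ν)).FG := Module.Finite.iff_fg.mp (hN.finiteDimensional (μ - ν))
      exact f1.map₂ _ f2
    have : FiniteDimensional ℂ ↥(⨆ ν ∈ hfin.toFinset,
        Submodule.map₂ (TensorProduct.mk ℂ M N) (wt M ν) (wt N (μ - ν))) :=
      Module.Finite.iff_fg.mpr h2
    exact Submodule.finiteDimensional_of_le h1

/-- The subspaces reached by negative root vectors from a family of subspaces indexed by weights. -/
def low (b : (rootSystem H).Base) (D : Dual ℂ H → Submodule ℂ M) (μ : Dual ℂ H) :
    Submodule ℂ M :=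
  ⨆ (i : H.root) (_ : ¬ b.IsPos i), Submodule.map₂ (toEnd ℂ 𝔤 M : 𝔤 →ₗ[ℂ] End ℂ M)
    (rootSpace H (i.1 : H → ℂ)).toSubmodule (D (μ - (rootSystem H).root i))

lemma low_le {D : Dual ℂ H → Submodule ℂ M} {μ : Dual ℂ H} {P : Submodule ℂ M}
    (h : ∀ i : H.root, ¬ b.IsPos i → ∀ x ∈ rootSpace H (i.1 : H → ℂ),
      ∀ m ∈ D (μ - (rootSystem H).root i), ⁅x, m⁆ ∈ P) : low b D μ ≤ P :=
  iSup₂_le fun i hi => Submodule.map₂_le.mpr fun x hx m hm => h i hi x hx m hm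

lemma lie_mem_low {D : Dual ℂ H → Submodule ℂ M} {μ : Dual ℂ H} {i : H.root} (hi : ¬ b.IsPos i)
    {x : 𝔤} (hx : x ∈ rootSpace H (i.1 : H → ℂ)) {m : M} (hm : m ∈ D (μ - (rootSystem H).root i)) :
    ⁅x, m⁆ ∈ low b D μ :=
  Submodule.mem_iSup_of_mem i (Submodule.mem_iSup_of_mem hi (Submodule.apply_mem_map₂ _ hx hm))

lemma lie_mem_iSup_low {D : Dual ℂ H → Submodule ℂ M} {x : 𝔤} (hx : x ∈ nNeg b) {m : M}
    (hm : m ∈ ⨆ μ, D μ) : ⁅x, m⁆ ∈ ⨆ μ, low b D μ := by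
  have h1 : ⨆ μ, D μ ≤ (⨆ μ, low b D μ).comap (toEnd ℂ 𝔤 M x) := by
    refine iSup_le fun μ m hm => ?_
    refine nNeg_le (P := (⨆ μ, low b D μ).comap ((toEnd ℂ 𝔤 M : 𝔤 →ₗ[ℂ] End ℂ M).flip m)) ?_ x hx
    intro i hi x hx
    refine Submodule.mem_iSup_of_mem (μ + (rootSystem H).root i) (lie_mem_low hi hx ?_)
    rwa [add_sub_cancel_right]
  exact h1 hm

lemma low_wt_le (μ : Dual ℂ H) : low b (wt M) μ ≤ wt M μ :=
  low_le fun i _ x hx m hm => by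
    have := lie_mem_wt hx hm
    rwa [add_sub_cancel] at this

lemma low_fg {D : Dual ℂ H → Submodule ℂ M} {μ : Dual ℂ H}
    (h : ∀ i : H.root, ¬ b.IsPos i → (D (μ - (rootSystem H).root i)).FG) : (low b D μ).FG := by
  refine Submodule.fg_iSup _ fun i => ?_
  by_cases hi : b.IsPos i
  · have : (⨆ (_ : ¬ b.IsPos i), Submodule.map₂ (toEnd ℂ 𝔤 M : 𝔤 →ₗ[ℂ] End ℂ M)
      (rootSpace H (i.1 : H → ℂ)).toSubmodule (D (μ - (rootSystem H).root i))) = ⊥ := by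
      simp [hi]
    rw [this]; exact Submodule.fg_bot
  · refine Submodule.fg_iSup _ fun _ => Submodule.FG.map₂ _ ?_ (h i hi)
    exact IsNoetherian.noetherian _

variable (b) in
lemma vermaGen_mem_wt (μ : Dual ℂ H) : vermaGen b μ ∈ wt (Verma b μ) μ :=
  mem_wt.mpr (isHighest_vermaGen b μ).cartan

-- The sum of the weight spaces with weights in `μ + ℕ₀R₋` contains the generator and is stable
-- under `𝔫₋`, so it is everything.
variable (b) in
lemma verma_weights (μ : Dual ℂ H) : IsWeightModule H (Verma b μ) ∧
    ∀ ν ∈ supp H (Verma b μ), ν - μ ∈ negCone b := by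
  classical
  have hgen := vermaGen_mem_wt b μ
  let A : Dual ℂ H → Submodule ℂ (Verma b μ) :=
    fun ν => if ν - μ ∈ negCone b then wt (Verma b μ) ν else ⊥
  have hAle : ∀ ν, A ν ≤ wt (Verma b μ) ν := fun ν => by
    simp only [A]; split_ifs
    · exact le_rfl
    · exact bot_le
  have hA : ⨆ ν, A ν = ⊤ := by
    rw [eq_top_iff]
    intro v _
    obtain ⟨u, rfl⟩ := verma_surjective b μ v
    refine uact_mem _ ?_ u ?_
    · intro x m hm
      have h1 := lie_mem_iSup_low x.2 hm
      refine (iSup_mono fun ν => ?_ : ⨆ ν, low b A ν ≤ ⨆ ν, A ν) h1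
      refine low_le fun i hi x hx m hm => ?_
      by_cases hc : ν - (rootSystem H).root i - μ ∈ negCone b
      · have h2 : ν - μ ∈ negCone b := by
          have := add_mem hc (root_mem_negCone hi)
          convert this using 1; abel
        simp only [A, if_pos hc, if_pos h2] at hm ⊢
        have := lie_mem_wt hx hm
        rwa [add_sub_cancel] at this
      · simp only [A, if_neg hc, Submodule.mem_bot] at hm
        rw [hm, lie_zero]; exact Submodule.zero_mem _
    · refine Submodule.mem_iSup_of_mem μ ?_
      simp only [A, sub_self, zero_mem, if_true]
      exact hgen
  have hwA := wt_eq_of_iSup_eq_top hAle hA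
  refine ⟨isWeightModule_of_le hAle hA, fun ν hν => ?_⟩
  by_contra hc
  rw [mem_supp, hwA] at hν
  simp only [A, if_neg hc] at hν
  exact hν rfl

variable (b) in
/-- Verma modules are objects of `Õ`. -/
lemma isOTilde_verma (μ : Dual ℂ H) : IsOTilde b (Verma b μ) := by
  classical
  have hgen := vermaGen_mem_wt b μ
  obtain ⟨hwm, hsupp⟩ := verma_weights b μ
  -- Every weight space except the line of the generator is reached by negative root vectors from
  -- weight spaces of greater height. Finite dimension therefore descends by induction on the
  -- height.
  let B : Dual ℂ H → Submodule ℂ (Verma b μ) :=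
    fun ν => if ν = μ then Submodule.span ℂ {vermaGen b μ} else low b (wt (Verma b μ)) ν
  have hBle : ∀ ν, B ν ≤ wt (Verma b μ) ν := fun ν => by
    simp only [B]; split_ifs with h
    · rw [h, Submodule.span_singleton_le_iff_mem]; exact hgen
    · exact low_wt_le ν
  have hB : ⨆ ν, B ν = ⊤ := by
    rw [eq_top_iff]
    intro v _
    obtain ⟨u, rfl⟩ := verma_surjective b μ v
    refine uact_mem _ ?_ u ?_
    · intro x m hm
      have hm' : m ∈ ⨆ ν : Dual ℂ H, wt (Verma b μ) ν := by
        rw [show ⨆ ν : Dual ℂ H, wt (Verma b μ) ν = ⊤ from hwm]; trivial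
      have h1 := lie_mem_iSup_low x.2 hm'
      refine (iSup_mono fun ν => ?_ : ⨆ ν, low b (wt (Verma b μ)) ν ≤ ⨆ ν, B ν) h1
      by_cases hν : ν = μ
      · refine low_le fun i hi x hx m hm => ?_
        have h2 : ν - (rootSystem H).root i ∉ supp H (Verma b μ) := by
          intro hs
          have h3 := ht_nonpos_of_mem_negCone (hsupp _ hs)
          have h4 := ht_root_neg b hi
          rw [hν, sub_sub_cancel_left, map_neg] at h3
          linarith
        rw [wt_eq_bot h2, Submodule.mem_bot] at hm
        rw [hm, lie_zero]; exact Submodule.zero_mem _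
      · simp only [B, if_neg hν]; exact le_rfl
    · refine Submodule.mem_iSup_of_mem μ ?_
      simp only [B, if_true]
      exact Submodule.mem_span_singleton_self _
  have hwB := wt_eq_of_iSup_eq_top hBle hB
  have hfin : ∀ (n : ℕ) (ν : Dual ℂ H), ht b μ - n < ht b ν → (wt (Verma b μ) ν).FG := by
    intro n
    induction n with
    | zero =>
      intro ν hν
      rw [wt_eq_bot (fun hs => ?_)]
      · exact Submodule.fg_bot
      · have := ht_nonpos_of_mem_negCone (hsupp ν hs)
        rw [map_sub] at this
        simp only [Nat.cast_zero] at hν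
        linarith
    | succ n ih =>
      intro ν hν
      rw [hwB]
      simp only [B]
      split_ifs with h
      · exact Submodule.fg_span_singleton _
      · refine low_fg fun i hi => ih _ ?_
        have := ht_root_neg b hi
        rw [map_sub]
        push_cast at hν
        linarith
  refine ⟨hwm, ⟨{μ}, fun ν hν => ⟨μ, Finset.mem_singleton_self _, ν - μ, hsupp ν hν, by abel⟩⟩,
    fun ν => ?_⟩
  obtain ⟨n, hn⟩ := exists_nat_gt (ht b μ - ht b ν)
  exact Module.Finite.iff_fg.mpr (hfin n ν (by linarith))

end OTildeFacts

/-! ### The Casimir operator -/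

section CasimirAbstract

variable {𝔤 : Type*} [LieRing 𝔤] [LieAlgebra ℂ 𝔤] {A : Type*} [Fintype A] (p q : A → 𝔤)
  (M : Type*) [AddCommGroup M] [Module ℂ M] [LieRingModule 𝔤 M] [LieModule ℂ 𝔤 M]

/-- The operator `∑ pₐ qₐ`. -/
def casimirSum : M →ₗ[ℂ] M := ∑ a, toEnd ℂ 𝔤 M (p a) ∘ₗ toEnd ℂ 𝔤 M (q a)

lemma casimirSum_apply (m : M) : casimirSum p q M m = ∑ a, ⁅p a, ⁅q a, m⁆⁆ := by
  simp [casimirSum]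

/-- The operator `∑ pₐ qₐ` attached to dual families with respect to an invariant form commutes
with the Lie algebra. -/
lemma casimirSum_lie [FiniteDimensional ℂ 𝔤]
    (h1 : ∀ z, z = ∑ a, killingForm ℂ 𝔤 z (q a) • p a)
    (h2 : ∀ z, z = ∑ a, killingForm ℂ 𝔤 z (p a) • q a) (z : 𝔤) (m : M) :
    casimirSum p q M ⁅z, m⁆ = ⁅z, casimirSum p q M m⁆ := by
  have e1 : ∀ a, ⁅⁅z, p a⁆, ⁅q a, m⁆⁆ =
      ∑ c, killingForm ℂ 𝔤 ⁅z, p a⁆ (q c) • ⁅p c, ⁅q a, m⁆⁆ := by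
    intro a
    conv_lhs => rw [h1 ⁅z, p a⁆, sum_lie]
    exact Finset.sum_congr rfl fun c _ => smul_lie _ _ _
  have e2 : ∀ a, ⁅p a, ⁅⁅z, q a⁆, m⁆⁆ =
      ∑ c, killingForm ℂ 𝔤 ⁅z, q a⁆ (p c) • ⁅p a, ⁅q c, m⁆⁆ := by
    intro a
    conv_lhs => rw [h2 ⁅z, q a⁆, sum_lie, lie_sum]
    refine Finset.sum_congr rfl fun c _ => ?_
    rw [smul_lie, lie_smul]
  -- Invariance of the Killing form makes the two families of coefficients opposite, so the sums in
  -- `e4` cancel after interchanging the indices.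
  have e3 : ∀ a c, killingForm ℂ 𝔤 ⁅z, p a⁆ (q c) = - killingForm ℂ 𝔤 ⁅z, q c⁆ (p a) := by
    intro a c
    rw [LieModule.traceForm_apply_lie_apply' ℂ 𝔤 𝔤 z (p a) (q c), LieModule.traceForm_comm]
  have e4 : ∑ a, ⁅⁅z, p a⁆, ⁅q a, m⁆⁆ + ∑ a, ⁅p a, ⁅⁅z, q a⁆, m⁆⁆ = 0 := by
    simp_rw [e1, e2, e3, neg_smul]
    rw [Finset.sum_comm, ← Finset.sum_add_distrib]
    refine Finset.sum_eq_zero fun a _ => ?_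
    rw [← Finset.sum_add_distrib]
    exact Finset.sum_eq_zero fun c _ => neg_add_cancel _
  rw [casimirSum_apply, casimirSum_apply, lie_sum]
  have e5 : ∀ a, ⁅z, ⁅p a, ⁅q a, m⁆⁆⁆ =
      ⁅p a, ⁅q a, ⁅z, m⁆⁆⁆ + (⁅⁅z, p a⁆, ⁅q a, m⁆⁆ + ⁅p a, ⁅⁅z, q a⁆, m⁆⁆) := by
    intro a
    rw [leibniz_lie z (p a), leibniz_lie z (q a), lie_add]
    abel
  simp_rw [e5]
  rw [Finset.sum_add_distrib, Finset.sum_add_distrib, e4, add_zero]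

end CasimirAbstract

section Casimir

variable {𝔤 : Type*} [LieRing 𝔤] [LieAlgebra ℂ 𝔤] [FiniteDimensional ℂ 𝔤] [IsSemisimple ℂ 𝔤]
  {H : LieSubalgebra ℂ 𝔤} [H.IsCartanSubalgebra]
  {M : Type*} [AddCommGroup M] [Module ℂ M] [LieRingModule 𝔤 M] [LieModule ℂ 𝔤 M]

lemma exists_root_vectors (i : H.root) : ∃ x ∈ rootSpace H (i.1 : H → ℂ),
    ∃ y ∈ rootSpace H (-(i.1 : H → ℂ)), killingForm ℂ 𝔤 x y = 1 := by
  obtain ⟨h, e, f, isSl2, he, hf⟩ :=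
    exists_isSl2Triple_of_weight_isNonZero (H.isNonZero_coe_root i)
  have h1 := lie_eq_killingForm_smul_of_mem_rootSpace_of_mem_rootSpace_neg he hf
  have h2 : killingForm ℂ 𝔤 e f ≠ 0 := by
    intro h0
    rw [h0, zero_smul, isSl2.lie_e_f] at h1
    exact isSl2.h_ne_zero h1
  refine ⟨(killingForm ℂ 𝔤 e f)⁻¹ • e, Submodule.smul_mem _ _ he, f, hf, ?_⟩
  rw [map_smul, LinearMap.smul_apply, smul_eq_mul, inv_mul_cancel₀ h2]

/-- A root vector. -/
def rootVec (i : H.root) : 𝔤 := (exists_root_vectors i).choose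

lemma rootVec_mem (i : H.root) : rootVec i ∈ rootSpace H (i.1 : H → ℂ) :=
  (exists_root_vectors i).choose_spec.1

/-- The opposite root vector, normalized by the Killing form. -/
def negRootVec (i : H.root) : 𝔤 := (exists_root_vectors i).choose_spec.2.choose

lemma negRootVec_mem (i : H.root) : negRootVec i ∈ rootSpace H (-(i.1 : H → ℂ)) :=
  (exists_root_vectors i).choose_spec.2.choose_spec.1

lemma killingForm_rootVec (i : H.root) : killingForm ℂ 𝔤 (rootVec i) (negRootVec i) = 1 :=
  (exists_root_vectors i).choose_spec.2.choose_spec.2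

lemma exists_eq_smul_of_mem_rootSpace (i : H.root) {x y : 𝔤} (hx : x ∈ rootSpace H (i.1 : H → ℂ))
    (hx0 : x ≠ 0) (hy : y ∈ rootSpace H (i.1 : H → ℂ)) : ∃ c : ℂ, y = c • x := by
  obtain ⟨c, hc⟩ := (finrank_eq_one_iff_of_nonzero' (⟨x, hx⟩ : rootSpace H (i.1 : H → ℂ))
    (by simpa [Subtype.ext_iff] using hx0)).mp
    (finrank_rootSpace_eq_one i.1 (H.isNonZero_coe_root i)) ⟨y, hy⟩
  exact ⟨c, (congrArg Subtype.val hc).symm⟩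

lemma rootVec_ne_zero (i : H.root) : rootVec i ≠ (0 : 𝔤) := by
  intro h
  have := killingForm_rootVec i
  rw [h, map_zero] at this
  simp at this

lemma negRootVec_ne_zero (i : H.root) : negRootVec i ≠ (0 : 𝔤) := by
  intro h
  have := killingForm_rootVec i
  rw [h, map_zero] at this
  simp at this

/-- The opposite of a root. -/
def negRoot (i : H.root) : H.root := ⟨-i.1, by simpa using (H.isNonZero_coe_root i).neg⟩

lemma coe_negRoot (i : H.root) : ((negRoot i).1 : H → ℂ) = -(i.1 : H → ℂ) := rfl

lemma negRoot_negRoot (i : H.root) : negRoot (negRoot i) = i := by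
  apply Subtype.ext
  exact neg_neg i.1

lemma root_negRoot (i : H.root) :
    (rootSystem H).root (negRoot i) = -(rootSystem H).root i := rfl

lemma isPos_negRoot {b : (rootSystem H).Base} {i : H.root} : b.IsPos (negRoot i) ↔ ¬ b.IsPos i := by
  have h1 : (rootSystem H).root ((rootSystem H).reflectionPerm i i) =
      (rootSystem H).root (negRoot i) := by
    rw [RootPairing.root_reflectionPerm, RootPairing.reflection_apply_self, root_negRoot]
  have h2 := (rootSystem H).root.injective h1
  have h3 := b.height_reflectionPerm_self i
  have h3 : b.height (negRoot i) = -b.height i := h2 ▸ h3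
  have h4 := b.height_ne_zero i
  rw [RootPairing.Base.isPos_iff, RootPairing.Base.isPos_iff]
  omega

variable (H) in
/-- The first of two families dual with respect to the Killing form. -/
def casP : Fin (finrank ℂ H) ⊕ H.root → 𝔤 :=
  Sum.elim (fun j => (finBasis ℂ H j : H)) rootVec

variable (H) in
/-- The second of two families dual with respect to the Killing form. -/
def casQ : Fin (finrank ℂ H) ⊕ H.root → 𝔤 :=
  Sum.elim (fun j => (tElt ((finBasis ℂ H).coord j) : H)) negRootVec

omit [IsSemisimple ℂ 𝔤] in
lemma killingForm_eq_zero_of_ne {i j : H.root} (h : (j.1 : H → ℂ) ≠ -(i.1 : H → ℂ)) {x y : 𝔤}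
    (hx : x ∈ rootSpace H (i.1 : H → ℂ)) (hy : y ∈ rootSpace H (j.1 : H → ℂ)) :
    killingForm ℂ 𝔤 x y = 0 := by
  refine killingForm_apply_eq_zero_of_mem_rootSpace_of_add_ne_zero ℂ 𝔤 H hx hy fun h0 => h ?_
  exact eq_neg_of_add_eq_zero_right h0

omit [IsSemisimple ℂ 𝔤] in
lemma root_coe_injective {i j : H.root} (h : (i.1 : H → ℂ) = j.1) : i = j :=
  Subtype.ext (DFunLike.coe_injective h)

/-- The Killing form pairs `H` only with itself and the root space of `α` only with that of `-α`, so
completeness may be checked on `H` and on each root space separately. -/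
lemma casimir_complete (z : 𝔤) : z = ∑ a, killingForm ℂ 𝔤 z (casQ H a) • casP H a := by
  classical
  rw [Fintype.sum_sum_type]
  simp only [casP, casQ, Sum.elim_inl, Sum.elim_inr]
  let R : 𝔤 →ₗ[ℂ] 𝔤 := ∑ j, ((killingForm ℂ 𝔤).flip (tElt ((finBasis ℂ H).coord j) : H)).smulRight
    ((finBasis ℂ H j : H) : 𝔤) + ∑ i : H.root, ((killingForm ℂ 𝔤).flip (negRootVec i)).smulRight
    (rootVec i)
  have hR : ∀ z, R z = ∑ j, killingForm ℂ 𝔤 z (tElt ((finBasis ℂ H).coord j) : H) •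
      ((finBasis ℂ H j : H) : 𝔤) + ∑ i : H.root, killingForm ℂ 𝔤 z (negRootVec i) • rootVec i :=
    fun z => by simp [R]
  rw [← hR]
  refine eq_top_of_triangular (H := H) (P := LinearMap.eqLocus LinearMap.id R) ?_ ?_ z
  · intro t ht
    change t = R t
    rw [hR]
    have h1 : ∀ i : H.root, killingForm ℂ 𝔤 t (negRootVec i) = 0 := fun i =>
      killingForm_cartan_rootSpace ⟨t, ht⟩ (negRoot i) (negRootVec_mem i)
    have h2 : ∀ j, killingForm ℂ 𝔤 t (tElt ((finBasis ℂ H).coord j) : H) =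
        (finBasis ℂ H).coord j ⟨t, ht⟩ := fun j => by
      rw [LieModule.traceForm_comm]
      exact killingForm_tElt _ ⟨t, ht⟩
    simp only [h1, h2, zero_smul, Finset.sum_const_zero, add_zero]
    have h3 := (finBasis ℂ H).sum_repr ⟨t, ht⟩
    have h4 := congrArg (Subtype.val : H → 𝔤) h3
    rw [AddSubmonoidClass.coe_finsetSum] at h4
    exact h4.symm
  · intro k x hx
    change x = R x
    rw [hR]
    have h1 : ∀ j, killingForm ℂ 𝔤 x (tElt ((finBasis ℂ H).coord j) : H) = 0 := fun j => by
      rw [LieModule.traceForm_comm]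
      exact killingForm_cartan_rootSpace _ k hx
    simp only [h1, zero_smul, Finset.sum_const_zero, zero_add]
    rw [Finset.sum_eq_single k]
    · obtain ⟨c, rfl⟩ := exists_eq_smul_of_mem_rootSpace k (rootVec_mem k) (rootVec_ne_zero k) hx
      rw [map_smul, LinearMap.smul_apply, killingForm_rootVec, smul_eq_mul, mul_one]
    · intro i _ hi
      rw [killingForm_eq_zero_of_ne (j := negRoot i) ?_ hx (negRootVec_mem i), zero_smul]
      rw [coe_negRoot, Ne, neg_inj]
      exact fun h => hi (root_coe_injective h)
    · simp

lemma casimir_complete' (z : 𝔤) : z = ∑ a, killingForm ℂ 𝔤 z (casP H a) • casQ H a := by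
  classical
  rw [Fintype.sum_sum_type]
  simp only [casP, casQ, Sum.elim_inl, Sum.elim_inr]
  let R : 𝔤 →ₗ[ℂ] 𝔤 := ∑ j, ((killingForm ℂ 𝔤).flip (finBasis ℂ H j : H)).smulRight
    ((tElt ((finBasis ℂ H).coord j) : H) : 𝔤) + ∑ i : H.root,
      ((killingForm ℂ 𝔤).flip (rootVec i)).smulRight (negRootVec i)
  have hR : ∀ z, R z = ∑ j, killingForm ℂ 𝔤 z (finBasis ℂ H j : H) •
      ((tElt ((finBasis ℂ H).coord j) : H) : 𝔤) +
      ∑ i : H.root, killingForm ℂ 𝔤 z (rootVec i) • negRootVec i :=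
    fun z => by simp [R]
  rw [← hR]
  refine eq_top_of_triangular (H := H) (P := LinearMap.eqLocus LinearMap.id R) ?_ ?_ z
  · intro t ht
    change t = R t
    rw [hR]
    have h1 : ∀ i : H.root, killingForm ℂ 𝔤 t (rootVec i) = 0 := fun i =>
      killingForm_cartan_rootSpace ⟨t, ht⟩ i (rootVec_mem i)
    simp only [h1, zero_smul, Finset.sum_const_zero, add_zero]
    have h3 : (⟨t, ht⟩ : H) = ∑ j, killingForm ℂ 𝔤 t (finBasis ℂ H j : H) •
        tElt ((finBasis ℂ H).coord j) := by
      apply (cartanEquivDual H).injective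
      rw [map_sum]
      ext s
      have h4 : ∀ μ : Dual ℂ H, cartanEquivDual H (tElt μ) = μ := fun μ =>
        LinearEquiv.apply_symm_apply (cartanEquivDual H) μ
      simp only [map_smul, h4, LinearMap.sum_apply, LinearMap.smul_apply, smul_eq_mul]
      have h5 := (finBasis ℂ H).sum_repr s
      conv_lhs => rw [← h5]
      rw [map_sum]
      refine Finset.sum_congr rfl fun j _ => ?_
      rw [map_smul, smul_eq_mul, mul_comm]
      rfl
    have h4 := congrArg (Subtype.val : H → 𝔤) h3
    rw [AddSubmonoidClass.coe_finsetSum] at h4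
    exact h4
  · intro k x hx
    change x = R x
    rw [hR]
    have h1 : ∀ j, killingForm ℂ 𝔤 x (finBasis ℂ H j : H) = 0 := fun j => by
      rw [LieModule.traceForm_comm]
      exact killingForm_cartan_rootSpace _ k hx
    simp only [h1, zero_smul, Finset.sum_const_zero, zero_add]
    rw [Finset.sum_eq_single (negRoot k)]
    · have hy := negRootVec_mem (negRoot k)
      rw [coe_negRoot, neg_neg] at hy
      obtain ⟨c, rfl⟩ := exists_eq_smul_of_mem_rootSpace k hy (negRootVec_ne_zero _) hx
      rw [map_smul, LinearMap.smul_apply, LieModule.traceForm_comm, killingForm_rootVec,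
        smul_eq_mul, mul_one]
    · intro i _ hi
      rw [killingForm_eq_zero_of_ne (j := i) ?_ hx (rootVec_mem i), zero_smul]
      rw [← coe_negRoot]
      exact fun h => hi (root_coe_injective h)
    · simp

variable (H M) in
/-- The Casimir operator. -/
def casimir : M →ₗ[ℂ] M := casimirSum (casP H) (casQ H) M

lemma casimir_lie (z : 𝔤) (m : M) : casimir H M ⁅z, m⁆ = ⁅z, casimir H M m⁆ :=
  casimirSum_lie _ _ _ casimir_complete casimir_complete' z m

lemma casimir_map {N : Type*} [AddCommGroup N] [Module ℂ N] [LieRingModule 𝔤 N]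
    [LieModule ℂ 𝔤 N] (f : M →ₗ⁅ℂ,𝔤⁆ N) (m : M) : f (casimir H M m) = casimir H N (f m) := by
  rw [casimir, casimir, casimirSum_apply, casimirSum_apply, map_sum]
  refine Finset.sum_congr rfl fun a _ => ?_
  rw [LieModuleHom.map_lie, LieModuleHom.map_lie]

open Classical in
/-- The scalar by which the Casimir operator acts on a highest weight vector. -/
def casScalar (b : (rootSystem H).Base) (μ : Dual ℂ H) : ℂ :=
  ∑ i : H.root, (μ (tElt ((rootSystem H).root i)) ^ 2 +
    if b.IsPos i then μ (tElt ((rootSystem H).root i)) else 0)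

lemma apply_tElt_comm (μ ν : Dual ℂ H) : μ (tElt ν) = ν (tElt μ) := by
  rw [← killingForm_tElt, ← killingForm_tElt, LieModule.traceForm_comm]

/-- The restriction of the Killing form to `H` is the sum of the squares of the roots. -/
lemma apply_tElt_self (μ : Dual ℂ H) :
    μ (tElt μ) = ∑ i : H.root, μ (tElt ((rootSystem H).root i)) ^ 2 := by
  have h1 : killingForm ℂ 𝔤 (tElt μ : 𝔤) (tElt μ) = μ (tElt μ) := killingForm_tElt μ _
  have h2 := LinearMap.congr_fun (LinearMap.congr_fun
    (restrict_killingForm_eq_sum (K := ℂ) (L := 𝔤) (H := H)) (tElt μ)) (tElt μ)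
  have h3 : (killingForm ℂ 𝔤).restrict H (tElt μ) (tElt μ) =
    killingForm ℂ 𝔤 (tElt μ : 𝔤) (tElt μ) := rfl
  rw [h3, h1] at h2
  rw [h2, LinearMap.sum_apply, LinearMap.sum_apply, ← Finset.sum_coe_sort]
  refine Finset.sum_congr rfl fun i _ => ?_
  rw [apply_tElt_comm μ, pow_two]
  rfl

/-- The Cartan part contributes `(μ, μ)`. For a positive root `α`, the product of the two root
vectors acts as their bracket `t_α`, hence by `μ(t_α)`; for a negative root the vector applied first
lies in `𝔫₊` and kills `m`. The total is the familiar `(μ, μ + 2ρ)`. -/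
lemma casimir_apply_highest (b : (rootSystem H).Base) {μ : Dual ℂ H} {m : M}
    (hm : IsHighest b μ m) : casimir H M m = casScalar b μ • m := by
  classical
  rw [casimir, casimirSum_apply, Fintype.sum_sum_type]
  simp only [casP, casQ, Sum.elim_inl, Sum.elim_inr]
  have h1 : ∀ j, ⁅((finBasis ℂ H j : H) : 𝔤), ⁅((tElt ((finBasis ℂ H).coord j) : H) : 𝔤), m⁆⁆ =
      ((finBasis ℂ H).repr (tElt μ) j * μ (finBasis ℂ H j)) • m := by
    intro j
    rw [hm.cartan, lie_smul, hm.cartan, smul_smul, apply_tElt_comm]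
    rfl
  have h2 : ∀ i : H.root, ⁅rootVec i, ⁅negRootVec i, m⁆⁆ =
      (if b.IsPos i then μ (tElt ((rootSystem H).root i)) else 0) • m := by
    intro i
    split_ifs with hi
    · rw [leibniz_lie, hm.nPos _ (mem_nPos hi (rootVec_mem i)), lie_zero, add_zero,
        lie_eq_killingForm_smul_of_mem_rootSpace_of_mem_rootSpace_neg (rootVec_mem i)
        (negRootVec_mem i), killingForm_rootVec, one_smul]
      exact hm.cartan _
    · rw [hm.nPos _ (mem_nPos (isPos_negRoot.mpr hi) (negRootVec_mem i)), lie_zero, zero_smul]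
  simp only [h1, h2]
  rw [← Finset.sum_smul, ← Finset.sum_smul, ← add_smul, casScalar, Finset.sum_add_distrib,
    ← apply_tElt_self]
  congr 2
  conv_rhs => rw [← (finBasis ℂ H).sum_repr (tElt μ)]
  rw [map_sum]
  exact Finset.sum_congr rfl fun j _ => by rw [map_smul, smul_eq_mul]

/-! ### Finiteness of the fibres of the Casimir scalar -/

/-- Inner products of roots are rational. With `s = (αᵢ, αᵢ)`, integrality of Cartan numbers gives
`(αₖ, αᵢ) = s nₖ / 2`. Then `s = ∑ (αᵢ, αₖ)² = (s² / 4) ∑ nₖ²`, so `s = 4 / ∑ nₖ²`. -/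
lemma root_apply_tElt_im (i j : H.root) :
    ((rootSystem H).root j (tElt ((rootSystem H).root i))).im = 0 := by
  set s := (rootSystem H).root i (tElt ((rootSystem H).root i)) with hs
  have hs0 : s ≠ 0 := root_apply_cartanEquivDual_symm_ne_zero (H.isNonZero_coe_root i)
  have hint : ∀ k : H.root, ∃ n : ℤ,
      (rootSystem H).root k (tElt ((rootSystem H).root i)) = s / 2 * n := by
    intro k
    refine ⟨(chainBotCoeff i.1 k.1 : ℤ) - chainTopCoeff i.1 k.1, ?_⟩
    have h1 : (k.1 : H → ℂ) (coroot i.1) = _ := apply_coroot_eq_cast i.1 k.1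
    have h2 : (coroot i.1 : H) = (2 * s⁻¹) • tElt ((rootSystem H).root i) := by
      rw [coroot, ← Nat.cast_smul_eq_nsmul ℂ, smul_smul]; rfl
    have h3 : (k.1 : H → ℂ) (coroot i.1) =
        2 * s⁻¹ * (rootSystem H).root k (tElt ((rootSystem H).root i)) := by
      rw [h2]
      exact map_smul ((rootSystem H).root k) _ _
    rw [← h1, h3]
    field_simp
  choose n hn using hint
  have h1 := apply_tElt_self ((rootSystem H).root i)
  rw [← hs] at h1
  have h2 : ∀ k : H.root, (rootSystem H).root i (tElt ((rootSystem H).root k)) ^ 2 =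
      s ^ 2 / 4 * ((n k ^ 2 : ℤ) : ℂ) := by
    intro k
    rw [apply_tElt_comm, hn]
    push_cast
    ring
  simp only [h2] at h1
  rw [← Finset.mul_sum, ← Int.cast_sum] at h1
  set N : ℤ := ∑ k, n k ^ 2
  have h3 : s * (N : ℂ) = 4 := by
    have : s * (4 - s * N) = 0 := by linear_combination 4 * h1
    rcases mul_eq_zero.mp this with h | h
    · exact absurd h hs0
    · linear_combination -h
  have h4 : (N : ℂ) ≠ 0 := by
    rintro h0
    rw [h0, mul_zero] at h3
    norm_num at h3
  have h5 : s = ((4 / (N : ℝ) : ℝ) : ℂ) := by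
    push_cast
    field_simp
    exact h3
  rw [hn, h5]
  have : ((4 / (N : ℝ) : ℝ) : ℂ) / 2 * (n j : ℂ) = ((4 / (N : ℝ) / 2 * n j : ℝ) : ℂ) := by
    push_cast; ring
  rw [this, Complex.ofReal_im]

lemma negCone_apply_tElt_im {b : (rootSystem H).Base} {κ : Dual ℂ H} (hκ : κ ∈ negCone b)
    (i : H.root) : (κ (tElt ((rootSystem H).root i))).im = 0 := by
  induction hκ using AddSubmonoid.closure_induction with
  | mem x hx =>
    obtain ⟨j, -, rfl⟩ := hx
    exact root_apply_tElt_im i j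
  | zero => simp
  | add x y _ _ hx hy => rw [LinearMap.add_apply, Complex.add_im, hx, hy, add_zero]

lemma exists_heightElement_eq (b : (rootSystem H).Base) : ∃ a : H.root → ℂ,
    heightElement b = ∑ i, a i • tElt ((rootSystem H).root i) := by
  have h1 : cartanEquivDual H (heightElement b) ∈
      Submodule.span ℂ (Set.range (rootSystem H).root) := by
    rw [RootPairing.IsRootSystem.span_root_eq_top (P := rootSystem H)]; trivial
  obtain ⟨a, ha⟩ := (Submodule.mem_span_range_iff_exists_fun ℂ).mp h1
  refine ⟨a, (cartanEquivDual H).injective ?_⟩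
  rw [← ha, map_sum]
  refine Finset.sum_congr rfl fun i _ => ?_
  rw [map_smul]
  congr 1
  exact (LinearEquiv.apply_symm_apply (cartanEquivDual H) _).symm

lemma abs_le_of_sum_sq_sub_le {ι : Type*} [Fintype ι] (z : ι → ℝ) {K : ℝ}
    (h : ∑ i, (z i ^ 2 - |z i|) ≤ K) (i : ι) : |z i| ≤ |K| + Fintype.card ι + 2 := by
  classical
  have h0 : ∀ j, -1 ≤ z j ^ 2 - |z j| := fun j => by
    have := sq_abs (z j)
    nlinarith [sq_nonneg (|z j| - 1), abs_nonneg (z j)]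
  have h1 : z i ^ 2 - |z i| ≤ K + Fintype.card ι := by
    rw [← Finset.add_sum_erase _ _ (Finset.mem_univ i)] at h
    have h2 : -((Finset.univ.erase i).card : ℝ) ≤
        ∑ j ∈ Finset.univ.erase i, (z j ^ 2 - |z j|) := by
      have := Finset.card_nsmul_le_sum (Finset.univ.erase i) (fun j => z j ^ 2 - |z j|) (-1)
        (fun j _ => h0 j)
      simpa using this
    have h3 : ((Finset.univ.erase i).card : ℝ) ≤ Fintype.card ι := by
      exact_mod_cast Finset.card_le_univ _
    linarith
  by_contra! hc
  have h4 : (0 : ℝ) ≤ Fintype.card ι := Nat.cast_nonneg _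
  have h5 := le_abs_self K
  have h6 := sq_abs (z i)
  have h7 := abs_nonneg K
  nlinarith

/-- Elements of the cone are real on the `t_α`. The real part of the Casimir scalar at `ν + κ` is
thus a sum of squares of the real coordinates plus lower order terms. Fixing its value bounds these
coordinates, hence the height of `κ`, and only finitely many elements of the cone have height
bounded below. -/
lemma finite_negCone_casScalar (b : (rootSystem H).Base) (ν : Dual ℂ H) (c : ℂ) :
    {κ | κ ∈ negCone b ∧ casScalar b (ν + κ) = c}.Finite := by
  classical
  obtain ⟨a, ha⟩ := exists_heightElement_eq b
  let t : H.root → H := fun i => tElt ((rootSystem H).root i)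
  -- The imaginary parts of `(ν + κ)(t_α)` do not depend on `κ`; their squares enter the real part
  -- with a minus sign and are moved to the constant.
  let K : ℝ := c.re + ∑ i, (ν (t i)).im ^ 2
  let B : ℝ := |K| + Fintype.card H.root + 2
  refine (finite_negCone_ht_ge b (-∑ i, ‖a i‖ * (B + ‖ν (t i)‖))).subset ?_
  rintro κ ⟨hκ, hc⟩
  refine ⟨hκ, ?_⟩
  have him : ∀ i, (κ (t i)).im = 0 := fun i => negCone_apply_tElt_im hκ i
  have h1 : ∑ i, (((ν + κ) (t i)).re ^ 2 - |((ν + κ) (t i)).re|) ≤ K := by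
    have h2 : c.re = ∑ i, (((ν + κ) (t i)).re ^ 2 - (ν (t i)).im ^ 2 +
        if b.IsPos i then ((ν + κ) (t i)).re else 0) := by
      rw [← hc, casScalar, Complex.re_sum]
      refine Finset.sum_congr rfl fun i _ => ?_
      rw [Complex.add_re]
      congr 1
      · rw [pow_two, Complex.mul_re, ← pow_two, ← pow_two, LinearMap.add_apply, Complex.add_im]
        rw [show (κ (tElt ((rootSystem H).root i))).im = 0 from him i, add_zero]
      · split_ifs <;> rfl
    simp only [K]
    rw [h2, ← Finset.sum_add_distrib]
    refine Finset.sum_le_sum fun i _ => ?_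
    have h3 : -|((ν + κ) (t i)).re| ≤ if b.IsPos i then ((ν + κ) (t i)).re else 0 := by
      split_ifs
      · exact neg_abs_le _
      · linarith [abs_nonneg ((ν + κ) (t i)).re]
    linarith
  have h4 : ∀ i, ‖κ (t i)‖ ≤ B + ‖ν (t i)‖ := by
    intro i
    have h5 : |((ν + κ) (t i)).re| ≤ B :=
      abs_le_of_sum_sq_sub_le (fun i => ((ν + κ) (t i)).re) h1 i
    have h6 : κ (t i) = (((κ (t i)).re : ℝ) : ℂ) := by
      apply Complex.ext <;> simp [him i]
    rw [h6, Complex.norm_real, Real.norm_eq_abs]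
    have h7 : (κ (t i)).re = ((ν + κ) (t i)).re - (ν (t i)).re := by simp
    rw [h7]
    refine (abs_sub _ _).trans (add_le_add h5 (Complex.abs_re_le_norm _))
  have h8 : |ht b κ| ≤ ∑ i, ‖a i‖ * (B + ‖ν (t i)‖) := by
    have h9 : ht b κ = (κ (heightElement b)).re := rfl
    rw [h9, ha, map_sum]
    refine (Complex.abs_re_le_norm _).trans ((norm_sum_le _ _).trans ?_)
    refine Finset.sum_le_sum fun i _ => ?_
    rw [map_smul, smul_eq_mul, norm_mul]
    exact mul_le_mul_of_nonneg_left (h4 i) (norm_nonneg _)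
  exact (abs_le.mp h8).1

lemma IsOTilde.finite_casScalar {b : (rootSystem H).Base} (hM : IsOTilde b M) (c : ℂ) :
    {μ | μ ∈ supp H M ∧ casScalar b μ = c}.Finite := by
  obtain ⟨s, hs⟩ := hM.supp_bounded
  refine (s.finite_toSet.biUnion fun ν _ =>
    (finite_negCone_casScalar b ν c).image fun κ => ν + κ).subset ?_
  rintro μ ⟨hμ, hc⟩
  obtain ⟨ν, hν, κ, hκ, rfl⟩ := hs μ hμ
  exact Set.mem_biUnion hν ⟨κ, ⟨hκ, hc⟩, rfl⟩

end Casimir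

/-! ### Bases of free modules adapted to weights and the Casimir operator -/

section Spans

variable {L : Type*} [LieRing L] [LieAlgebra ℂ L]
  {M : Type*} [AddCommGroup M] [Module ℂ M] [LieRingModule L M] [LieModule ℂ L M]
  {I : Type*}

variable (L) in
/-- The span of part of a family over the enveloping algebra. -/
def uspan (v : I → M) (S : Set I) : Submodule ℂ M :=
  (Finsupp.supported (Env L) ℂ S).map (ucomb (L := L) v)

lemma uact_mem_uspan (v : I → M) {S : Set I} {i : I} (hi : i ∈ S) (u : Env L) :
    uact L M u (v i) ∈ uspan L v S :=
  ⟨Finsupp.single i u, Finsupp.single_mem_supported ℂ u hi, ucomb_single v i u⟩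

lemma mem_uspan (v : I → M) {S : Set I} {i : I} (hi : i ∈ S) : v i ∈ uspan L v S := by
  have h := uact_mem_uspan (L := L) v hi 1
  rwa [map_one] at h

lemma uspan_le {v : I → M} {S : Set I} {P : Submodule ℂ M}
    (h : ∀ i ∈ S, ∀ u, uact L M u (v i) ∈ P) : uspan L v S ≤ P := by
  rintro _ ⟨r, hr, rfl⟩
  rw [ucomb_apply, Finsupp.sum]
  exact P.sum_mem fun i hi => h i (hr hi) _

lemma uspan_mono (v : I → M) {S T : Set I} (h : S ⊆ T) : uspan L v S ≤ uspan L v T :=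
  Submodule.map_mono (Finsupp.supported_mono h)

lemma uspan_univ (v : I → M) : uspan L v Set.univ = LinearMap.range (ucomb (L := L) v) := by
  rw [uspan, Finsupp.supported_univ, Submodule.map_top]

lemma lie_mem_uspan (v : I → M) {S : Set I} (x : L) {m : M} (hm : m ∈ uspan L v S) :
    ⁅x, m⁆ ∈ uspan L v S := by
  have : uspan L v S ≤ (uspan L v S).comap (toEnd ℂ L M x) := by
    refine uspan_le fun i hi u => ?_
    change ⁅x, uact L M u (v i)⁆ ∈ uspan L v S
    rw [← uact_env_mul]
    exact uact_mem_uspan v hi _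
  exact this hm

lemma eq_zero_of_uact_mem_uspan {v : I → M} (hv : Function.Injective (ucomb (L := L) v))
    {S : Set I} {i : I} (hi : i ∉ S) {u : Env L} (hu : uact L M u (v i) ∈ uspan L v S) :
    u = 0 := by
  obtain ⟨r, hr, h⟩ := hu
  rw [← ucomb_single v i u] at h
  have h1 := hv h
  rw [h1] at hr
  by_contra h0
  exact hi (hr (by simpa using h0))

lemma exists_of_mem_uspan_insert {v : I → M} {S : Set I} {i : I} {m : M}
    (hm : m ∈ uspan L v (insert i S)) : ∃ u, m - uact L M u (v i) ∈ uspan L v S := by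
  classical
  obtain ⟨r, hr, rfl⟩ := hm
  refine ⟨r i, r.erase i, ?_, ?_⟩
  · intro j hj
    simp only [Finset.mem_coe, Finsupp.mem_support_iff] at hj
    by_cases hji : j = i
    · subst hji; simp at hj
    · rw [Finsupp.erase_ne hji] at hj
      exact (hr (by simpa using hj)).resolve_left hji
  · have h := congrArg (ucomb (L := L) v) (Finsupp.single_add_erase i r)
    rw [map_add, ucomb_single] at h
    rw [← h, add_sub_cancel_left]

end Spans

section Independence

variable {V : Type*} [AddCommGroup V] [Module ℂ V] {P : Type*}

lemma mem_of_sum_mem_iSup {A Q : P → Submodule ℂ V} (hA : iSupIndep A) (hQ : ∀ p, Q p ≤ A p)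
    (s : Finset P) (w : P → V) (hw : ∀ p, w p ∈ A p) (hs : ∑ p ∈ s, w p ∈ ⨆ p, Q p) :
    ∀ p ∈ s, w p ∈ Q p := by
  classical
  obtain ⟨q, hq, hqs⟩ := (Submodule.mem_iSup_iff_exists_finsupp _ _).mp hs
  rw [iSupIndep_iff_finsetSum_eq_zero_imp_eq_zero] at hA
  have h1 := hA (s ∪ q.support) (fun p => (if p ∈ s then w p else 0) - q p) (fun p _ =>
    (A p).sub_mem (by split_ifs; exacts [hw p, (A p).zero_mem]) (hQ p (hq p))) ?_
  · intro p hp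
    have h2 := h1 p (Finset.mem_union_left _ hp)
    rw [if_pos hp, sub_eq_zero] at h2
    rw [h2]; exact hq p
  · rw [Finset.sum_sub_distrib, sub_eq_zero, Finset.sum_ite_mem,
      Finset.inter_eq_right.mpr Finset.subset_union_left, ← hqs, Finsupp.sum]
    exact Finset.sum_subset Finset.subset_union_right fun p _ hp => by
      simpa using hp

/-- Bases of complements of the `Q p` in independent spaces `A p` are independent modulo the sum
of the `Q p`. -/
lemma eq_zero_of_sum_mem_iSup {A Q W : P → Submodule ℂ V} (hA : iSupIndep A)
    (hQ : ∀ p, Q p ≤ A p) (hW : ∀ p, W p ≤ A p) (hQW : ∀ p, Disjoint (Q p) (W p))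
    {n : P → ℕ} (B : ∀ p, Basis (Fin (n p)) ℂ (W p)) (ε : (Σ p, Fin (n p)) →₀ ℂ)
    (hε : ε.sum (fun j a => a • (B j.1 j.2 : V)) ∈ ⨆ p, Q p) : ε = 0 := by
  classical
  let s := ε.support.image Sigma.fst
  let w : P → V := fun p => ∑ k, ε ⟨p, k⟩ • (B p k : V)
  have hwW : ∀ p, w p ∈ W p := fun p =>
    Submodule.sum_mem _ fun k _ => Submodule.smul_mem _ _ (B p k).2
  have hsum : ε.sum (fun j a => a • (B j.1 j.2 : V)) = ∑ p ∈ s, w p := by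
    rw [Finsupp.sum_of_support_subset ε (s := s.sigma fun _ => Finset.univ) _ _ (by simp),
      Finset.sum_sigma]
    intro j hj
    rw [Finset.mem_sigma]
    exact ⟨Finset.mem_image_of_mem _ hj, Finset.mem_univ _⟩
  rw [hsum] at hε
  have h1 := mem_of_sum_mem_iSup hA hQ s w (fun p => hW p (hwW p)) hε
  ext ⟨p, k⟩
  rw [Finsupp.zero_apply]
  by_contra h0
  have hp : p ∈ s := Finset.mem_image.mpr ⟨⟨p, k⟩, by simpa using h0, rfl⟩
  have h2 : w p = 0 := by
    have := (hQW p).le_bot ⟨h1 p hp, hwW p⟩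
    simpa using this
  have h3 : ∑ k, ε ⟨p, k⟩ • B p k = 0 := by
    apply Subtype.ext
    refine Eq.trans ?_ h2
    simp [w]
  exact h0 (Fintype.linearIndependent_iff.mp (B p).linearIndependent (fun k => ε ⟨p, k⟩) h3 k)

end Independence

/-! ### Generalized eigenspaces of the Casimir operator and adapted bases -/

section Blocks

variable {𝔤 : Type*} [LieRing 𝔤] [LieAlgebra ℂ 𝔤] [FiniteDimensional ℂ 𝔤] [IsSemisimple ℂ 𝔤]
  {H : LieSubalgebra ℂ 𝔤} [H.IsCartanSubalgebra] {b : (rootSystem H).Base}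
  {D : Type*} [AddCommGroup D] [Module ℂ D] [LieRingModule 𝔤 D] [LieModule ℂ 𝔤 D]

variable (D) in
/-- The part of a weight space on which the Casimir operator has a single generalized
eigenvalue. -/
def genWt (p : Dual ℂ H × ℂ) : Submodule ℂ D :=
  wt D p.1 ⊓ End.maxGenEigenspace (casimir H D) p.2

lemma casimir_mem_wt {μ : Dual ℂ H} {m : D} (hm : m ∈ wt D μ) : casimir H D m ∈ wt D μ := by
  rw [mem_wt] at hm ⊢
  intro t
  rw [← casimir_lie, hm, map_smul]

/-- The Casimir operator preserves the weight space, which is finite-dimensional over an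
algebraically closed field. -/
lemma wt_eq_iSup_genWt (hD : IsOTilde b D) (μ : Dual ℂ H) : wt D μ = ⨆ c, genWt D (μ, c) := by
  have := hD.finiteDimensional μ
  have hp : ∀ x ∈ wt D μ, casimir H D x ∈ wt D μ := fun x hx => casimir_mem_wt hx
  have h1 := Module.End.iSup_maxGenEigenspace_eq_top ((casimir H D).restrict hp)
  have h2 := congrArg (Submodule.map (wt D μ).subtype) h1
  rw [Submodule.map_iSup, Submodule.map_top, Submodule.range_subtype] at h2
  refine h2.symm.trans ?_
  refine iSup_congr fun c => ?_
  exact (Submodule.inf_genEigenspace (casimir H D) (wt D μ) hp (μ := c) (k := ⊤)).symm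

lemma iSup_genWt (hD : IsOTilde b D) : ⨆ p : Dual ℂ H × ℂ, genWt D p = ⊤ := by
  rw [iSup_prod]
  simp_rw [← wt_eq_iSup_genWt hD]
  exact hD.isWeightModule

lemma iSupIndep_genWt : iSupIndep fun p : Dual ℂ H × ℂ => genWt D p := by
  classical
  rw [iSupIndep_iff_finsetSum_eq_zero_imp_eq_zero]
  intro s f hf hs p hp
  have h1 := mem_of_sum_mem (H := H) (P := (⊥ : Submodule ℂ D)) (by simp) (s.image Prod.fst)
    (fun μ => ∑ q ∈ s with q.1 = μ, f q)
    (fun μ _ => Submodule.sum_mem _ fun q hq => by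
      obtain ⟨hq, h⟩ := Finset.mem_filter.mp hq
      exact h ▸ (hf q hq).1)
    (by
      rw [Finset.sum_fiberwise_of_maps_to (g := Prod.fst)
        (fun q hq => Finset.mem_image_of_mem _ hq) f, hs]
      simp)
    p.1 (Finset.mem_image_of_mem _ hp)
  rw [Submodule.mem_bot] at h1
  have h2 := ((iSupIndep_iff_finsetSum_eq_zero_imp_eq_zero _).mp
    (Module.End.independent_maxGenEigenspace (casimir H D))) ((s.filter fun q => q.1 = p.1).image
      Prod.snd) (fun c => f (p.1, c)) ?_ ?_ p.2 ?_
  · exact h2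
  · intro c hc
    obtain ⟨q, hq, rfl⟩ := Finset.mem_image.mp hc
    obtain ⟨hq, hq1⟩ := Finset.mem_filter.mp hq
    have := (hf q hq).2
    rwa [← hq1]
  · rw [Finset.sum_image, ← h1]
    · refine Finset.sum_congr rfl fun q hq => ?_
      rw [← (Finset.mem_filter.mp hq).2]
    · intro q hq q' hq' h
      have e1 := (Finset.mem_filter.mp hq).2
      have e2 := (Finset.mem_filter.mp hq').2
      exact Prod.ext (e1.trans e2.symm) h
  · exact Finset.mem_image.mpr ⟨p, Finset.mem_filter.mpr ⟨hp, rfl⟩, rfl⟩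

lemma lie_mem_maxGenEigenspace (x : 𝔤) {c : ℂ} {m : D}
    (hm : m ∈ End.maxGenEigenspace (casimir H D) c) :
    ⁅x, m⁆ ∈ End.maxGenEigenspace (casimir H D) c := by
  have hc : Commute (casimir H D) (toEnd ℂ 𝔤 D x) := by
    ext m
    exact casimir_lie x m
  exact Module.End.mapsTo_maxGenEigenspace_of_comm hc c hm

lemma lie_mem_genWt {i : H.root} {x : 𝔤} (hx : x ∈ rootSpace H (i.1 : H → ℂ)) {μ : Dual ℂ H}
    {c : ℂ} {m : D} (hm : m ∈ genWt D (μ, c)) :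
    ⁅x, m⁆ ∈ genWt D ((rootSystem H).root i + μ, c) :=
  ⟨lie_mem_wt hx hm.1, lie_mem_maxGenEigenspace x hm.2⟩

lemma low_genWt_le (p : Dual ℂ H × ℂ) : low b (fun ν => genWt D (ν, p.2)) p.1 ≤ genWt D p :=
  low_le fun i _ x hx m hm => by
    have := lie_mem_genWt hx hm
    rwa [add_sub_cancel] at this

lemma lie_mem_iSup_low_genWt (hD : IsOTilde b D) {x : 𝔤} (hx : x ∈ nNeg b) (m : D) :
    ⁅x, m⁆ ∈ ⨆ p : Dual ℂ H × ℂ, low b (fun ν => genWt D (ν, p.2)) p.1 := by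
  have hm : m ∈ ⨆ p : Dual ℂ H × ℂ, genWt D p := by rw [iSup_genWt hD]; trivial
  have h1 : ⨆ p : Dual ℂ H × ℂ, genWt D p ≤
      (⨆ p : Dual ℂ H × ℂ, low b (fun ν => genWt D (ν, p.2)) p.1).comap (toEnd ℂ 𝔤 D x) := by
    refine iSup_le fun p m hm => ?_
    have h2 := lie_mem_iSup_low (b := b) (D := fun ν => genWt D (ν, p.2)) hx
      (Submodule.mem_iSup_of_mem p.1 hm)
    have h3 : ⨆ ν, low b (fun ν => genWt D (ν, p.2)) ν ≤
        ⨆ p : Dual ℂ H × ℂ, low b (fun ν => genWt D (ν, p.2)) p.1 := by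
      refine iSup_le fun ν => ?_
      exact le_iSup (fun p : Dual ℂ H × ℂ => low b (fun ν => genWt D (ν, p.2)) p.1) (ν, p.2)
    exact h3 h2
  exact h1 hm

/-- The sum of the weight spaces of height at most `c`. -/
def htLe (b : (rootSystem H).Base) (D : Type*) [AddCommGroup D] [Module ℂ D] [LieRingModule 𝔤 D]
    [LieModule ℂ 𝔤 D] (c : ℝ) : Submodule ℂ D :=
  ⨆ (ν : Dual ℂ H) (_ : ht b ν ≤ c), wt D ν

lemma wt_le_htLe {c : ℝ} {ν : Dual ℂ H} (h : ht b ν ≤ c) : wt D ν ≤ htLe b D c :=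
  le_iSup₂_of_le (f := fun (ν : Dual ℂ H) (_ : ht b ν ≤ c) => wt D ν) ν h le_rfl

lemma htLe_mono {c d : ℝ} (h : c ≤ d) : htLe b D c ≤ htLe b D d :=
  iSup₂_le fun _ hν => wt_le_htLe (hν.trans h)

lemma lie_mem_htLe {c : ℝ} {x : 𝔤} (hx : x ∈ nNeg b) {m : D} (hm : m ∈ htLe b D c) :
    ⁅x, m⁆ ∈ htLe b D (c - 1) := by
  have : htLe b D c ≤ (htLe b D (c - 1)).comap (toEnd ℂ 𝔤 D x) := by
    refine iSup₂_le fun ν hν m hm => ?_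
    refine nNeg_le (P := (htLe b D (c - 1)).comap ((toEnd ℂ 𝔤 D : 𝔤 →ₗ[ℂ] End ℂ D).flip m)) ?_ x hx
    intro i hi x hx
    refine wt_le_htLe ?_ (lie_mem_wt hx hm)
    rw [map_add]
    linarith [ht_root_neg b hi]
  exact this hm

lemma uact_mem_htLe {c : ℝ} (u : Env (nNeg b)) {m : D} (hm : m ∈ htLe b D c) :
    uact (nNeg b) D u m ∈ htLe b D c :=
  uact_mem (L := nNeg b) _ (fun x _ hm => htLe_mono (by linarith) (lie_mem_htLe x.2 hm)) u hm

lemma eq_zero_of_mem_htLe {c : ℝ} {m : D} {s : Finset (Dual ℂ H)}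
    (hs : ∀ ν ∈ s, c < ht b ν) (hm : m ∈ ⨆ ν ∈ s, wt D ν) (hmc : m ∈ htLe b D c) : m = 0 := by
  have h := (iSupIndep_wt (H := H) (M := D)).disjoint_biSup_biSup (s := (s : Set (Dual ℂ H)))
    (t := {ν | ht b ν ≤ c}) (by
      rw [Set.disjoint_left]
      intro ν h1 h2
      exact absurd h2 (not_le.mpr (hs ν h1)))
  simpa using h.le_bot ⟨hm, hmc⟩

/-- The elements of the enveloping algebra of `𝔫₋` that lower heights by at least `k`. -/
def lowering (b : (rootSystem H).Base) (k : ℕ) : Submodule ℂ (Env (nNeg b)) :=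
  -- Lowering is measured on `Δ(0)`. Being free of rank one over `U(𝔫₋)`, it is faithful, and its
  -- weights stand in for a grading of `U(𝔫₋)`.
  ⨅ (c : ℝ) (m : htLe b (Verma b (0 : Dual ℂ H)) c),
    (htLe b (Verma b (0 : Dual ℂ H)) (c - k)).comap ((uact (nNeg b) _).toLinearMap.flip m.1)

lemma mem_lowering {k : ℕ} {u : Env (nNeg b)} : u ∈ lowering b k ↔
    ∀ c, ∀ m ∈ htLe b (Verma b (0 : Dual ℂ H)) c,
      uact (nNeg b) _ u m ∈ htLe b (Verma b (0 : Dual ℂ H)) (c - k) := by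
  simp [lowering, Submodule.mem_iInf]

/-- The vector `u · vermaGen` has finitely many weight components, so it cannot have arbitrarily low
height unless it vanishes; freeness of `Δ(0)` then gives `u = 0`. -/
lemma eq_zero_of_mem_lowering {u : Env (nNeg b)} (h : ∀ k, u ∈ lowering b k) : u = 0 := by
  have hO := isOTilde_verma b (0 : Dual ℂ H)
  set m := uact (nNeg b) _ u (vermaGen b (0 : Dual ℂ H)) with hm
  have h1 : ∀ k : ℕ, m ∈ htLe b (Verma b (0 : Dual ℂ H)) (0 - k) := fun k =>
    mem_lowering.mp (h k) 0 _ (wt_le_htLe (by simp) (vermaGen_mem_wt b 0))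
  obtain ⟨f, hf, hfm⟩ := hO.isWeightModule.exists_finsupp m
  obtain ⟨C, hC⟩ := (f.support.image (ht b)).bddBelow
  obtain ⟨k, hk⟩ := exists_nat_gt (-C)
  have h2 : m = 0 := by
    refine eq_zero_of_mem_htLe (s := f.support) (fun ν hν => ?_) ?_ (h1 k)
    · have := hC (Finset.mem_coe.mpr (Finset.mem_image_of_mem _ hν))
      linarith
    · rw [← hfm]
      exact Submodule.sum_mem _ fun ν hν =>
        Submodule.mem_iSup_of_mem ν (Submodule.mem_iSup_of_mem hν (hf ν))
  apply (verma_bijective b (0 : Dual ℂ H)).injective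
  change _ = uact (nNeg b) _ 0 _
  rw [map_zero]
  exact h2

/-- A basis over `U(𝔫₋)` adapted to weights and generalized eigenspaces of the Casimir
operator. -/
structure IsGoodBasis (b : (rootSystem H).Base) {I : Type*} (v : I → D) (lam : I → Dual ℂ H)
    (cas : I → ℂ) : Prop where
  mem_wt : ∀ i, v i ∈ wt D (lam i)
  mem_cas : ∀ i, v i ∈ End.maxGenEigenspace (casimir H D) (cas i)
  bijective : Function.Bijective (ucomb (L := nNeg b) v)
  genWt_le : ∀ μ c, genWt D (μ, c) ≤
    uspan (nNeg b) v {j | cas j = c ∧ μ - lam j ∈ negCone b}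

/-- In each `genWt D p`, let `Q p` be the part reached by `𝔫₋` and `W p` a complement. Bases of the
`W p` generate `D` by descending induction on the height, and the same induction locates the labels
needed for a given weight and eigenvalue. They are independent modulo `𝔫₋ D`, and
`ucomb_injective_of_filtration`, with the filtration `lowering`, promotes this to independence over
`U(𝔫₋)`. -/
theorem exists_goodBasis (hD : IsOTilde b D) (hfree : LieFree (nNeg b) D) :
    ∃ (n : Dual ℂ H × ℂ → ℕ) (v : (Σ p, Fin (n p)) → D),
      IsGoodBasis b v (fun j => j.1.1) (fun j => j.1.2) := by
  classical
  let Q : Dual ℂ H × ℂ → Submodule ℂ D := fun p => low b (fun ν => genWt D (ν, p.2)) p.1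
  have hQ : ∀ p, Q p ≤ genWt D p := low_genWt_le
  have hW : ∀ p, ∃ W, Disjoint (Q p) W ∧ Q p ⊔ W = genWt D p := by
    intro p
    obtain ⟨C, hC⟩ := Submodule.exists_isCompl (Q p)
    refine ⟨C ⊓ genWt D p, hC.disjoint.mono_right inf_le_left, ?_⟩
    rw [← sup_inf_assoc_of_le C (hQ p), hC.sup_eq_top, top_inf_eq]
  choose W hdisj hsup using hW
  have hWle : ∀ p, W p ≤ genWt D p := fun p => hsup p ▸ le_sup_right
  have hfin : ∀ p, FiniteDimensional ℂ (W p) := fun p => by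
    have : FiniteDimensional ℂ (wt D p.1) := hD.finiteDimensional p.1
    exact Submodule.finiteDimensional_of_le ((hWle p).trans inf_le_left)
  let B : ∀ p, Basis (Fin (finrank ℂ (W p))) ℂ (W p) := fun p => finBasis ℂ (W p)
  let v : (Σ p, Fin (finrank ℂ (W p))) → D := fun j => (B j.1 j.2 : D)
  have hv : ∀ j, v j ∈ genWt D j.1 := fun j => hWle _ (B j.1 j.2).2
  have hspan : ∀ μ c, genWt D (μ, c) ≤
      uspan (nNeg b) v {j | j.1.2 = c ∧ μ - j.1.1 ∈ negCone b} := by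
    intro μ c
    refine hD.ht_induction (b := b) (Q := fun μ => genWt D (μ, c) ≤
      uspan (nNeg b) v {j | j.1.2 = c ∧ μ - j.1.1 ∈ negCone b}) (fun μ hμ => ?_) (fun μ ih => ?_) μ
    · exact (inf_le_left.trans (wt_eq_bot hμ).le).trans bot_le
    · rw [← hsup (μ, c)]
      refine sup_le (low_le fun i hi x hx m hm => ?_) ?_
      · have h1 := ih (μ - (rootSystem H).root i)
          (by rw [map_sub]; linarith [ht_root_neg b hi]) hm
        have h2 := lie_mem_uspan v (⟨x, mem_nNeg hi hx⟩ : nNeg b) h1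
        refine uspan_mono v ?_ h2
        rintro j ⟨hj1, hj2⟩
        refine ⟨hj1, ?_⟩
        have := add_mem hj2 (root_mem_negCone hi)
        convert this using 1; abel
      · intro w hw
        have h1 : (⟨w, hw⟩ : W (μ, c)) ∈ Submodule.span ℂ (Set.range (B (μ, c))) := by
          rw [(B (μ, c)).span_eq]; trivial
        have h2 : Submodule.span ℂ (Set.range (B (μ, c))) ≤ (uspan (nNeg b) v
            {j | j.1.2 = c ∧ μ - j.1.1 ∈ negCone b}).comap (W (μ, c)).subtype := by
          rw [Submodule.span_le]
          rintro _ ⟨k, rfl⟩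
          refine mem_uspan (L := nNeg b) v (i := ⟨(μ, c), k⟩) ⟨rfl, ?_⟩
          simp
        exact h2 h1
  have hsurj : Function.Surjective (ucomb (L := nNeg b) v) := by
    rw [← LinearMap.range_eq_top, eq_top_iff, ← iSup_genWt hD, ← uspan_univ]
    exact iSup_le fun p => (hspan p.1 p.2).trans (uspan_mono v (Set.subset_univ _))
  refine ⟨fun p => finrank ℂ (W p), v, fun j => (hv j).1, fun j => (hv j).2, ⟨?_, hsurj⟩, hspan⟩
  refine ucomb_injective_of_filtration hfree v hsurj
    (fun k => (lowering b k).toAddSubgroup) ?_ ?_ (fun a ha => eq_zero_of_mem_lowering ha) ?_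
  · rw [eq_top_iff]
    intro u _
    refine mem_lowering.mpr fun c m hm => ?_
    simpa using uact_mem_htLe u hm
  · intro k a ha e he
    refine mem_lowering.mpr fun c m hm => ?_
    have h1 := mem_lowering.mp ha _ _ (mem_lowering.mp he c m hm)
    rw [map_mul, Module.End.mul_apply]
    convert h1 using 2
    push_cast; ring
  · intro r hr
    -- The constant terms of the coefficients of a relation. The remainders lie in `𝔫₋ U(𝔫₋)`, so
    -- they lower heights by at least `1`, and it remains to see that the constant terms vanish.
    choose ε hε using fun i => env_eq_algebraMap_add (r i)
    have hε' : ∀ i, r i - algebraMap ℂ _ (ε i) ∈ lowering b 1 := by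
      intro i
      refine (Submodule.span_le (p := lowering b 1)).mpr ?_ (hε i)
      rintro _ ⟨x, u, rfl⟩
      refine mem_lowering.mpr fun c m hm => ?_
      rw [uact_env_mul, Nat.cast_one]
      exact lie_mem_htLe x.2 (uact_mem_htLe u hm)
    suffices h0 : ∀ i ∈ r.support, ε i = 0 by
      intro i
      by_cases hi : i ∈ r.support
      · have := hε' i
        rwa [h0 i hi, map_zero, sub_zero] at this
      · rw [Finsupp.notMem_support_iff.mp hi]
        exact (lowering b 1).zero_mem
    let ε' : (Σ p, Fin (finrank ℂ (W p))) →₀ ℂ := Finsupp.onFinset r.support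
      (fun i => if i ∈ r.support then ε i else 0) (fun i hi => by
        by_contra hc
        exact hi (if_neg hc))
    have h1 : ε'.sum (fun j a => a • (B j.1 j.2 : D)) ∈ ⨆ p, Q p := by
      have h2 : ε'.sum (fun j a => a • (B j.1 j.2 : D)) = ∑ i ∈ r.support, ε i • v i := by
        rw [Finsupp.sum_of_support_subset ε' Finsupp.support_onFinset_subset _ (by simp)]
        refine Finset.sum_congr rfl fun i hi => ?_
        rw [Finsupp.onFinset_apply, if_pos hi]
      have h3 : ∑ i ∈ r.support, uact (nNeg b) D (r i - algebraMap ℂ _ (ε i)) (v i) =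
          - ∑ i ∈ r.support, ε i • v i := by
        have h4 : ∑ i ∈ r.support, uact (nNeg b) D (r i) (v i) = 0 := hr
        rw [eq_neg_iff_add_eq_zero, ← Finset.sum_add_distrib, ← h4]
        refine Finset.sum_congr rfl fun i _ => ?_
        rw [map_sub, LinearMap.sub_apply, AlgHom.commutes]
        exact sub_add_cancel _ _
      rw [h2, ← Submodule.neg_mem_iff, ← h3]
      refine Submodule.sum_mem _ fun i _ => ?_
      have h5 : Submodule.span ℂ {w | ∃ (x : nNeg b) (v : Env (nNeg b)), w = env x * v} ≤
          (⨆ p, Q p).comap ((uact (nNeg b) D).toLinearMap.flip (v i)) := by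
        rw [Submodule.span_le]
        rintro _ ⟨x, u, rfl⟩
        change uact (nNeg b) D (env x * u) (v i) ∈ ⨆ p, Q p
        rw [uact_env_mul]
        exact lie_mem_iSup_low_genWt hD x.2 _
      exact h5 (hε i)
    have h2 := eq_zero_of_sum_mem_iSup iSupIndep_genWt hQ hWle hdisj B ε' h1
    intro i hi
    have h3 := DFunLike.congr_fun h2 i
    rwa [Finsupp.onFinset_apply, if_pos hi] at h3

end Blocks

/-! ### Quotients of Lie modules -/

section Quotients

variable {L : Type*} [LieRing L] [LieAlgebra ℂ L]
  {M : Type*} [AddCommGroup M] [Module ℂ M] [LieRingModule L M] [LieModule ℂ L M]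
  {N : Type*} [AddCommGroup N] [Module ℂ N] [LieRingModule L N] [LieModule ℂ L N]
  {X : Type*} [AddCommGroup X] [Module ℂ X] [LieRingModule L X] [LieModule ℂ L X]

/-- A bijective morphism of Lie modules is an isomorphism. -/
def lieEquivOfBijective (f : M →ₗ⁅ℂ,L⁆ N) (hf : Function.Bijective f) : M ≃ₗ⁅ℂ,L⁆ N :=
  { f, LinearEquiv.ofBijective (f : M →ₗ[ℂ] N) hf with
    toFun := f }

omit [LieAlgebra ℂ L] [LieModule ℂ L M] [LieModule ℂ L N] [LieModule ℂ L X] in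
lemma exists_factor_of_injective (f : X →ₗ⁅ℂ,L⁆ N) (hf : Function.Injective f)
    (h : M →ₗ⁅ℂ,L⁆ N) (hr : ∀ m, ∃ x, f x = h m) : ∃ g : M →ₗ⁅ℂ,L⁆ X, ∀ m, f (g m) = h m := by
  choose g hg using hr
  refine ⟨{ toFun := g
            map_add' := fun x y => hf ?_
            map_smul' := fun c x => hf ?_
            map_lie' := fun {x m} => hf ?_ }, hg⟩
  · rw [map_add, hg, hg, hg, map_add]
  · rw [map_smul, hg, hg, map_smul, RingHom.id_apply]
  · rw [LieModuleHom.map_lie, hg, hg, LieModuleHom.map_lie]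

omit [LieAlgebra ℂ L] [LieModule ℂ L M] [LieModule ℂ L N] [LieModule ℂ L X] in
lemma exists_factor_of_surjective (p : M →ₗ⁅ℂ,L⁆ N) (hp : Function.Surjective p)
    (h : M →ₗ⁅ℂ,L⁆ X) (hk : ∀ m, p m = 0 → h m = 0) :
    ∃ g : N →ₗ⁅ℂ,L⁆ X, ∀ m, g (p m) = h m := by
  have key : ∀ m m', p m = p m' → h m = h m' := by
    intro m m' hm
    rw [← sub_eq_zero, ← map_sub] at hm ⊢
    exact hk _ hm
  choose s hs using hp
  refine ⟨{ toFun := fun n => h (s n)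
            map_add' := fun x y => ?_
            map_smul' := fun c x => ?_
            map_lie' := fun {x m} => ?_ }, fun m => key _ _ (hs _)⟩
  · rw [← map_add]; apply key; rw [map_add, hs, hs, hs]
  · rw [← map_smul]; apply key; rw [map_smul, hs, hs]; rfl
  · rw [← LieModuleHom.map_lie]; apply key; rw [LieModuleHom.map_lie, hs, hs]

omit [LieModule ℂ L X] in
lemma subquotient_iff {A B : LieSubmodule ℂ L M} :
    Nonempty ((B ⧸ A.comap B.incl) ≃ₗ⁅ℂ,L⁆ X) ↔
    ∃ g : B →ₗ⁅ℂ,L⁆ X, Function.Surjective g ∧ ∀ m : B, g m = 0 ↔ (m : M) ∈ A := by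
  have hmk : ∀ m : B, LieSubmodule.Quotient.mk' (A.comap B.incl) m = 0 ↔ (m : M) ∈ A := fun m => by
    rw [LieSubmodule.Quotient.mk_eq_zero, LieSubmodule.mem_comap]; rfl
  have hsurj := LieSubmodule.Quotient.surjective_mk' (A.comap B.incl)
  constructor
  · rintro ⟨e⟩
    refine ⟨e.toLieModuleHom.comp (LieSubmodule.Quotient.mk' _), e.surjective.comp hsurj,
      fun m => ?_⟩
    rw [← hmk]
    constructor
    · intro h
      apply e.injective
      exact h.trans (map_zero e.toLieModuleHom).symm
    · intro h
      exact (congrArg e h).trans (map_zero e.toLieModuleHom)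
  · rintro ⟨g, hg, hk⟩
    obtain ⟨f, hf⟩ := exists_factor_of_surjective (LieSubmodule.Quotient.mk' (A.comap B.incl))
      hsurj g (fun m hm => (hk m).mpr ((hmk m).mp hm))
    refine ⟨lieEquivOfBijective f ⟨?_, fun x => ?_⟩⟩
    · rw [injective_iff_map_eq_zero]
      intro q hq
      obtain ⟨m, rfl⟩ := hsurj q
      rw [hf, hk] at hq
      exact (hmk m).mpr hq
    · obtain ⟨m, rfl⟩ := hg x
      exact ⟨_, hf m⟩

end Quotients

lemma env_one_ne_zero {L : Type*} [LieRing L] [LieAlgebra ℂ L] : (1 : Env L) ≠ 0 := by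
  let := LieRing.ofAssociativeRing (A := ℂ)
  intro h
  have := congrArg (UniversalEnvelopingAlgebra.lift ℂ (0 : L →ₗ⁅ℂ⁆ ℂ)) h
  rw [map_one, map_zero] at this
  exact one_ne_zero this

/-- Encode `i` by the finite set `S i` of itself and its predecessors, read as a binary number
through an injection of `I` into `ℕ`. The number determines `S i`, which determines `i`, and smaller
labels have strictly smaller sets. -/
lemma exists_rank {I : Type*} [Countable I] (r : I → I → Prop) (hirr : ∀ i, ¬ r i i)
    (htrans : ∀ i j k, r i j → r j k → r i k) (hfin : ∀ i, {j | r j i}.Finite) :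
    ∃ ρ : I → ℕ, Function.Injective ρ ∧ ∀ j i, r j i → ρ j < ρ i := by
  classical
  obtain ⟨e, he⟩ := exists_injective_nat I
  let S : I → Finset I := fun i => insert i (hfin i).toFinset
  have hS : ∀ i j, j ∈ S i ↔ j = i ∨ r j i := by simp [S]
  let ρ : I → ℕ := fun i => ∑ n ∈ (S i).map ⟨e, he⟩, 2 ^ n
  have hsub : ∀ j i, r j i → S j ⊆ S i := by
    intro j i hji k hk
    rw [hS] at hk ⊢
    rcases hk with rfl | hk
    · exact .inr hji
    · exact .inr (htrans _ _ _ hk hji)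
  refine ⟨ρ, fun i j hij => ?_, fun j i hji => ?_⟩
  · have h1 := Finset.map_injective _ (Finset.geomSum_injective le_rfl hij)
    have h2 : i ∈ S j := h1 ▸ (hS i i).mpr (.inl rfl)
    have h3 : j ∈ S i := h1 ▸ (hS j j).mpr (.inl rfl)
    rw [hS] at h2 h3
    rcases h2 with h2 | h2
    · exact h2
    · rcases h3 with h3 | h3
      · exact h3.symm
      · exact absurd (htrans _ _ _ h2 h3) (hirr i)
  · refine Finset.sum_lt_sum_of_subset (i := e i) (Finset.map_subset_map.mpr (hsub j i hji)) ?_ ?_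
      (by positivity) (fun _ _ _ => Nat.zero_le _)
    · exact Finset.mem_map_of_mem ⟨e, he⟩ ((hS i i).mpr (.inl rfl))
    · intro h
      obtain ⟨k, hk, hke⟩ := Finset.mem_map.mp h
      have hki : k = i := he hke
      rw [hki, hS] at hk
      rcases hk with rfl | hk
      · exact hirr _ hji
      · exact hirr _ (htrans _ _ _ hk hji)

/-! ### Filtrations obtained from adapted bases -/

section GoodBases

variable {𝔤 : Type*} [LieRing 𝔤] [LieAlgebra ℂ 𝔤] [FiniteDimensional ℂ 𝔤] [IsSemisimple ℂ 𝔤]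
  {H : LieSubalgebra ℂ 𝔤} [H.IsCartanSubalgebra] {b : (rootSystem H).Base}
  {D : Type*} [AddCommGroup D] [Module ℂ D] [LieRingModule 𝔤 D] [LieModule ℂ 𝔤 D]
  {I : Type*} {v : I → D} {lam : I → Dual ℂ H} {cas : I → ℂ}

/-- The order on the labels of a basis adapted to the Casimir operator. -/
def prec (b : (rootSystem H).Base) (lam : I → Dual ℂ H) (cas : I → ℂ) (j i : I) : Prop :=
  cas j = cas i ∧ ht b (lam i) < ht b (lam j)

/-- Sets of labels closed under passing to predecessors. -/
def IsLower (b : (rootSystem H).Base) (lam : I → Dual ℂ H) (cas : I → ℂ) (S : Set I) : Prop :=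
  ∀ i ∈ S, ∀ j, prec b lam cas j i → j ∈ S

lemma prec_trans {i j k : I} (hij : prec b lam cas i j) (hjk : prec b lam cas j k) :
    prec b lam cas i k := ⟨hij.1.trans hjk.1, hjk.2.trans hij.2⟩

lemma prec_irrefl (i : I) : ¬ prec b lam cas i i := fun h => lt_irrefl _ h.2

lemma isLower_prec (i : I) : IsLower b lam cas {j | prec b lam cas j i} :=
  fun _ hj _ hk => prec_trans hk hj

namespace IsGoodBasis

variable (hg : IsGoodBasis b v lam cas)
include hg

/-- A positive root vector preserves the generalized Casimir eigenspace and raises the weight, and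
`genWt_le` expresses the result through labels of at least the new height. This triangularity makes
spans of lower sets stable under `𝔤`. -/
lemma lie_nPos_mem {i : I} {x : 𝔤} (hx : x ∈ nPos b) :
    ⁅x, v i⁆ ∈ uspan (nNeg b) v {j | prec b lam cas j i} := by
  refine nPos_le (P := (uspan (nNeg b) v {j | prec b lam cas j i}).comap
    ((toEnd ℂ 𝔤 D : 𝔤 →ₗ[ℂ] End ℂ D).flip (v i))) ?_ x hx
  intro k hk x hx
  refine uspan_mono v ?_ (hg.genWt_le _ _ (lie_mem_genWt hx ⟨hg.mem_wt i, hg.mem_cas i⟩))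
  rintro j ⟨hj1, hj2⟩
  refine ⟨hj1, ?_⟩
  have h1 := ht_nonpos_of_mem_negCone hj2
  have h2 := ht_root_pos b hk
  rw [map_sub, map_add] at h1
  linarith

lemma lie_mem {S : Set I} (hS : IsLower b lam cas S) (x : 𝔤) {m : D}
    (hm : m ∈ uspan (nNeg b) v S) : ⁅x, m⁆ ∈ uspan (nNeg b) v S := by
  have hneg : ∀ x ∈ nNeg b, ∀ m ∈ uspan (nNeg b) v S, ⁅x, m⁆ ∈ uspan (nNeg b) v S :=
    fun x hx m hm => lie_mem_uspan v (⟨x, hx⟩ : nNeg b) hm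
  have h1 : ∀ i ∈ S, ∀ x : 𝔤, ⁅x, v i⁆ ∈ uspan (nNeg b) v S := by
    intro i hi x
    refine eq_top_of_triangular (H := H) (P := (uspan (nNeg b) v S).comap
      ((toEnd ℂ 𝔤 D : 𝔤 →ₗ[ℂ] End ℂ D).flip (v i))) (fun t ht => ?_) (fun k x hx => ?_) x
    · change ⁅t, v i⁆ ∈ uspan (nNeg b) v S
      rw [CatO.mem_wt.mp (hg.mem_wt i) ⟨t, ht⟩]
      exact Submodule.smul_mem _ _ (mem_uspan (L := nNeg b) v hi)
    · by_cases hk : b.IsPos k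
      · exact uspan_mono v (hS i hi) (hg.lie_nPos_mem (mem_nPos hk hx))
      · exact hneg x (mem_nNeg hk hx) _ (mem_uspan (L := nNeg b) v hi)
  have h2 : ∀ i ∈ S, ∀ u, ∀ x : 𝔤, ⁅x, uact (nNeg b) D u (v i)⁆ ∈ uspan (nNeg b) v S := by
    intro i hi u
    let P : Submodule ℂ (Env (nNeg b)) := ⨅ x : 𝔤, (uspan (nNeg b) v S).comap
      ((toEnd ℂ 𝔤 D x) ∘ₗ (uact (nNeg b) D).toLinearMap.flip (v i))
    have hP : ∀ u, u ∈ P ↔ ∀ x : 𝔤, ⁅x, uact (nNeg b) D u (v i)⁆ ∈ uspan (nNeg b) v S :=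
      fun u => by rw [Submodule.mem_iInf]; rfl
    rw [← hP]
    refine env_eq_top P ?_ ?_ u
    · rw [hP]
      intro x
      rw [map_one]
      exact h1 i hi x
    · intro y u hu
      rw [hP] at hu ⊢
      intro x
      have h3 : uact (nNeg b) D (env y * u) (v i) = ⁅(y : 𝔤), uact (nNeg b) D u (v i)⁆ := by
        rw [uact_env_mul]; rfl
      rw [h3, leibniz_lie]
      exact Submodule.add_mem _ (hu _) (hneg y y.2 _ (hu x))
  have h3 : uspan (nNeg b) v S ≤ (uspan (nNeg b) v S).comap (toEnd ℂ 𝔤 D x) :=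
    uspan_le fun i hi u => h2 i hi u x
  exact h3 hm

/-- The submodule spanned by a lower set of basis elements. -/
def sub {S : Set I} (hS : IsLower b lam cas S) : LieSubmodule ℂ 𝔤 D :=
  { uspan (nNeg b) v S with lie_mem := fun {x _} hm => hg.lie_mem hS x hm }

lemma mem_sub {S : Set I} (hS : IsLower b lam cas S) {m : D} :
    m ∈ hg.sub hS ↔ m ∈ uspan (nNeg b) v S := Iff.rfl

lemma isHighest_mk {S : Set I} (hS : IsLower b lam cas S) {i : I}
    (hi : ∀ j, prec b lam cas j i → j ∈ S) :
    IsHighest b (lam i) (LieSubmodule.Quotient.mk' (hg.sub hS) (v i)) where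
  cartan t := by rw [← LieModuleHom.map_lie, CatO.mem_wt.mp (hg.mem_wt i), map_smul]
  nPos x hx := by
    rw [← LieModuleHom.map_lie, LieSubmodule.Quotient.mk_eq_zero, mem_sub]
    exact uspan_mono v hi (hg.lie_nPos_mem hx)

/-- Modulo the submodule of `S`, the vector `v i` is a highest weight vector and receives a morphism
from `Δ(lam i)`. Independence of the basis over `U(𝔫₋)` makes it injective, and its image is the
submodule of `insert i S` modulo that of `S`; `g` is obtained by inverting it. -/
lemma exists_verma_proj {S : Set I} (hS : IsLower b lam cas S) {i : I} (hi : i ∉ S)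
    (hS' : IsLower b lam cas (insert i S)) :
    ∃ g : hg.sub hS' →ₗ⁅ℂ,𝔤⁆ Verma b (lam i), Function.Surjective g ∧
      ∀ m : hg.sub hS', g m = 0 ↔ (m : D) ∈ hg.sub hS := by
  have hpred : ∀ j, prec b lam cas j i → j ∈ S := fun j hj =>
    (hS' i (Set.mem_insert _ _) j hj).resolve_left fun h => prec_irrefl i (h ▸ hj)
  obtain ⟨f, hf⟩ := exists_verma_hom (hg.isHighest_mk hS hpred)
  set p := LieSubmodule.Quotient.mk' (hg.sub hS) with hp
  have hfu : ∀ u, f (uact (nNeg b) (Verma b (lam i)) u (vermaGen b (lam i))) =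
      p (uact (nNeg b) D u (v i)) := by
    intro u
    have h1 := map_uact (L := nNeg b) (f : Verma b (lam i) →ₗ[ℂ] D ⧸ hg.sub hS)
      (fun x m => f.map_lie (x : 𝔤) m) u (vermaGen b (lam i))
    have h2 := map_uact (L := nNeg b) (p : D →ₗ[ℂ] D ⧸ hg.sub hS)
      (fun x m => p.map_lie (x : 𝔤) m) u (v i)
    exact h1.trans ((congrArg _ hf).trans h2.symm)
  have hinj : Function.Injective f := by
    rw [injective_iff_map_eq_zero]
    intro w hw
    obtain ⟨u, rfl⟩ := verma_surjective b (lam i) w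
    change f (uact (nNeg b) (Verma b (lam i)) u (vermaGen b (lam i))) = 0 at hw
    rw [hfu, hp, LieSubmodule.Quotient.mk_eq_zero, mem_sub] at hw
    have := eq_zero_of_uact_mem_uspan hg.bijective.injective hi hw
    simp [this]
  obtain ⟨g, hgf⟩ := exists_factor_of_injective f hinj (p.comp (hg.sub hS').incl) (by
    rintro ⟨m, hm⟩
    obtain ⟨u, hu⟩ := exists_of_mem_uspan_insert hm
    refine ⟨_, (hfu u).trans ?_⟩
    change p _ = p m
    rw [eq_comm, ← sub_eq_zero, ← map_sub, hp, LieSubmodule.Quotient.mk_eq_zero]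
    exact hu)
  refine ⟨g, fun w => ?_, fun m => ?_⟩
  · obtain ⟨u, rfl⟩ := verma_surjective b (lam i) w
    refine ⟨⟨uact (nNeg b) D u (v i), uact_mem_uspan v (Set.mem_insert _ _) u⟩, hinj ?_⟩
    rw [hgf]
    exact (hfu u).symm
  · rw [← LieSubmodule.Quotient.mk_eq_zero (N := hg.sub hS)]
    constructor
    · intro h
      have := hgf m
      rw [h, map_zero] at this
      exact this.symm
    · intro h
      exact hinj ((hgf m).trans (h.trans (map_zero f).symm))

/-- Modulo its predecessors `v i` is a nonzero highest weight vector, so the Casimir operator acts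
on it by `casScalar b (lam i)`; a power of its difference with `cas i` kills the vector. -/
lemma cas_eq (i : I) : cas i = casScalar b (lam i) := by
  let S : Set I := {j | prec b lam cas j i}
  have hS : IsLower b lam cas S := isLower_prec i
  set p := LieSubmodule.Quotient.mk' (hg.sub hS) with hp
  have hz := casimir_apply_highest b (hg.isHighest_mk hS (i := i) fun j hj => hj)
  rw [← hp] at hz
  have hz0 : p (v i) ≠ 0 := by
    intro h
    rw [hp, LieSubmodule.Quotient.mk_eq_zero, mem_sub] at h
    have h1 := eq_zero_of_uact_mem_uspan (u := 1) hg.bijective.injective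
      (S := S) (i := i) (prec_irrefl i) (by rwa [map_one])
    exact env_one_ne_zero h1
  obtain ⟨k, hk⟩ := (Module.End.mem_maxGenEigenspace _ _ _).mp (hg.mem_cas i)
  have key : ∀ k : ℕ, p (((casimir H D - cas i • 1 : End ℂ D) ^ k) (v i)) =
      (casScalar b (lam i) - cas i) ^ k • p (v i) := by
    intro k
    induction k with
    | zero => simp
    | succ k ih =>
      rw [pow_succ', Module.End.mul_apply, LinearMap.sub_apply, map_sub, casimir_map, ih,
        LinearMap.smul_apply, Module.End.one_apply, map_smul, map_smul, ih, hz, smul_smul,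
        smul_smul, ← sub_smul]
      congr 1; ring
  have h1 := key k
  rw [hk, map_zero] at h1
  have h2 := (smul_eq_zero.mp h1.symm).resolve_right hz0
  exact (sub_eq_zero.mp (eq_zero_of_pow_eq_zero h2)).symm

lemma linearIndependent : LinearIndependent ℂ v := by
  rw [linearIndependent_iff]
  intro l hl
  have h1 : ucomb (L := nNeg b) v (l.mapRange (algebraMap ℂ _) (map_zero _)) = 0 := by
    rw [ucomb_apply, Finsupp.sum_mapRange_index (by simp), ← hl, Finsupp.linearCombination_apply]
    refine Finsupp.sum_congr fun i _ => ?_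
    rw [AlgHom.commutes]; rfl
  have h2 := hg.bijective.injective (h1.trans (map_zero _).symm)
  ext i
  have h3 := DFunLike.congr_fun h2 i
  rw [Finsupp.mapRange_apply, Finsupp.zero_apply] at h3
  rw [Finsupp.zero_apply]
  by_contra h0
  apply env_one_ne_zero (L := nNeg b)
  rw [← one_smul ℂ (1 : Env (nNeg b)), ← inv_mul_cancel₀ h0, mul_smul,
    ← Algebra.algebraMap_eq_smul_one, h3, smul_zero]

lemma lam_mem_supp (i : I) : lam i ∈ supp H D :=
  mem_supp_of_mem (hg.mem_wt i) (hg.linearIndependent.ne_zero i)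

lemma finite_lam_eq (hD : IsOTilde b D) (μ : Dual ℂ H) : {i | lam i = μ}.Finite := by
  have := hD.finiteDimensional μ
  let w : {i | lam i = μ} → wt D μ := fun i => ⟨v i, by have := hg.mem_wt i; rwa [i.2] at this⟩
  have hw : LinearIndependent ℂ w :=
    LinearIndependent.of_comp (wt D μ).subtype
      (hg.linearIndependent.comp Subtype.val Subtype.val_injective)
  have := hw.finite_of_isNoetherian
  exact Set.toFinite _

lemma finite_of_image (hD : IsOTilde b D) {s : Set (Dual ℂ H)} (hs : s.Finite) :
    {i | lam i ∈ s}.Finite := by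
  have : {i | lam i ∈ s} = ⋃ μ ∈ s, {i | lam i = μ} := by ext; simp
  rw [this]
  exact hs.biUnion fun μ _ => hg.finite_lam_eq hD μ

lemma finite_ht_ge (hD : IsOTilde b D) (c : ℝ) : {i | c ≤ ht b (lam i)}.Finite :=
  (hg.finite_of_image hD (hD.finite_ht_ge c)).subset fun i hi => ⟨hg.lam_mem_supp i, hi⟩

/-- A block has finitely many labels, even though the weights of `D` may extend infinitely far down.
This permits enumerations of the labels in both directions of the order. -/
lemma finite_cas_eq (hD : IsOTilde b D) (c : ℂ) : {i | cas i = c}.Finite :=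
  (hg.finite_of_image hD (hD.finite_casScalar c)).subset fun i hi =>
    ⟨hg.lam_mem_supp i, (hg.cas_eq i).symm.trans hi⟩

lemma countable (hD : IsOTilde b D) : Countable I := by
  rw [← Set.countable_univ_iff]
  have : (Set.univ : Set I) = ⋃ n : ℕ, {i | -(n : ℝ) ≤ ht b (lam i)} := by
    ext i
    obtain ⟨n, hn⟩ := exists_nat_ge (-ht b (lam i))
    simp only [Set.mem_univ, Set.mem_iUnion, Set.mem_ofPred_eq, true_iff]
    exact ⟨n, by linarith⟩
  rw [this]
  exact Set.countable_iUnion fun n => (hg.finite_ht_ge hD _).countable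

end IsGoodBasis

/-- A module of `Õ` that is free over `U(𝔫₋)` has a Verma filtration. -/
theorem isVermaFiltered_of_lieFree (hD : IsOTilde b D) (hfree : LieFree (nNeg b) D) :
    IsVermaFiltered b D := by
  obtain ⟨n, v, hg⟩ := exists_goodBasis hD hfree
  set lam : (Σ p, Fin (n p)) → Dual ℂ H := fun j => j.1.1
  set cas : (Σ p, Fin (n p)) → ℂ := fun j => j.1.2
  have := hg.countable hD
  -- Predecessors, which have greater height, come first; the labels numbered below `k` then form a
  -- lower set, and each value of `ρ` adds a single label.
  obtain ⟨ρ, hinj, hmono⟩ := exists_rank (prec b lam cas) prec_irrefl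
    (fun _ _ _ => prec_trans) (fun i => (hg.finite_cas_eq hD (cas i)).subset fun j hj => hj.1)
  have hlow : ∀ k, IsLower b lam cas {i | ρ i < k} := fun k i hi j hj => (hmono j i hj).trans hi
  have hstep : ∀ i, {j | ρ j < ρ i + 1} = insert i {j | ρ j < ρ i} := by
    intro i
    ext j
    simp only [Set.mem_insert_iff, Set.mem_ofPred_eq, Nat.lt_succ_iff_lt_or_eq]
    rw [or_comm, hinj.eq_iff]
  refine ⟨hD, ⟨{ step := fun k => hg.sub (hlow k)
                 step_zero := ?_
                 monotone := fun k l hkl => uspan_mono v fun i hi => lt_of_lt_of_le hi hkl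
                 exhaustive := fun m => ?_
                 proper := Set.range ρ
                 label := fun k => lam k.2.choose
                 step_eq := fun k hk => ?_
                 subquotient := ?_ }⟩⟩
  · rw [LieSubmodule.eq_bot_iff]
    intro m hm
    rw [hg.mem_sub] at hm
    have : uspan (nNeg b) v {i | ρ i < 0} ≤ ⊥ := uspan_le fun i hi => absurd hi (Nat.not_lt_zero _)
    simpa using this hm
  · obtain ⟨r, rfl⟩ := hg.bijective.surjective m
    refine ⟨r.support.sup ρ + 1, ?_⟩
    rw [hg.mem_sub]
    refine ⟨r, fun i hi => ?_, rfl⟩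
    exact Nat.lt_succ_of_le (Finset.le_sup (f := ρ) hi)
  · have hset : {i | ρ i < k + 1} = {i | ρ i < k} := by
      ext i
      simp only [Set.mem_ofPred_eq, Nat.lt_succ_iff_lt_or_eq, or_iff_left_iff_imp]
      exact fun h => absurd ⟨i, h⟩ hk
    apply LieSubmodule.ext
    intro m
    rw [hg.mem_sub, hg.mem_sub, hset]
  · rintro ⟨k, hk⟩
    dsimp only
    -- Naming the chosen preimage of `k` allows `k` to be replaced by `ρ i`.
    obtain ⟨i, hi⟩ : ∃ i, hk.choose = i := ⟨_, rfl⟩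
    have hk' := hk.choose_spec
    rw [hi] at hk' ⊢
    subst hk'
    rw [subquotient_iff]
    have hl := hlow (ρ i + 1)
    obtain ⟨g, hg1, hg2⟩ := hg.exists_verma_proj (hlow (ρ i)) (i := i) (lt_irrefl (ρ i))
      ((hstep i) ▸ hl)
    have e : hg.sub (hlow (ρ i + 1)) = hg.sub ((hstep i) ▸ hl) := by
      apply LieSubmodule.ext
      intro m
      rw [hg.mem_sub, hg.mem_sub, hstep i]
    rw [e]
    exact ⟨g, hg1, hg2⟩

end GoodBases

/-! ### Modules with a Verma filtration are free -/

section Exhaustive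

variable {V : Type*} [AddCommGroup V] [Module ℂ V] {A : ℕ → Submodule ℂ V}
  {P : Set ℕ} {E : P → Type*} [∀ k, AddCommGroup (E k)] [∀ k, Module ℂ (E k)]
  {t : ∀ k, E k →ₗ[ℂ] V}

/-- Leading terms: in a vanishing sum the term of largest index `a` lies in `A a`, because all
others do, so it is zero. -/
lemma independent_of_exhaustive (hmono : Monotone A) (ht : ∀ (k : P) e, t k e ∈ A (k + 1))
    (hinj : ∀ (k : P) e, t k e ∈ A k → e = 0) (s : Finset P) (e : ∀ k, E k)
    (hs : ∑ k ∈ s, t k (e k) = 0) : ∀ k ∈ s, e k = 0 := by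
  induction s using Finset.induction_on_max with
  | empty => simp
  | insert a s hlt ih =>
    have ha : a ∉ s := fun h => lt_irrefl _ (hlt a h)
    rw [Finset.sum_insert ha] at hs
    have h1 : ∑ k ∈ s, t k (e k) ∈ A a :=
      Submodule.sum_mem _ fun k hk => hmono (Nat.succ_le_of_lt (hlt k hk)) (ht k (e k))
    have h2 : e a = 0 := by
      refine hinj a (e a) ?_
      rw [eq_neg_of_add_eq_zero_left hs]
      exact (A a).neg_mem h1
    intro k hk
    rcases Finset.mem_insert.mp hk with rfl | hk
    · exact h2
    · exact ih (by rwa [h2, map_zero, zero_add] at hs) k hk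

/-- An element of `A (k + 1)` is corrected by a value of `t k` to lie in `A k`; this ends at `A 0 =
⊥`. -/
lemma iSup_range_of_exhaustive (h0 : A 0 = ⊥) (hA : ∀ a, ∃ i, a ∈ A i)
    (hsurj : ∀ k : P, ∀ a ∈ A (k + 1), ∃ e, a - t k e ∈ A k)
    (hP : ∀ k : ℕ, k ∉ P → A (k + 1) = A k) : ⨆ k, LinearMap.range (t k) = ⊤ := by
  rw [eq_top_iff]
  intro a _
  obtain ⟨i, hi⟩ := hA a
  suffices h : A i ≤ ⨆ k, LinearMap.range (t k) from h hi
  clear hi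
  induction i with
  | zero => rw [h0]; exact bot_le
  | succ i ih =>
    by_cases hi : i ∈ P
    · intro a ha
      obtain ⟨e, he⟩ := hsurj ⟨i, hi⟩ a ha
      rw [← sub_add_cancel a (t ⟨i, hi⟩ e)]
      exact Submodule.add_mem _ (ih he) (Submodule.mem_iSup_of_mem ⟨i, hi⟩ ⟨e, rfl⟩)
    · rw [hP i hi]; exact ih

end Exhaustive

lemma ucomb_bijective {L : Type*} [LieRing L] [LieAlgebra ℂ L]
    {M : Type*} [AddCommGroup M] [Module ℂ M] [LieRingModule L M] [LieModule ℂ L M]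
    {I : Type*} {v : I → M}
    (hind : ∀ (s : Finset I) (e : I → Env L), ∑ i ∈ s, uact L M (e i) (v i) = 0 →
      ∀ i ∈ s, e i = 0)
    (hspan : ⨆ i, LinearMap.range ((uact L M).toLinearMap.flip (v i)) = ⊤) :
    Function.Bijective (ucomb (L := L) v) := by
  constructor
  · rw [injective_iff_map_eq_zero]
    intro r hr
    ext i
    by_cases hi : i ∈ r.support
    · exact hind r.support r hr i hi
    · exact Finsupp.notMem_support_iff.mp hi
  · rw [← LinearMap.range_eq_top, eq_top_iff, ← hspan]
    refine iSup_le fun i => ?_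
    rintro _ ⟨u, rfl⟩
    exact ⟨Finsupp.single i u, ucomb_single v i u⟩

section FreeOfFiltration

variable {𝔤 : Type*} [LieRing 𝔤] [LieAlgebra ℂ 𝔤]

lemma exists_proj {Λ : Type*} {X : Λ → Type*}
    [∀ μ, AddCommGroup (X μ)] [∀ μ, Module ℂ (X μ)]
    [∀ μ, LieRingModule 𝔤 (X μ)] [∀ μ, LieModule ℂ 𝔤 (X μ)]
    {M : Type*} [AddCommGroup M] [Module ℂ M] [LieRingModule 𝔤 M] [LieModule ℂ 𝔤 M]
    (F : Filtration (𝔤 := 𝔤) X M) (k : F.proper) :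
    ∃ g : F.step (k + 1) →ₗ⁅ℂ,𝔤⁆ X (F.label k), Function.Surjective g ∧
      ∀ m : F.step (k + 1), g m = 0 ↔ (m : M) ∈ F.step k :=
  subquotient_iff.mp (F.subquotient k)

lemma map_uact_sub {𝔞 : LieSubalgebra ℂ 𝔤}
    {M : Type*} [AddCommGroup M] [Module ℂ M] [LieRingModule 𝔤 M] [LieModule ℂ 𝔤 M]
    {N : Type*} [AddCommGroup N] [Module ℂ N] [LieRingModule 𝔤 N] [LieModule ℂ 𝔤 N]
    (f : M →ₗ⁅ℂ,𝔤⁆ N) (u : Env 𝔞) (m : M) : f (uact 𝔞 M u m) = uact 𝔞 N u (f m) :=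
  map_uact (L := 𝔞) (f : M →ₗ[ℂ] N) (fun x m => f.map_lie (x : 𝔤) m) u m

variable [FiniteDimensional ℂ 𝔤] [IsSemisimple ℂ 𝔤]
  {H : LieSubalgebra ℂ 𝔤} [H.IsCartanSubalgebra] {b : (rootSystem H).Base}
  {M : Type*} [AddCommGroup M] [Module ℂ M] [LieRingModule 𝔤 M] [LieModule ℂ 𝔤 M]
  {N : Type*} [AddCommGroup N] [Module ℂ N] [LieRingModule 𝔤 N] [LieModule ℂ 𝔤 N]

/-- Each nonzero subquotient is free of rank one over `U(𝔫₋)`, so arbitrary lifts `w k` of the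
highest weight generators form a basis. -/
theorem Filtration.lieFree (F : Filtration (𝔤 := 𝔤) (Verma b) M) : LieFree (nNeg b) M := by
  choose g hg hk using exists_proj F
  choose w hw using fun k => hg k (vermaGen b (F.label k))
  have hcoe : ∀ (k : F.proper) (u : Env (nNeg b)),
      ((uact (nNeg b) (F.step (k + 1)) u (w k) : F.step (k + 1)) : M) =
        uact (nNeg b) M u (w k : M) :=
    fun k u => map_uact_sub (F.step (k + 1)).incl u (w k)
  have hgu : ∀ (k : F.proper) (u : Env (nNeg b)), g k (uact (nNeg b) (F.step (k + 1)) u (w k)) =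
      uact (nNeg b) (Verma b (F.label k)) u (vermaGen b (F.label k)) := fun k u => by
    rw [map_uact_sub, hw]
  let t : ∀ _ : F.proper, Env (nNeg b) →ₗ[ℂ] M :=
    fun k => (uact (nNeg b) M).toLinearMap.flip (w k : M)
  have ht : ∀ k u, t k u = uact (nNeg b) M u (w k : M) := fun k u => rfl
  refine LieFree.of_bijective (fun k => (w k : M)) (ucomb_bijective ?_ ?_)
  · refine independent_of_exhaustive (A := fun k => (F.step k).toSubmodule) (t := t)
      F.monotone ?_ ?_
    · intro k u
      rw [ht, ← hcoe]
      exact (uact (nNeg b) (F.step (k + 1)) u (w k)).2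
    · intro k u hu
      rw [ht, ← hcoe] at hu
      have h1 := (hk k _).mpr hu
      rw [hgu] at h1
      apply (verma_bijective b (F.label k)).injective
      change _ = uact (nNeg b) _ 0 _
      rw [map_zero]
      exact h1
  · refine iSup_range_of_exhaustive (A := fun k => (F.step k).toSubmodule) (t := t)
      (by rw [F.step_zero]; rfl) F.exhaustive ?_ (fun k hk => by rw [F.step_eq k hk])
    intro k a ha
    obtain ⟨u, hu⟩ := verma_surjective b (F.label k) (g k ⟨a, ha⟩)
    refine ⟨u, ?_⟩
    have h1 := (hk k (⟨a, ha⟩ - uact (nNeg b) (F.step (k + 1)) u (w k))).mp (by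
      rw [map_sub, hgu, sub_eq_zero]; exact hu.symm)
    have h2 : ((⟨a, ha⟩ - uact (nNeg b) (F.step (k + 1)) u (w k) : F.step (k + 1)) : M) =
        a - t k u := by
      rw [ht, ← hcoe]; rfl
    rw [← h2]
    exact h1

/-- The criterion that no longer mentions a filtration; the closure of Verma filtered modules under
tensor products is read off from it. -/
theorem isVermaFiltered_iff : IsVermaFiltered b M ↔ IsOTilde b M ∧ LieFree (nNeg b) M :=
  ⟨fun ⟨h, ⟨F⟩⟩ => ⟨h, F.lieFree⟩, fun h => isVermaFiltered_of_lieFree h.1 h.2⟩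

theorem IsVermaFiltered.tensor (hM : IsOTilde b M) (hN : IsVermaFiltered b N) :
    IsVermaFiltered b (M ⊗[ℂ] N) := by
  rw [isVermaFiltered_iff] at hN ⊢
  exact ⟨hM.tensor hN.1, isFreeOver_tensor _ hN.2⟩

theorem IsVermaFiltered.of_equiv (hM : IsVermaFiltered b M) (e : M ≃ₗ⁅ℂ,𝔤⁆ N) :
    IsVermaFiltered b N := by
  rw [isVermaFiltered_iff] at hM ⊢
  exact ⟨hM.1.of_equiv e, hM.2.of_equiv e.toLinearEquiv fun x m => e.map_lie (x : 𝔤) m⟩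

/-- The flip of a tensor product, as an isomorphism of Lie modules. -/
def tensorComm (𝔤 M N : Type*) [LieRing 𝔤] [LieAlgebra ℂ 𝔤]
    [AddCommGroup M] [Module ℂ M] [LieRingModule 𝔤 M] [LieModule ℂ 𝔤 M]
    [AddCommGroup N] [Module ℂ N] [LieRingModule 𝔤 N] [LieModule ℂ 𝔤 N] :
    M ⊗[ℂ] N ≃ₗ⁅ℂ,𝔤⁆ N ⊗[ℂ] M :=
  { TensorProduct.comm ℂ M N with
    map_lie' := fun {x t} => by
      change TensorProduct.comm ℂ M N ⁅x, t⁆ = ⁅x, TensorProduct.comm ℂ M N t⁆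
      induction t using TensorProduct.induction_on with
      | zero => simp
      | add a c ha hc => rw [lie_add, map_add, ha, hc, map_add, lie_add]
      | tmul m n =>
        rw [TensorProduct.LieModule.lie_tmul_right, map_add, TensorProduct.comm_tmul,
          TensorProduct.comm_tmul, TensorProduct.comm_tmul,
          TensorProduct.LieModule.lie_tmul_right, add_comm] }

end FreeOfFiltration

/-! ### The restricted duality -/

section ChevalleyFacts

variable {𝔤 : Type*} [LieRing 𝔤] [LieAlgebra ℂ 𝔤] [FiniteDimensional ℂ 𝔤] [IsSemisimple ℂ 𝔤]
  {H : LieSubalgebra ℂ 𝔤} [H.IsCartanSubalgebra] {b : (rootSystem H).Base}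
  (θ : ChevalleyAntiAut H)

lemma ChevalleyAntiAut.mem_rootSpace {i : H.root} {x : 𝔤} (hx : x ∈ rootSpace H (i.1 : H → ℂ)) :
    θ.toLinearEquiv x ∈ rootSpace H ((negRoot i).1 : H → ℂ) := by
  rw [mem_rootSpace_iff] at hx ⊢
  intro t
  have h1 : ⁅(t : 𝔤), θ.toLinearEquiv x⁆ = -θ.toLinearEquiv ⁅(t : 𝔤), x⁆ := by
    rw [θ.map_lie, θ.map_cartan t t.2, lie_skew]
  rw [h1, hx, map_smul, root_negRoot, LinearMap.neg_apply, neg_smul]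

/-- A Chevalley anti-automorphism is an involution. -/
lemma ChevalleyAntiAut.involutive (x : 𝔤) : θ.toLinearEquiv (θ.toLinearEquiv x) = x := by
  refine eq_top_of_triangular (H := H) (P := LinearMap.eqLocus
    (θ.toLinearEquiv.toLinearMap ∘ₗ θ.toLinearEquiv.toLinearMap) LinearMap.id) ?_ ?_ x
  · intro t ht
    change θ.toLinearEquiv (θ.toLinearEquiv t) = t
    rw [θ.map_cartan t ht, θ.map_cartan t ht]
  · intro i x hx
    have hnz := H.isNonZero_coe_root i
    obtain ⟨c, e, f, isSl2, he, hf⟩ := exists_isSl2Triple_of_weight_isNonZero hnz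
    have hc : c ∈ H := by
      rw [isSl2.h_eq_coroot hnz he hf]
      exact (coroot i.1).2
    have hc0 : c ≠ 0 := isSl2.h_ne_zero
    have hef := isSl2.lie_e_f
    have he0 : e ≠ 0 := by rintro rfl; rw [zero_lie] at hef; exact hc0 hef.symm
    have hf0 : f ≠ 0 := by rintro rfl; rw [lie_zero] at hef; exact hc0 hef.symm
    have hf' : f ∈ rootSpace H ((negRoot i).1 : H → ℂ) := hf
    obtain ⟨p, hp⟩ := exists_eq_smul_of_mem_rootSpace (negRoot i) hf' hf0 (θ.mem_rootSpace he)
    obtain ⟨q, hq⟩ := exists_eq_smul_of_mem_rootSpace i he he0 (by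
      have := θ.mem_rootSpace hf'
      rwa [negRoot_negRoot] at this)
    -- The coroot `c = ⁅e, f⁆` is fixed, whereas reversing the bracket gives `⁅q e, p f⁆ = q p c`;
    -- hence `p q = 1`.
    have h1 : (q * p - 1) • c = 0 := by
      have h2 : θ.toLinearEquiv ⁅e, f⁆ = c := by rw [hef, θ.map_cartan c hc]
      rw [θ.map_lie, hp, hq, smul_lie, lie_smul, smul_smul, hef] at h2
      rw [sub_smul, h2, one_smul, sub_self]
    have hqp : p * q = 1 := by
      rw [mul_comm]
      exact sub_eq_zero.mp ((smul_eq_zero.mp h1).resolve_right hc0)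
    obtain ⟨a, rfl⟩ := exists_eq_smul_of_mem_rootSpace i he he0 hx
    change θ.toLinearEquiv (θ.toLinearEquiv (a • e)) = a • e
    rw [map_smul, map_smul, hp, map_smul, hq, smul_smul, smul_smul, mul_assoc, hqp, mul_one]

lemma ChevalleyAntiAut.mem_nPos {x : 𝔤} (hx : x ∈ nNeg b) : θ.toLinearEquiv x ∈ nPos b :=
  nNeg_le (P := (nPos b).toSubmodule.comap θ.toLinearEquiv.toLinearMap)
    (fun _ hi _ hx => CatO.mem_nPos (isPos_negRoot.mpr hi) (θ.mem_rootSpace hx)) x hx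

lemma ChevalleyAntiAut.mem_nNeg {x : 𝔤} (hx : x ∈ nPos b) : θ.toLinearEquiv x ∈ nNeg b :=
  nPos_le (P := (nNeg b).toSubmodule.comap θ.toLinearEquiv.toLinearMap)
    (fun _ hi _ hx => CatO.mem_nNeg (fun h => isPos_negRoot.mp h hi) (θ.mem_rootSpace hx)) x hx

end ChevalleyFacts

section StarFacts

variable {𝔤 : Type*} [LieRing 𝔤] [LieAlgebra ℂ 𝔤] [FiniteDimensional ℂ 𝔤] [IsSemisimple ℂ 𝔤]
  {H : LieSubalgebra ℂ 𝔤} [H.IsCartanSubalgebra] {b : (rootSystem H).Base}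
  {θ : ChevalleyAntiAut H}
  {M : Type*} [AddCommGroup M] [Module ℂ M] [LieRingModule 𝔤 M] [LieModule ℂ 𝔤 M]
  {N : Type*} [AddCommGroup N] [Module ℂ N] [LieRingModule 𝔤 N] [LieModule ℂ 𝔤 N]

variable (θ M) in
/-- An element of the restricted dual as a functional. -/
def spair : StarDual θ M →ₗ[ℂ] Dual ℂ M := (finiteFunctionals H M).subtype

omit [FiniteDimensional ℂ 𝔤] [IsSemisimple ℂ 𝔤] in
lemma spair_injective : Function.Injective (spair θ M) := Subtype.val_injective

omit [FiniteDimensional ℂ 𝔤] [IsSemisimple ℂ 𝔤] in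
lemma star_ext {f g : StarDual θ M} (h : ∀ m, spair θ M f m = spair θ M g m) : f = g :=
  spair_injective (LinearMap.ext h)

lemma spair_lie (x : 𝔤) (f : StarDual θ M) (m : M) :
    spair θ M ⁅x, f⁆ m = spair θ M f ⁅θ.toLinearEquiv x, m⁆ := rfl

omit [FiniteDimensional ℂ 𝔤] [IsSemisimple ℂ 𝔤] in
lemma spair_mem (f : StarDual θ M) : spair θ M f ∈ finiteFunctionals H M := f.2

omit [FiniteDimensional ℂ 𝔤] [IsSemisimple ℂ 𝔤] in
lemma exists_spair {φ : Dual ℂ M} (h : φ ∈ finiteFunctionals H M) : ∃ f, spair θ M f = φ :=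
  ⟨⟨φ, h⟩, rfl⟩

omit [FiniteDimensional ℂ 𝔤] [IsSemisimple ℂ 𝔤] in
lemma mem_finiteFunctionals {φ : Dual ℂ M} : φ ∈ finiteFunctionals H M ↔
    {μ : Dual ℂ H | ∃ m ∈ wt M μ, φ m ≠ 0}.Finite := Iff.rfl

/-- Since `θ` fixes `𝔥`, the pairing is `𝔥`-invariant, so different weights are orthogonal. The
restricted dual thus has the same weights as the module. -/
lemma spair_eq_zero_of_ne {μ ν : Dual ℂ H} {f : StarDual θ M} (hf : f ∈ wt (StarDual θ M) μ)
    (h : ν ≠ μ) {m : M} (hm : m ∈ wt M ν) : spair θ M f m = 0 := by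
  obtain ⟨t, ht⟩ : ∃ t, ν t ≠ μ t := by
    by_contra! hc
    exact h (LinearMap.ext hc)
  have h1 := spair_lie (t : 𝔤) f m
  rw [mem_wt.mp hf, θ.map_cartan t t.2, mem_wt.mp hm, map_smul, map_smul, LinearMap.smul_apply,
    ← sub_eq_zero, ← sub_smul] at h1
  exact (smul_eq_zero.mp h1).resolve_left (sub_ne_zero.mpr (Ne.symm ht))

lemma mem_wt_star (hM : IsWeightModule H M) {μ : Dual ℂ H} {f : StarDual θ M}
    (h : ∀ ν, ν ≠ μ → ∀ m ∈ wt M ν, spair θ M f m = 0) : f ∈ wt (StarDual θ M) μ := by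
  rw [mem_wt]
  intro t
  apply spair_injective
  refine hM.ext fun ν m hm => ?_
  rw [spair_lie, θ.map_cartan t t.2, mem_wt.mp hm, map_smul, map_smul, LinearMap.smul_apply]
  by_cases hν : ν = μ
  · rw [hν]
  · rw [h ν hν m hm, smul_zero, smul_zero]

lemma star_eq_zero (hM : IsWeightModule H M) {μ : Dual ℂ H} {f : StarDual θ M}
    (hf : f ∈ wt (StarDual θ M) μ) (h : ∀ m ∈ wt M μ, spair θ M f m = 0) : f = 0 := by
  apply spair_injective
  rw [map_zero]
  refine hM.ext fun ν m hm => ?_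
  by_cases hν : ν = μ
  · subst hν; exact h m hm
  · exact spair_eq_zero_of_ne hf hν hm

lemma exists_star_extension (hM : IsWeightModule H M) {μ : Dual ℂ H} (φ : wt M μ →ₗ[ℂ] ℂ) :
    ∃ f ∈ wt (StarDual θ M) μ, ∀ (m : M) (hm : m ∈ wt M μ), spair θ M f m = φ ⟨m, hm⟩ := by
  obtain ⟨g, hg1, hg2⟩ := hM.exists_extension μ φ
  have hfin : g ∈ finiteFunctionals H M := by
    rw [mem_finiteFunctionals]
    refine (Set.finite_singleton μ).subset ?_
    rintro ν ⟨m, hm, h0⟩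
    by_contra hν
    exact h0 (hg2 ν hν m hm)
  obtain ⟨f, rfl⟩ := exists_spair (θ := θ) hfin
  exact ⟨f, mem_wt_star hM hg2, hg1⟩

lemma isWeightModule_star (hM : IsWeightModule H M) : IsWeightModule H (StarDual θ M) := by
  refine eq_top_iff.mpr fun f _ => ?_
  have hfin := spair_mem f
  rw [mem_finiteFunctionals] at hfin
  choose g hg hgf using fun μ : Dual ℂ H =>
    exists_star_extension (θ := θ) hM (spair θ M f ∘ₗ (wt M μ).subtype)
  have h1 : f = ∑ μ ∈ hfin.toFinset, g μ := by
    apply spair_injective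
    refine hM.ext fun ν m hm => ?_
    rw [map_sum, LinearMap.sum_apply]
    by_cases hν : ν ∈ hfin.toFinset
    · rw [Finset.sum_eq_single ν, hgf ν m hm]
      · rfl
      · exact fun κ _ hκ => spair_eq_zero_of_ne (hg κ) hκ.symm hm
      · exact fun h => absurd hν h
    · rw [Finset.sum_eq_zero]
      · by_contra h0
        exact hν (hfin.mem_toFinset.mpr ⟨m, hm, h0⟩)
      · exact fun κ hκ => spair_eq_zero_of_ne (hg κ) (fun h => hν (by rw [h]; exact hκ)) hm
  rw [h1]
  exact Submodule.sum_mem _ fun μ _ => Submodule.mem_iSup_of_mem μ (hg μ)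

variable (θ) in
/-- The restriction of functionals in a weight space of the dual to the weight space. -/
def wtRestrict (M : Type*) [AddCommGroup M] [Module ℂ M] [LieRingModule 𝔤 M] [LieModule ℂ 𝔤 M]
    (μ : Dual ℂ H) : wt (StarDual θ M) μ →ₗ[ℂ] Dual ℂ (wt M μ) :=
  Module.Dual.transpose (wt M μ).subtype ∘ₗ spair θ M ∘ₗ (wt (StarDual θ M) μ).subtype

lemma wtRestrict_bijective (hM : IsWeightModule H M) (μ : Dual ℂ H) :
    Function.Bijective (wtRestrict θ M μ) := by
  constructor
  · rw [injective_iff_map_eq_zero]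
    rintro ⟨f, hf⟩ h
    refine Subtype.ext (star_eq_zero hM hf fun m hm => ?_)
    exact LinearMap.congr_fun h ⟨m, hm⟩
  · intro φ
    obtain ⟨f, hf, h⟩ := exists_star_extension (θ := θ) hM φ
    refine ⟨⟨f, hf⟩, ?_⟩
    ext ⟨m, hm⟩
    exact h m hm

lemma IsOTilde.star (hM : IsOTilde b M) : IsOTilde b (StarDual θ M) := by
  obtain ⟨h1, ⟨s, hs⟩, h3⟩ := hM
  refine ⟨isWeightModule_star h1, ⟨s, fun μ hμ => hs μ ?_⟩, fun μ => ?_⟩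
  · by_contra h
    have h0 := wt_eq_bot h
    rw [mem_supp] at hμ
    refine hμ ((Submodule.eq_bot_iff _).mpr fun f hf => star_eq_zero h1 hf fun m hm => ?_)
    rw [h0, Submodule.mem_bot] at hm
    rw [hm, map_zero]
  · have := h3 μ
    have h4 : FiniteDimensional ℂ (wt (StarDual θ M) μ) :=
      FiniteDimensional.of_injective (wtRestrict θ M μ) (wtRestrict_bijective h1 μ).injective
    exact h4

/-- The weight space of the dual is the full dual of the weight space, and finite-dimensional spaces
are reflexive. No finiteness is asked of `φ` beyond being defined on one weight space. -/
lemma exists_bidual_wt (hM : IsOTilde b M) {μ : Dual ℂ H}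
    (φ : wt (StarDual θ M) μ →ₗ[ℂ] ℂ) :
    ∃ m ∈ wt M μ, ∀ (f : StarDual θ M) (hf : f ∈ wt (StarDual θ M) μ),
      spair θ M f m = φ ⟨f, hf⟩ := by
  have : FiniteDimensional ℂ (wt M μ) := hM.finiteDimensional μ
  let e := LinearEquiv.ofBijective _ (wtRestrict_bijective (θ := θ) hM.isWeightModule μ)
  let m := (evalEquiv ℂ (wt M μ)).symm (φ ∘ₗ e.symm.toLinearMap)
  refine ⟨m, m.2, fun f hf => ?_⟩
  have h1 : e ⟨f, hf⟩ m = (φ ∘ₗ e.symm.toLinearMap) (e ⟨f, hf⟩) :=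
    apply_evalEquiv_symm_apply ℂ (wt M μ) (e ⟨f, hf⟩) _
  rw [LinearMap.comp_apply, LinearEquiv.coe_coe, LinearEquiv.symm_apply_apply] at h1
  exact h1

lemma exists_bidual (hM : IsOTilde b M) {F : Dual ℂ (StarDual θ M)}
    (hF : F ∈ finiteFunctionals H (StarDual θ M)) : ∃ m, ∀ f, spair θ M f m = F f := by
  rw [mem_finiteFunctionals] at hF
  choose m hm hmF using fun μ : Dual ℂ H =>
    exists_bidual_wt (θ := θ) hM (F ∘ₗ (wt (StarDual θ M) μ).subtype)
  refine ⟨∑ μ ∈ hF.toFinset, m μ, fun f => ?_⟩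
  refine LinearMap.congr_fun (f := (spair θ M).flip (∑ μ ∈ hF.toFinset, m μ)) (g := F)
    ((isWeightModule_star hM.isWeightModule).ext fun μ f hf => ?_) f
  rw [LinearMap.flip_apply, map_sum]
  by_cases hμ : μ ∈ hF.toFinset
  · rw [Finset.sum_eq_single μ, hmF μ f hf]
    · rfl
    · exact fun κ _ hκ => spair_eq_zero_of_ne hf hκ (hm κ)
    · exact fun h => absurd hμ h
  · rw [Finset.sum_eq_zero]
    · by_contra h0
      exact hμ (hF.mem_toFinset.mpr ⟨f, hf, Ne.symm h0⟩)
    · exact fun κ hκ => spair_eq_zero_of_ne hf (fun h => hμ (h ▸ hκ)) (hm κ)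

variable (θ) in
lemma eq_zero_of_spair (hM : IsWeightModule H M) {m : M} (h : ∀ f, spair θ M f m = 0) : m = 0 := by
  obtain ⟨g, hg, hgm⟩ := hM.exists_finsupp m
  rw [← hgm]
  refine Finset.sum_eq_zero fun μ hμ => ?_
  have h1 : (⟨g μ, hg μ⟩ : wt M μ) = 0 := by
    rw [← Module.forall_dual_apply_eq_zero_iff ℂ]
    intro φ
    obtain ⟨f, hf, hfφ⟩ := exists_star_extension (θ := θ) hM φ
    rw [← hfφ (g μ) (hg μ), ← h f, ← hgm, Finsupp.sum, map_sum, Finset.sum_eq_single μ]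
    · exact fun κ _ hκ => spair_eq_zero_of_ne hf hκ (hg κ)
    · exact fun h => absurd hμ h
  exact congrArg Subtype.val h1

variable (θ) in
lemma eval_mem_finiteFunctionals (hM : IsWeightModule H M) (m : M) :
    (spair θ M).flip m ∈ finiteFunctionals H (StarDual θ M) := by
  obtain ⟨g, hg, hgm⟩ := hM.exists_finsupp m
  rw [mem_finiteFunctionals]
  refine g.support.finite_toSet.subset ?_
  rintro μ ⟨f, hf, h0⟩
  by_contra hμ
  refine h0 ?_
  rw [LinearMap.flip_apply, ← hgm, Finsupp.sum, map_sum]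
  exact Finset.sum_eq_zero fun κ hκ => spair_eq_zero_of_ne hf (fun h => hμ (h ▸ hκ)) (hg κ)

variable (θ) in
/-- The restricted bidual of a module of `Õ` is the module itself. -/
lemma exists_bidual_equiv (hM : IsOTilde b M) :
    ∃ e : M ≃ₗ⁅ℂ,𝔤⁆ StarDual θ (StarDual θ M), ∀ m f, spair θ _ (e m) f = spair θ M f m := by
  choose e he using fun m => exists_spair (θ := θ) (eval_mem_finiteFunctionals θ hM.isWeightModule m)
  have he' : ∀ m f, spair θ _ (e m) f = spair θ M f m := fun m f => by rw [he]; rfl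
  let f : M →ₗ⁅ℂ,𝔤⁆ StarDual θ (StarDual θ M) :=
    { toFun := e
      map_add' := fun x y => star_ext fun f => by
        rw [map_add, LinearMap.add_apply, he', he', he', map_add]
      map_smul' := fun c x => star_ext fun f => by
        rw [map_smul, RingHom.id_apply, LinearMap.smul_apply, he', he', map_smul]
      map_lie' := fun {x m} => star_ext fun f => by
        rw [spair_lie, he', he', spair_lie, θ.involutive] }
  refine ⟨lieEquivOfBijective f ⟨?_, fun F => ?_⟩, he'⟩
  · rw [injective_iff_map_eq_zero]
    intro m hm
    refine eq_zero_of_spair θ hM.isWeightModule fun g => ?_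
    rw [← he', show e m = 0 from hm, map_zero, LinearMap.zero_apply]
  · obtain ⟨m, hm⟩ := exists_bidual hM (spair_mem F)
    exact ⟨m, star_ext fun g => (he' m g).trans (hm g)⟩

variable (θ) in
/-- The contravariant functoriality of the restricted dual. -/
def starMap (f : M →ₗ⁅ℂ,𝔤⁆ N) : StarDual θ N →ₗ⁅ℂ,𝔤⁆ StarDual θ M where
  toFun g := ⟨spair θ N g ∘ₗ (f : M →ₗ[ℂ] N), by
    rw [mem_finiteFunctionals]
    refine (mem_finiteFunctionals.mp (spair_mem g)).subset ?_
    rintro μ ⟨m, hm, h0⟩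
    exact ⟨f m, map_mem_wt f hm, h0⟩⟩
  map_add' g g' := rfl
  map_smul' c g := rfl
  map_lie' {x g} := star_ext fun m => by
    change spair θ N ⁅x, g⁆ (f m) = spair θ N g (f ⁅θ.toLinearEquiv x, m⁆)
    rw [spair_lie, LieModuleHom.map_lie]

lemma spair_starMap (f : M →ₗ⁅ℂ,𝔤⁆ N) (g : StarDual θ N) (m : M) :
    spair θ M (starMap θ f g) m = spair θ N g (f m) := rfl

lemma starMap_injective {f : M →ₗ⁅ℂ,𝔤⁆ N} (hf : Function.Surjective f) :
    Function.Injective (starMap θ f) := by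
  intro g g' h
  refine star_ext fun n => ?_
  obtain ⟨m, rfl⟩ := hf n
  rw [← spair_starMap, h, spair_starMap]

/-- Functionals are extended along the injection one weight space at a time, by a linear left
inverse on that weight space and by zero on the others. -/
lemma starMap_surjective (hN : IsWeightModule H N) {f : M →ₗ⁅ℂ,𝔤⁆ N} (hf : Function.Injective f) :
    Function.Surjective (starMap θ f) := by
  have hM := hN.of_injective hf
  have key : ∀ g, g ∈ LinearMap.range (starMap θ f : StarDual θ N →ₗ[ℂ] StarDual θ M) := by
    refine (isWeightModule_star hM).induction fun μ g hg => ?_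
    let r : wt M μ →ₗ[ℂ] wt N μ := (f : M →ₗ[ℂ] N).restrict fun m hm => map_mem_wt f hm
    have hr : LinearMap.ker r = ⊥ := LinearMap.ker_eq_bot.mpr fun x y h =>
      Subtype.ext (hf (congrArg Subtype.val h))
    obtain ⟨l, hl⟩ := r.exists_leftInverse_of_injective hr
    obtain ⟨F, hF, hFl⟩ := exists_star_extension (θ := θ) hN
      (spair θ M g ∘ₗ (wt M μ).subtype ∘ₗ l)
    refine ⟨F, spair_injective (hM.ext fun ν m hm => ?_)⟩
    refine (spair_starMap f F m).trans ?_
    by_cases hν : ν = μ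
    · subst hν
      rw [hFl _ (map_mem_wt f hm)]
      have : l (r ⟨m, hm⟩) = ⟨m, hm⟩ := LinearMap.congr_fun hl ⟨m, hm⟩
      change spair θ M g (l (r ⟨m, hm⟩)) = _
      rw [this]
    · rw [spair_eq_zero_of_ne hF hν (map_mem_wt f hm), spair_eq_zero_of_ne hg hν hm]
  intro g
  exact key g

/-- The functional descends to `N` as a linear map; the descended functional meets finitely many
weight spaces because those of `N` are images of those of `M`. -/
lemma exists_starMap_eq (hM : IsWeightModule H M) {f : M →ₗ⁅ℂ,𝔤⁆ N} (hf : Function.Surjective f)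
    (g : StarDual θ M) (hg : ∀ m, f m = 0 → spair θ M g m = 0) : ∃ F, starMap θ f F = g := by
  have hk : LinearMap.ker (f : M →ₗ[ℂ] N) ≤ LinearMap.ker (spair θ M g) := fun m hm => hg m hm
  let φ : Dual ℂ N := (LinearMap.ker (f : M →ₗ[ℂ] N)).liftQ (spair θ M g) hk ∘ₗ
    ((f : M →ₗ[ℂ] N).quotKerEquivOfSurjective hf).symm.toLinearMap
  have hφ : ∀ m, φ (f m) = spair θ M g m := by
    intro m
    have : ((f : M →ₗ[ℂ] N).quotKerEquivOfSurjective hf).symm (f m) =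
        Submodule.Quotient.mk m := by
      rw [LinearEquiv.symm_apply_eq]; rfl
    change (LinearMap.ker (f : M →ₗ[ℂ] N)).liftQ (spair θ M g) hk
      (((f : M →ₗ[ℂ] N).quotKerEquivOfSurjective hf).symm (f m)) = _
    rw [this]; rfl
  obtain ⟨F, hF⟩ := exists_spair (θ := θ) (φ := φ) (by
    rw [mem_finiteFunctionals]
    refine (mem_finiteFunctionals.mp (spair_mem g)).subset ?_
    rintro μ ⟨n, hn, h0⟩
    rw [wt_eq_map_of_surjective hM hf] at hn
    obtain ⟨m, hm, rfl⟩ := hn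
    exact ⟨m, hm, by rw [← hφ]; exact h0⟩)
  refine ⟨F, star_ext fun m => ?_⟩
  rw [spair_starMap, hF, hφ]

end StarFacts

/-! ### The restricted dual of a tensor product -/

section StarTensor

variable {𝔤 : Type*} [LieRing 𝔤] [LieAlgebra ℂ 𝔤] [FiniteDimensional ℂ 𝔤] [IsSemisimple ℂ 𝔤]
  {H : LieSubalgebra ℂ 𝔤} [H.IsCartanSubalgebra] {b : (rootSystem H).Base}
  (θ : ChevalleyAntiAut H)
  {M : Type*} [AddCommGroup M] [Module ℂ M] [LieRingModule 𝔤 M] [LieModule ℂ 𝔤 M]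
  {N : Type*} [AddCommGroup N] [Module ℂ N] [LieRingModule 𝔤 N] [LieModule ℂ 𝔤 N]

variable (M N) in
/-- The product of functionals, as a functional on the tensor product. -/
def tensorFunctional : StarDual θ M ⊗[ℂ] StarDual θ N →ₗ[ℂ] Dual ℂ (M ⊗[ℂ] N) :=
  TensorProduct.dualDistrib ℂ M N ∘ₗ TensorProduct.map (spair θ M) (spair θ N)

omit [FiniteDimensional ℂ 𝔤] [IsSemisimple ℂ 𝔤] in
lemma tensorFunctional_tmul (f : StarDual θ M) (g : StarDual θ N) (m : M) (n : N) :
    tensorFunctional θ M N (f ⊗ₜ g) (m ⊗ₜ n) = spair θ M f m * spair θ N g n := rfl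

omit [FiniteDimensional ℂ 𝔤] [IsSemisimple ℂ 𝔤] in
lemma tensorFunctional_mem (hM : IsWeightModule H M) (hN : IsWeightModule H N)
    (t : StarDual θ M ⊗[ℂ] StarDual θ N) :
    tensorFunctional θ M N t ∈ finiteFunctionals H (M ⊗[ℂ] N) := by
  induction t using TensorProduct.induction_on with
  | zero => rw [map_zero]; exact zero_mem _
  | add a c ha hc => rw [map_add]; exact add_mem ha hc
  | tmul f g =>
    rw [mem_finiteFunctionals]
    refine (Set.Finite.image2 (· + ·) (mem_finiteFunctionals.mp (spair_mem f))
      (mem_finiteFunctionals.mp (spair_mem g))).subset ?_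
    rintro μ ⟨t, ht, h0⟩
    by_contra hμ
    refine h0 ?_
    rw [wt_tensor hM hN] at ht
    have hle : tensorWt M N μ ≤ LinearMap.ker (tensorFunctional θ M N (f ⊗ₜ g)) := by
      refine iSup_le fun ν => Submodule.map₂_le.mpr fun m hm n hn => ?_
      rw [LinearMap.mem_ker]
      change spair θ M f m * spair θ N g n = 0
      by_contra hne
      exact hμ ⟨ν, ⟨m, hm, left_ne_zero_of_mul hne⟩, μ - ν, ⟨n, hn, right_ne_zero_of_mul hne⟩,
        add_sub_cancel _ _⟩
    exact hle ht

omit [FiniteDimensional ℂ 𝔤] [IsSemisimple ℂ 𝔤] in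
lemma tensorFunctional_injective : Function.Injective (tensorFunctional θ M N) := by
  classical
  rw [injective_iff_map_eq_zero]
  intro t ht
  let B := Basis.ofVectorSpace ℂ (StarDual θ N)
  obtain ⟨r, rfl⟩ := (TensorProduct.equivFinsuppOfBasisRight (M := StarDual θ M) B).symm.surjective t
  have h1 : r = 0 := by
    ext1 i
    refine star_ext fun m => ?_
    have h2 : r.sum (fun i f => spair θ M f m • B i) = 0 := by
      refine star_ext fun n => ?_
      have h3 := LinearMap.congr_fun ht (m ⊗ₜ n)
      rw [TensorProduct.equivFinsuppOfBasisRight_symm_apply, map_finsuppSum,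
        Finsupp.sum, LinearMap.sum_apply] at h3
      rw [Finsupp.sum, map_sum, LinearMap.sum_apply]
      refine Eq.trans ?_ (h3.trans ?_)
      · refine Finset.sum_congr rfl fun i _ => ?_
        rw [tensorFunctional_tmul, map_smul]; rfl
      · simp
    have h4 := (linearIndependent_iff'.mp B.linearIndependent) r.support
      (fun i => spair θ M (r i) m) h2
    rw [Finsupp.zero_apply, map_zero, LinearMap.zero_apply]
    by_cases hi : i ∈ r.support
    · exact h4 i hi
    · rw [Finsupp.notMem_support_iff.mp hi, map_zero, LinearMap.zero_apply]
  rw [h1, map_zero]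

/-- Finitely many weights carry `F`, with heights at least `c`, and heights in `N` are at most `C`.
Hence `F` vanishes on `M_ν ⊗ N` unless `ht ν ≥ c - C`, which leaves a finite set `S` of weights `ν`.
Over each of these `M_ν` is finite-dimensional, and `F` is expanded along a dual basis. -/
lemma exists_tensorFunctional_eq (hM : IsOTilde b M) (hN : IsOTilde b N)
    {F : Dual ℂ (M ⊗[ℂ] N)} (hF : F ∈ finiteFunctionals H (M ⊗[ℂ] N)) :
    ∃ t, tensorFunctional θ M N t = F := by
  classical
  rw [mem_finiteFunctionals] at hF
  obtain ⟨C, hC⟩ := hN.exists_ht_le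
  obtain ⟨c, hc⟩ := (hF.image (ht b)).bddBelow
  have hS := hM.finite_ht_ge (c - C)
  set S := hS.toFinset
  have hzero : ∀ ν, ν ∉ S → ∀ m ∈ wt M ν, ∀ n, F (m ⊗ₜ n) = 0 := by
    intro ν hν m hm n
    refine hN.isWeightModule.induction
      (P := LinearMap.ker (F ∘ₗ TensorProduct.mk ℂ M N m)) (fun κ n hn => ?_) n
    rw [LinearMap.mem_ker]
    change F (m ⊗ₜ n) = 0
    by_contra h0
    have hm0 : m ≠ 0 := by rintro rfl; simp at h0
    have hn0 : n ≠ 0 := by rintro rfl; simp at h0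
    have h1 := hC κ (mem_supp_of_mem hn hn0)
    have h2 := hc (Set.mem_image_of_mem (ht b)
      (show ν + κ ∈ _ from ⟨m ⊗ₜ n, tmul_mem_wt hm hn, h0⟩))
    rw [map_add] at h2
    exact hν (hS.mem_toFinset.mpr ⟨mem_supp_of_mem hm hm0, by linarith⟩)
  have hfd : ∀ ν, FiniteDimensional ℂ (wt M ν) := hM.finiteDimensional
  let B : ∀ ν : Dual ℂ H, Basis _ ℂ (wt M ν) := fun ν => finBasis ℂ (wt M ν)
  choose f hf hfB using fun (ν : Dual ℂ H) (k : Fin (finrank ℂ (wt M ν))) =>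
    exists_star_extension (θ := θ) hM.isWeightModule ((B ν).coord k)
  have hg : ∀ (ν : Dual ℂ H) (k : Fin (finrank ℂ (wt M ν))), ∃ g, spair θ N g =
      F ∘ₗ TensorProduct.mk ℂ M N (B ν k : M) := by
    intro ν k
    refine exists_spair ?_
    rw [mem_finiteFunctionals]
    refine (hF.image fun μ => μ - ν).subset ?_
    rintro κ ⟨n, hn, h0⟩
    exact ⟨ν + κ, ⟨(B ν k : M) ⊗ₜ n, tmul_mem_wt (B ν k).2 hn, h0⟩, by simp⟩
  choose g hg using hg
  refine ⟨∑ ν ∈ S, ∑ k, f ν k ⊗ₜ g ν k, ?_⟩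
  refine TensorProduct.ext ?_
  refine hM.isWeightModule.ext fun ν m hm => ?_
  ext n
  change tensorFunctional θ M N (∑ ν ∈ S, ∑ k, f ν k ⊗ₜ g ν k) (m ⊗ₜ n) = F (m ⊗ₜ n)
  have h1 : tensorFunctional θ M N (∑ ν ∈ S, ∑ k, f ν k ⊗ₜ g ν k) (m ⊗ₜ n) =
      ∑ κ ∈ S, ∑ k, spair θ M (f κ k) m * spair θ N (g κ k) n := by
    simp only [map_sum, LinearMap.sum_apply, tensorFunctional_tmul]
  rw [h1]
  by_cases hν : ν ∈ S
  · rw [Finset.sum_eq_single ν]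
    · have h2 : m = ∑ k, (B ν).coord k ⟨m, hm⟩ • (B ν k : M) := by
        have := congrArg Subtype.val ((B ν).sum_repr ⟨m, hm⟩)
        rw [← Submodule.subtype_apply, map_sum] at this
        exact this.symm
      conv_rhs => rw [h2, TensorProduct.sum_tmul, map_sum]
      refine Finset.sum_congr rfl fun k _ => ?_
      rw [hfB ν k m hm, hg, ← TensorProduct.smul_tmul', map_smul]; rfl
    · intro κ _ hκ
      refine Finset.sum_eq_zero fun k _ => ?_
      rw [spair_eq_zero_of_ne (hf κ k) hκ.symm hm, zero_mul]
    · exact fun h => absurd hν h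
  · rw [hzero ν hν m hm n]
    refine Finset.sum_eq_zero fun κ hκ => Finset.sum_eq_zero fun k _ => ?_
    rw [spair_eq_zero_of_ne (hf κ k) (fun h => hν (by rw [h]; exact hκ)) hm, zero_mul]

/-- The restricted dual of a tensor product. -/
theorem nonempty_star_tensor (hM : IsOTilde b M) (hN : IsOTilde b N) :
    Nonempty ((StarDual θ M ⊗[ℂ] StarDual θ N) ≃ₗ⁅ℂ,𝔤⁆ StarDual θ (M ⊗[ℂ] N)) := by
  choose e he using fun t => exists_spair (θ := θ)
    (tensorFunctional_mem θ hM.isWeightModule hN.isWeightModule t)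
  have hlie : ∀ (x : 𝔤) t s, tensorFunctional θ M N ⁅x, t⁆ s =
      tensorFunctional θ M N t ⁅θ.toLinearEquiv x, s⁆ := by
    intro x t s
    induction t using TensorProduct.induction_on with
    | zero => simp
    | add a c ha hc => rw [lie_add, map_add, LinearMap.add_apply, ha, hc, map_add]; rfl
    | tmul f g =>
      induction s using TensorProduct.induction_on with
      | zero => simp
      | add a c ha hc => rw [map_add, ha, hc, lie_add, map_add]
      | tmul m n =>
        rw [TensorProduct.LieModule.lie_tmul_right, TensorProduct.LieModule.lie_tmul_right, map_add,
          LinearMap.add_apply, map_add]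
        simp only [tensorFunctional_tmul, spair_lie]
  let f : (StarDual θ M ⊗[ℂ] StarDual θ N) →ₗ⁅ℂ,𝔤⁆ StarDual θ (M ⊗[ℂ] N) :=
    { toFun := e
      map_add' := fun x y => spair_injective (by rw [he, map_add, map_add, he, he])
      map_smul' := fun c x => spair_injective (by
        rw [he, RingHom.id_apply, map_smul, map_smul, he])
      map_lie' := fun {x t} => star_ext fun s => by
        rw [he, spair_lie, he, hlie] }
  refine ⟨lieEquivOfBijective f ⟨fun t t' h => ?_, fun F => ?_⟩⟩
  · apply tensorFunctional_injective θ
    rw [← he, ← he]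
    exact congrArg _ h
  · obtain ⟨t, ht⟩ := exists_tensorFunctional_eq θ hM hN (spair_mem F)
    exact ⟨t, spair_injective ((he t).trans ht)⟩

end StarTensor

/-! ### Dual Verma filtrations and freeness of the restricted dual -/

section DualFiltrations

variable {𝔤 : Type*} [LieRing 𝔤] [LieAlgebra ℂ 𝔤] [FiniteDimensional ℂ 𝔤] [IsSemisimple ℂ 𝔤]
  {H : LieSubalgebra ℂ 𝔤} [H.IsCartanSubalgebra] {b : (rootSystem H).Base}
  {θ : ChevalleyAntiAut H}
  {M : Type*} [AddCommGroup M] [Module ℂ M] [LieRingModule 𝔤 M] [LieModule ℂ 𝔤 M]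
  {N : Type*} [AddCommGroup N] [Module ℂ N] [LieRingModule 𝔤 N] [LieModule ℂ 𝔤 N]

lemma cartan_lie_mem_uspan {I : Type*} {v : I → M} {S : Set I}
    (hv : ∀ i ∈ S, ∃ μ : Dual ℂ H, v i ∈ wt M μ) (t : H) {m : M} (hm : m ∈ uspan (nNeg b) v S) :
    ⁅(t : 𝔤), m⁆ ∈ uspan (nNeg b) v S := by
  have h1 : ∀ i ∈ S, ∀ u, ⁅(t : 𝔤), uact (nNeg b) M u (v i)⁆ ∈ uspan (nNeg b) v S := by
    intro i hi u
    refine env_eq_top ((uspan (nNeg b) v S).comap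
      ((toEnd ℂ 𝔤 M (t : 𝔤)) ∘ₗ (uact (nNeg b) M).toLinearMap.flip (v i))) ?_ ?_ u
    · change ⁅(t : 𝔤), uact (nNeg b) M 1 (v i)⁆ ∈ uspan (nNeg b) v S
      obtain ⟨μ, hμ⟩ := hv i hi
      rw [map_one, Module.End.one_apply, mem_wt.mp hμ]
      exact Submodule.smul_mem _ _ (mem_uspan (L := nNeg b) v hi)
    · intro y u hu
      have h3 : uact (nNeg b) M (env y * u) (v i) = ⁅(y : 𝔤), uact (nNeg b) M u (v i)⁆ := by
        rw [uact_env_mul]; rfl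
      change ⁅(t : 𝔤), uact (nNeg b) M (env y * u) (v i)⁆ ∈ uspan (nNeg b) v S
      rw [h3, leibniz_lie]
      exact Submodule.add_mem _
        (lie_mem_uspan v (⟨_, lie_mem_nNeg_of_mem_cartan t y.2⟩ : nNeg b)
          (uact_mem_uspan v hi u)) (lie_mem_uspan v y hu)
  have h2 : uspan (nNeg b) v S ≤ (uspan (nNeg b) v S).comap (toEnd ℂ 𝔤 M (t : 𝔤)) :=
    uspan_le fun i hi u => h1 i hi u
  exact h2 hm

variable (θ) in
/-- The functionals in the restricted dual that vanish on a submodule. -/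
def annih (K : LieSubmodule ℂ 𝔤 M) : Submodule ℂ (StarDual θ M) :=
  LinearMap.ker (starMap θ K.incl : StarDual θ M →ₗ[ℂ] StarDual θ K)

lemma mem_annih {K : LieSubmodule ℂ 𝔤 M} {f : StarDual θ M} :
    f ∈ annih θ K ↔ ∀ m ∈ K, spair θ M f m = 0 := by
  constructor
  · intro h m hm
    have : starMap θ K.incl f = 0 := h
    have h2 := spair_starMap (θ := θ) K.incl f ⟨m, hm⟩
    rw [this, map_zero] at h2
    exact h2.symm
  · intro h
    exact star_ext fun m => (h m m.2).trans (by rw [map_zero]; rfl)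

lemma lie_mem_annih {K : LieSubmodule ℂ 𝔤 M} (x : 𝔤) {f : StarDual θ M} (hf : f ∈ annih θ K) :
    ⁅x, f⁆ ∈ annih θ K := by
  rw [mem_annih] at hf ⊢
  intro m hm
  rw [spair_lie]
  exact hf _ (K.lie_mem hm)

lemma annih_anti {K K' : LieSubmodule ℂ 𝔤 M} (h : K ≤ K') : annih θ K' ≤ annih θ K :=
  fun _ hf => mem_annih.mpr fun m hm => mem_annih.mp hf m (h hm)

lemma exists_annih_inf_wt_eq_bot (hM : IsOTilde b M) {K : ℕ → LieSubmodule ℂ 𝔤 M}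
    (hmono : Monotone K) (hK : ∀ m, ∃ k, m ∈ K k) (μ : Dual ℂ H) :
    ∃ k, annih θ (K k) ⊓ wt (StarDual θ M) μ = ⊥ := by
  have : FiniteDimensional ℂ (wt M μ) := hM.finiteDimensional μ
  choose k hk using hK
  let B := finBasis ℂ (wt M μ)
  let n := Finset.univ.sup fun i => k (B i)
  refine ⟨n, (Submodule.eq_bot_iff _).mpr ?_⟩
  rintro f ⟨hf1, hf2⟩
  refine star_eq_zero hM.isWeightModule hf2 fun m hm => mem_annih.mp hf1 m ?_
  have h1 : (⊤ : Submodule ℂ (wt M μ)) ≤ (K n).toSubmodule.comap (wt M μ).subtype := by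
    rw [← B.span_eq, Submodule.span_le]
    rintro _ ⟨i, rfl⟩
    exact hmono (Finset.le_sup (f := fun i => k (B i)) (Finset.mem_univ i)) (hk (B i))
  exact h1 (show (⟨m, hm⟩ : wt M μ) ∈ ⊤ from trivial)

/-- The restricted dual of a module with a dual Verma filtration is free over `U(𝔫₋)`. -/
theorem Filtration.lieFree_star (hM : IsOTilde b M)
    (F : Filtration (𝔤 := 𝔤) (DualVerma b θ) M) : LieFree (nNeg b) (StarDual θ M) := by
  choose g hg hk using exists_proj F
  choose e he using fun k : F.proper => exists_bidual_equiv θ (isOTilde_verma b (F.label k))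
  -- Dualizing `F.step (k + 1) → ∇` embeds `Δ ≅ ∇^⋆` into the dual of `F.step (k + 1)`, with image
  -- the functionals that vanish on `F.step k`. The successive quotients of the annihilators in
  -- `M^⋆` are therefore Verma modules.
  let σ : ∀ k : F.proper, Verma b (F.label k) →ₗ⁅ℂ,𝔤⁆ StarDual θ (F.step (k + 1)) :=
    fun k => (starMap θ (g k)).comp (e k).toLieModuleHom
  have hσ : ∀ k, Function.Injective (σ k) := fun k =>
    (starMap_injective (hg k)).comp (e k).injective
  let ρ : ∀ k : ℕ, StarDual θ M →ₗ⁅ℂ,𝔤⁆ StarDual θ (F.step k) := fun k => starMap θ (F.step k).incl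
  have hρ : ∀ k f, ρ k f = 0 ↔ f ∈ annih θ (F.step k) := fun k f => Iff.rfl
  have hσρ : ∀ (k : F.proper) f, f ∈ annih θ (F.step k) ↔ ∃ w, σ k w = ρ (k + 1) f := by
    intro k f
    constructor
    · intro hf
      obtain ⟨G, hG⟩ := exists_starMap_eq
        (hM.isWeightModule.of_injective (F.step (k + 1)).injective_incl) (hg k) (ρ (k + 1) f)
        (fun m hm => mem_annih.mp hf m ((hk k m).mp hm))
      obtain ⟨w, rfl⟩ := (e k).surjective G
      exact ⟨w, hG⟩
    · rintro ⟨w, hw⟩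
      refine mem_annih.mpr fun m hm => ?_
      have hm' : m ∈ F.step (k + 1) := F.monotone (Nat.le_succ _) hm
      have h1 : spair θ M f m = spair θ _ (ρ (k + 1) f) ⟨m, hm'⟩ := rfl
      have h2 : spair θ _ (σ k w) ⟨m, hm'⟩ = spair θ _ (e k w) (g k ⟨m, hm'⟩) := rfl
      rw [h1, ← hw, h2, (hk k ⟨m, hm'⟩).mpr hm, map_zero]
  -- The generator is lifted to a weight vector, so that the `U(𝔫₋)`-span of the lift is stable
  -- under `𝔥`.
  have hv : ∀ k : F.proper, ∃ v ∈ wt (StarDual θ M) (F.label k),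
      ρ (k + 1) v = σ k (vermaGen b (F.label k)) := by
    intro k
    have h1 := map_mem_wt (σ k) (vermaGen_mem_wt b (F.label k))
    rw [wt_eq_map_of_surjective (isWeightModule_star hM.isWeightModule) (f := ρ (k + 1))
      (starMap_surjective hM.isWeightModule (F.step (k + 1)).injective_incl)] at h1
    exact h1
  choose v hvw hvσ using hv
  have huv : ∀ (k : F.proper) (u : Env (nNeg b)), ρ (k + 1) (uact (nNeg b) _ u (v k)) =
      σ k (uact (nNeg b) _ u (vermaGen b (F.label k))) := by
    intro k u
    rw [map_uact_sub, map_uact_sub, hvσ]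
  have hmem : ∀ (k : F.proper) (u : Env (nNeg b)),
      uact (nNeg b) _ u (v k) ∈ annih θ (F.step k) := fun k u =>
    (hσρ k _).mpr ⟨_, (huv k u).symm⟩
  refine LieFree.of_bijective v (ucomb_bijective (fun s u hs => ?_) ?_)
  -- The annihilators decrease, so here the term of smallest index is isolated.
  · induction s using Finset.induction_on_min with
    | empty => simp
    | insert a s hlt ih =>
      have ha : a ∉ s := fun h => lt_irrefl _ (hlt a h)
      rw [Finset.sum_insert ha] at hs
      have h1 : ∑ k ∈ s, uact (nNeg b) _ (u k) (v k) ∈ annih θ (F.step (a + 1)) :=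
        Submodule.sum_mem _ fun k hk =>
          annih_anti (F.monotone (Nat.succ_le_of_lt (hlt k hk))) (hmem k (u k))
      have h2 : u a = 0 := by
        have h3 : uact (nNeg b) _ (u a) (v a) ∈ annih θ (F.step (a + 1)) := by
          rw [eq_neg_of_add_eq_zero_left hs]
          exact Submodule.neg_mem _ h1
        rw [← hρ, huv] at h3
        have h4 := hσ a (h3.trans (map_zero _).symm)
        apply (verma_bijective b (F.label a)).injective
        change _ = uact (nNeg b) _ 0 _
        rw [map_zero]
        exact h4
      intro k hk
      rcases Finset.mem_insert.mp hk with rfl | hk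
      · exact h2
      · exact ih (by rwa [h2, map_zero, LinearMap.zero_apply, zero_add] at hs) k hk
  · rw [eq_top_iff]
    intro f _
    set R := ⨆ k, LinearMap.range ((uact (nNeg b) (StarDual θ M)).toLinearMap.flip (v k)) with hR
    refine (isWeightModule_star hM.isWeightModule).induction (P := R) (fun μ f hf => ?_) f
    obtain ⟨n, hn⟩ := exists_annih_inf_wt_eq_bot (θ := θ) hM F.monotone F.exhaustive μ
    -- The decreasing filtration reaches zero only weight by weight: in weight `μ` this happens at
    -- `n`. The induction is on the number `j` of steps left before `n`.
    have key : ∀ j k : ℕ, n ≤ k + j → annih θ (F.step k) ⊓ wt (StarDual θ M) μ ≤ R := by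
      intro j
      induction j with
      | zero =>
        intro k hk
        refine (inf_le_inf_right _ (annih_anti (F.monotone hk))).trans ?_
        rw [hn]
        exact bot_le
      | succ j ih =>
        rintro k hk f ⟨hf1, hf2⟩
        by_cases hkp : k ∈ F.proper
        · obtain ⟨w, hw⟩ := (hσρ ⟨k, hkp⟩ f).mp hf1
          obtain ⟨u, hu⟩ := verma_surjective b (F.label ⟨k, hkp⟩) w
          have hu' : uact (nNeg b) _ u (vermaGen b (F.label ⟨k, hkp⟩)) = w := hu
          obtain ⟨d, hd, hds⟩ := (isWeightModule_star hM.isWeightModule).exists_finsupp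
            (uact (nNeg b) _ u (v ⟨k, hkp⟩))
          have hU : ∀ ν ∈ d.support, d ν ∈ uspan (nNeg b) v {⟨k, hkp⟩} :=
            mem_of_sum_mem (fun t m hm => cartan_lie_mem_uspan
              (fun i _ => ⟨_, hvw i⟩) t hm) d.support d (fun ν _ => hd ν)
              (by
                rw [show ∑ ν ∈ d.support, d ν = _ from hds]
                exact uact_mem_uspan v (Set.mem_singleton _) u)
          have hU' : d μ ∈ R := by
            by_cases hμ : μ ∈ d.support
            · refine uspan_le (P := R) ?_ (hU μ hμ)
              intro i _ u
              exact Submodule.mem_iSup_of_mem i ⟨u, rfl⟩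
            · rw [Finsupp.notMem_support_iff.mp hμ]; exact R.zero_mem
          have hA : f - uact (nNeg b) _ u (v ⟨k, hkp⟩) ∈ annih θ (F.step (k + 1)) := by
            rw [← hρ, map_sub]
            have := huv ⟨k, hkp⟩ u
            rw [hu', hw] at this
            exact sub_eq_zero.mpr this.symm
          -- The correction may have components of other weights. As annihilators are stable under
          -- `𝔥`, subtracting only its component of weight `μ` still leads into the next one.
          have hA' : f - d μ ∈ annih θ (F.step (k + 1)) := by
            classical
            have := mem_of_sum_mem (H := H) (P := annih θ (F.step (k + 1)))
              (fun t m hm => lie_mem_annih (t : 𝔤) hm) (insert μ d.support)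
              (fun ν => (if ν = μ then f else 0) - d ν) (fun ν _ => by
                refine Submodule.sub_mem _ ?_ (hd ν)
                split_ifs with h
                · rw [h]; exact hf2
                · exact Submodule.zero_mem _) (by
                rw [Finset.sum_sub_distrib, Finset.sum_ite_eq' , if_pos (Finset.mem_insert_self _ _),
                  ← Finset.sum_subset (Finset.subset_insert μ d.support)
                  (fun ν _ hν => Finsupp.notMem_support_iff.mp hν)]
                rw [← hds] at hA
                exact hA) μ (Finset.mem_insert_self _ _)
            rwa [if_pos rfl] at this
          rw [← sub_add_cancel f (d μ)]
          exact R.add_mem (ih (k + 1) (by omega)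
            ⟨hA', Submodule.sub_mem _ hf2 (hd μ)⟩) hU'
        · rw [← F.step_eq k hkp] at hf1
          exact ih (k + 1) (by omega) ⟨hf1, hf2⟩
    refine key n 0 (by omega) ⟨mem_annih.mpr fun m hm => ?_, hf⟩
    rw [F.step_zero, LieSubmodule.mem_bot] at hm
    rw [hm, map_zero]

lemma spair_eq_zero_of_mem_htLe {c : ℝ} {f : StarDual θ M} (hf : f ∈ htLe b (StarDual θ M) c)
    {ν : Dual ℂ H} (hν : c < ht b ν) {m : M} (hm : m ∈ wt M ν) : spair θ M f m = 0 := by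
  have : htLe b (StarDual θ M) c ≤ LinearMap.ker ((spair θ M).flip m) := by
    refine iSup₂_le fun κ hκ f hf => ?_
    refine spair_eq_zero_of_ne hf (fun h => ?_) hm
    rw [h] at hν
    exact absurd hκ (not_le.mpr hν)
  exact this hf

/-- The elements of `M` annihilated by a submodule of the restricted dual. -/
def coannih (E : LieSubmodule ℂ 𝔤 (StarDual θ M)) : LieSubmodule ℂ 𝔤 M where
  carrier := {m | ∀ f ∈ E, spair θ M f m = 0}
  zero_mem' f _ := map_zero _
  add_mem' {m n} hm hn f hf := by rw [map_add, hm f hf, hn f hf, add_zero]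
  smul_mem' c m hm f hf := by rw [map_smul, hm f hf, smul_zero]
  lie_mem {x m} hm f hf := by
    have h1 := hm _ (E.lie_mem (x := θ.toLinearEquiv x) hf)
    rwa [spair_lie, θ.involutive] at h1

lemma mem_coannih {E : LieSubmodule ℂ 𝔤 (StarDual θ M)} {m : M} :
    m ∈ coannih E ↔ ∀ f ∈ E, spair θ M f m = 0 := Iff.rfl

/-- By biduality, elements of `M` restrict to functionals on `E`, and every restricted functional
arises. Those killing `E'` are the functionals on `E / E' ≅ X`, and the kernel of the restriction is
`coannih E`. -/
lemma exists_coannih_proj (hM : IsOTilde b M) {E' E : LieSubmodule ℂ 𝔤 (StarDual θ M)}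
    (hE : E' ≤ E) {X : Type*} [AddCommGroup X] [Module ℂ X] [LieRingModule 𝔤 X] [LieModule ℂ 𝔤 X]
    (h : E →ₗ⁅ℂ,𝔤⁆ X) (hs : Function.Surjective h) (hk : ∀ f : E, h f = 0 ↔ (f : StarDual θ M) ∈ E') :
    ∃ g : coannih E' →ₗ⁅ℂ,𝔤⁆ StarDual θ X, Function.Surjective g ∧
      ∀ m : coannih E', g m = 0 ↔ (m : M) ∈ coannih E := by
  obtain ⟨e, he⟩ := exists_bidual_equiv θ hM
  have hwS := isWeightModule_star (θ := θ) hM.isWeightModule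
  let ev : M →ₗ⁅ℂ,𝔤⁆ StarDual θ E := (starMap θ E.incl).comp e.toLieModuleHom
  have hev : ∀ m (f : E), spair θ E (ev m) f = spair θ M f m := fun m f => he m f
  have hevs : Function.Surjective ev :=
    (starMap_surjective hwS E.injective_incl).comp e.surjective
  have hi := starMap_injective (θ := θ) hs
  obtain ⟨g, hg⟩ := exists_factor_of_injective (starMap θ h) hi (ev.comp (coannih E').incl) (by
    rintro ⟨m, hm⟩
    refine exists_starMap_eq (hwS.of_injective E.injective_incl) hs _ fun f hf => ?_
    exact (hev m f).trans (hm f ((hk f).mp hf)))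
  refine ⟨g, fun F => ?_, fun m => ?_⟩
  · obtain ⟨m, hm⟩ := hevs (starMap θ h F)
    refine ⟨⟨m, fun f hf => ?_⟩, hi ((hg _).trans hm)⟩
    have h1 := hev m ⟨f, hE hf⟩
    rw [hm, spair_starMap, (hk ⟨f, hE hf⟩).mpr hf, map_zero] at h1
    exact h1.symm
  · constructor
    · intro h0 f hf
      have h1 := hg m
      rw [h0, map_zero] at h1
      have h2 := hev m ⟨f, hf⟩
      rw [show ev (m : M) = 0 from h1.symm, map_zero] at h2
      exact h2.symm
    · intro h0
      refine hi ((hg m).trans ?_)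
      rw [map_zero]
      refine star_ext fun f => ?_
      rw [map_zero]
      exact (hev m f).trans (h0 f f.2)

/-- A module of `Õ` whose restricted dual is free over `U(𝔫₋)` has a dual Verma filtration. -/
theorem isDualVermaFiltered_of_lieFree (hM : IsOTilde b M)
    (hfree : LieFree (nNeg b) (StarDual θ M)) : IsDualVermaFiltered b θ M := by
  have hD : IsOTilde b (StarDual θ M) := hM.star
  obtain ⟨n, v, hg⟩ := exists_goodBasis hD hfree
  set lam : (Σ p, Fin (n p)) → Dual ℂ H := fun j => j.1.1
  set cas : (Σ p, Fin (n p)) → ℂ := fun j => j.1.2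
  have := hg.countable hD
  -- The order is reversed: labels of lesser height come first, so that the labels numbered at least
  -- `k` form a lower set. Finiteness of the preceding labels depends on the Casimir blocks, since
  -- infinitely many weights may lie below a given one.
  obtain ⟨ρ, hinj, hmono⟩ := exists_rank (fun j i => prec b lam cas i j) prec_irrefl
    (fun _ _ _ h h' => prec_trans h' h)
    (fun i => (hg.finite_cas_eq hD (cas i)).subset fun j hj => hj.1.symm)
  have hlow : ∀ k, IsLower b lam cas {i | k ≤ ρ i} :=
    fun k i hi j hj => hi.trans (hmono i j hj).le
  have hstep : ∀ i, {j | ρ i ≤ ρ j} = insert i {j | ρ i + 1 ≤ ρ j} := by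
    intro i
    ext j
    simp only [Set.mem_insert_iff, Set.mem_ofPred_eq, Nat.succ_le_iff]
    rw [le_iff_lt_or_eq, or_comm, hinj.eq_iff, eq_comm]
  have hmonoT : Monotone fun k => coannih (hg.sub (hlow k)) := fun k l hkl m hm f hf =>
    hm f (uspan_mono v (fun i hi => le_trans hkl hi) hf)
  refine ⟨hM, ⟨{ step := fun k => coannih (hg.sub (hlow k))
                 step_zero := ?_
                 monotone := hmonoT
                 exhaustive := fun m => ?_
                 proper := Set.range ρ
                 label := fun k => lam k.2.choose
                 step_eq := fun k hk => ?_
                 subquotient := ?_ }⟩⟩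
  · rw [LieSubmodule.eq_bot_iff]
    intro m hm
    refine eq_zero_of_spair θ hM.isWeightModule fun f => hm f ?_
    rw [hg.mem_sub]
    have h1 : {i | 0 ≤ ρ i} = Set.univ := by ext; simp
    rw [h1, uspan_univ, LinearMap.range_eq_top.mpr hg.bijective.surjective]
    trivial
  · obtain ⟨d, hd, hdm⟩ := hM.isWeightModule.exists_finsupp m
    obtain ⟨c, hc⟩ := (d.support.image (ht b)).bddBelow
    -- The components of `m` have height at least `c`, and only finitely many labels do. Beyond them
    -- all basis elements lie in heights below `c`, and `U(𝔫₋)` only lowers, so their span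
    -- annihilates `m`.
    obtain ⟨k, hk⟩ := ((hg.finite_ht_ge hD c).image ρ).bddAbove
    refine ⟨k + 1, fun f hf => ?_⟩
    rw [hg.mem_sub] at hf
    refine uspan_le (P := LinearMap.ker ((spair θ M).flip m)) ?_ hf
    intro i hi u
    have h1 : ht b (lam i) < c := by
      by_contra! h
      have h2 := hk (Set.mem_image_of_mem ρ (show i ∈ {i | c ≤ ht b (lam i)} from h))
      have h3 : k + 1 ≤ ρ i := hi
      omega
    have h2 := uact_mem_htLe u (wt_le_htLe (le_refl (ht b (lam i))) (hg.mem_wt i))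
    rw [LinearMap.mem_ker, LinearMap.flip_apply, ← hdm, Finsupp.sum, map_sum]
    refine Finset.sum_eq_zero fun ν hν => spair_eq_zero_of_mem_htLe h2 ?_ (hd ν)
    exact h1.trans_le (hc (Finset.mem_coe.mpr (Finset.mem_image_of_mem _ hν)))
  · have hset : {i | k + 1 ≤ ρ i} = {i | k ≤ ρ i} := by
      ext i
      simp only [Set.mem_ofPred_eq]
      refine ⟨fun h => by omega, fun h => Nat.lt_of_le_of_ne h fun h' => hk ⟨i, h'.symm⟩⟩
    apply LieSubmodule.ext
    intro m
    rw [mem_coannih, mem_coannih]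
    simp only [hg.mem_sub, hset]
  · rintro ⟨k, hk⟩
    dsimp only
    obtain ⟨i, hi⟩ : ∃ i, hk.choose = i := ⟨_, rfl⟩
    have hk' := hk.choose_spec
    rw [hi] at hk' ⊢
    subst hk'
    rw [subquotient_iff]
    have hl := hlow (ρ i)
    obtain ⟨h, hh1, hh2⟩ := hg.exists_verma_proj (hlow (ρ i + 1)) (i := i)
      (Nat.not_succ_le_self (ρ i)) ((hstep i) ▸ hl)
    have e : hg.sub (hlow (ρ i)) = hg.sub ((hstep i) ▸ hl) := by
      apply LieSubmodule.ext
      intro m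
      rw [hg.mem_sub, hg.mem_sub, hstep i]
    rw [e]
    exact exists_coannih_proj hM (uspan_mono v (Set.subset_insert _ _)) h hh1 hh2

theorem isDualVermaFiltered_iff :
    IsDualVermaFiltered b θ M ↔ IsOTilde b M ∧ LieFree (nNeg b) (StarDual θ M) :=
  ⟨fun ⟨h, ⟨F⟩⟩ => ⟨h, F.lieFree_star h⟩, fun h => isDualVermaFiltered_of_lieFree h.1 h.2⟩

lemma lieFree_star_tensor (hM : IsOTilde b M) (hN : IsOTilde b N)
    (h : LieFree (nNeg b) (StarDual θ N)) : LieFree (nNeg b) (StarDual θ (M ⊗[ℂ] N)) := by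
  obtain ⟨e⟩ := nonempty_star_tensor θ hM hN
  exact (isFreeOver_tensor _ h).of_equiv e.toLinearEquiv fun x m => e.map_lie (x : 𝔤) m

theorem IsDualVermaFiltered.tensor (hM : IsOTilde b M) (hN : IsDualVermaFiltered b θ N) :
    IsDualVermaFiltered b θ (M ⊗[ℂ] N) := by
  rw [isDualVermaFiltered_iff] at hN ⊢
  exact ⟨hM.tensor hN.1, lieFree_star_tensor hM hN.1 hN.2⟩

end DualFiltrations

/-! ### Lifting highest weight vectors and splitting -/

section Lifting

variable {𝔤 : Type*} [LieRing 𝔤] [LieAlgebra ℂ 𝔤] [FiniteDimensional ℂ 𝔤] [IsSemisimple ℂ 𝔤]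
  {H : LieSubalgebra ℂ 𝔤} [H.IsCartanSubalgebra] {b : (rootSystem H).Base}
  {θ : ChevalleyAntiAut H}
  {X : Type*} [AddCommGroup X] [Module ℂ X] [LieRingModule 𝔤 X] [LieModule ℂ 𝔤 X]
  {Y : Type*} [AddCommGroup Y] [Module ℂ Y] [LieRingModule 𝔤 Y] [LieModule ℂ 𝔤 Y]
  {Z : Type*} [AddCommGroup Z] [Module ℂ Z] [LieRingModule 𝔤 Z] [LieModule ℂ 𝔤 Z]

omit [LieModule ℂ 𝔤 Y] [LieModule ℂ 𝔤 Z] in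
lemma IsHighest.map {μ : Dual ℂ H} {m : Y} (h : IsHighest b μ m) (f : Y →ₗ⁅ℂ,𝔤⁆ Z) :
    IsHighest b μ (f m) where
  cartan t := by rw [← LieModuleHom.map_lie, h.cartan, map_smul]
  nPos x hx := by rw [← LieModuleHom.map_lie, h.nPos x hx, map_zero]

/-- Highest weight vectors lift along a surjection if the dual of its kernel is free over
`U(𝔫₋)`. -/
lemma IsHighest.exists_lift (hY : IsOTilde b Y) {q : Y →ₗ⁅ℂ,𝔤⁆ Z} (hq : Function.Surjective q)
    {j : X →ₗ⁅ℂ,𝔤⁆ Y} (hj : Function.Injective j) (hex : ∀ y, q y = 0 ↔ ∃ x, j x = y)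
    (hX : LieFree (nNeg b) (StarDual θ X)) {μ : Dual ℂ H} {z : Z} (hz : IsHighest b μ z) :
    ∃ y, IsHighest b μ y ∧ q y = z := by
  have hwY := hY.isWeightModule
  have hZ : IsOTilde b Z := hY.of_surjective q hq
  let js : StarDual θ Y →ₗ⁅ℂ,nNeg b⁆ StarDual θ X :=
    { (starMap θ j : StarDual θ Y →ₗ[ℂ] StarDual θ X) with
      map_lie' := fun {x m} => (starMap θ j).map_lie (x : 𝔤) m }
  obtain ⟨s, hs⟩ := hX.exists_section js (starMap_surjective hwY hj)
  -- The section `s` makes `p` an `𝔫₋`-equivariant projector of `Y^⋆` onto the image of `Z^⋆`.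
  let p : StarDual θ Y →ₗ⁅ℂ,nNeg b⁆ StarDual θ Y := LieModuleHom.id - s.comp js
  have hp : ∀ f, ∃ F, starMap θ q F = p f := by
    intro f
    refine exists_starMap_eq hwY hq _ fun m hm => ?_
    obtain ⟨x, rfl⟩ := (hex m).mp hm
    have h1 : js (p f) = 0 := by
      change js (f - s (js f)) = 0
      rw [map_sub, hs, sub_self]
    have h2 : spair θ X (js (p f)) x = 0 := by rw [h1, map_zero]; rfl
    exact h2
  have hjq : ∀ F, p (starMap θ q F) = starMap θ q F := by
    intro F
    have h1 : js (starMap θ q F) = 0 := star_ext fun x => by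
      change spair θ Z F (q (j x)) = _
      rw [(hex _).mpr ⟨x, rfl⟩, map_zero, map_zero]; rfl
    change starMap θ q F - s (js (starMap θ q F)) = _
    rw [h1, map_zero, sub_zero]
  obtain ⟨y₀, hy₀⟩ := hq z
  -- A functional on `Y^⋆` that extends evaluation at `z` on `Z^⋆`. It kills `𝔫₋ Y^⋆`, because `p`
  -- commutes with `𝔫₋` and `θ` carries `𝔫₋` to `𝔫₊`, which kills `z`. It need not be supported on
  -- finitely many weights, so only its restriction to weight `μ` is represented, by the vector `y`.
  let Φ : Dual ℂ (StarDual θ Y) := (spair θ Y).flip y₀ ∘ₗ (p : StarDual θ Y →ₗ[ℂ] StarDual θ Y)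
  have hΦ : ∀ f, Φ f = spair θ Y (p f) y₀ := fun f => rfl
  have hΦq : ∀ F, Φ (starMap θ q F) = spair θ Z F z := by
    intro F
    rw [hΦ, hjq, spair_starMap, hy₀]
  have hΦn : ∀ x ∈ nNeg b, ∀ f, Φ ⁅x, f⁆ = 0 := by
    intro x hx f
    obtain ⟨F, hF⟩ := hp f
    have h1 : p ⁅x, f⁆ = ⁅x, p f⁆ := p.map_lie (⟨x, hx⟩ : nNeg b) f
    rw [hΦ, h1, ← hF, ← LieModuleHom.map_lie, spair_starMap, spair_lie, hy₀,
      hz.nPos _ (θ.mem_nPos hx), map_zero]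
  obtain ⟨y, hy, hyΦ⟩ := exists_bidual_wt (θ := θ) hY (Φ ∘ₗ (wt (StarDual θ Y) μ).subtype)
  have hyΦ' : ∀ f ∈ wt (StarDual θ Y) μ, spair θ Y f y = Φ f := hyΦ
  have hzwt : z ∈ wt Z μ := mem_wt.mpr hz.cartan
  refine ⟨y, ⟨mem_wt.mp hy, ?_⟩, ?_⟩
  · intro x hx
    refine nPos_le (P := LinearMap.ker ((toEnd ℂ 𝔤 Y : 𝔤 →ₗ[ℂ] End ℂ Y).flip y)) ?_ x hx
    intro i hi x hx
    change ⁅x, y⁆ = 0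
    refine eq_zero_of_spair θ hwY fun f => ?_
    refine (isWeightModule_star hwY).induction
      (P := LinearMap.ker ((spair θ Y).flip ⁅x, y⁆)) (fun κ f hf => ?_) f
    change spair θ Y f ⁅x, y⁆ = 0
    have h1 : spair θ Y f ⁅x, y⁆ = spair θ Y ⁅θ.toLinearEquiv x, f⁆ y := by
      rw [spair_lie, θ.involutive]
    have h2 := lie_mem_wt (θ.mem_rootSpace hx) hf
    rw [h1]
    by_cases hκ : (rootSystem H).root (negRoot i) + κ = μ
    · rw [hκ] at h2
      rw [hyΦ' _ h2]
      exact hΦn _ (θ.mem_nNeg (mem_nPos hi hx)) f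
    · exact spair_eq_zero_of_ne h2 (Ne.symm hκ) hy
  · rw [← sub_eq_zero]
    refine eq_zero_of_spair θ hZ.isWeightModule fun F => ?_
    refine (isWeightModule_star hZ.isWeightModule).induction
      (P := LinearMap.ker ((spair θ Z).flip (q y - z))) (fun κ F hF => ?_) F
    change spair θ Z F (q y - z) = 0
    rw [map_sub, sub_eq_zero]
    by_cases hκ : μ = κ
    · subst hκ
      rw [← spair_starMap, hyΦ' _ (map_mem_wt _ hF), hΦq]
    · rw [spair_eq_zero_of_ne hF hκ (map_mem_wt q hy), spair_eq_zero_of_ne hF hκ hzwt]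

/-- A submodule `S` of `Y` that maps isomorphically onto `E`. -/
def IsLift (q : Y →ₗ⁅ℂ,𝔤⁆ Z) (E : LieSubmodule ℂ 𝔤 Z) (S : LieSubmodule ℂ 𝔤 Y) : Prop :=
  (∀ y ∈ S, q y = 0 → y = 0) ∧ ∀ z, z ∈ E ↔ ∃ y ∈ S, q y = z

/-- After dividing `Y` by `S` and `Z` by `E`, the kernel is still `X`, since `S` maps isomorphically
onto `E`. The highest weight generator of `E' / E ≅ Δ(μ)` lifts to `Y / S`, giving a morphism `φ`
from `Δ(μ)`; the preimage of its range in `Y` is the new lift. -/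
lemma IsLift.exists_extend (hY : IsOTilde b Y) {q : Y →ₗ⁅ℂ,𝔤⁆ Z} (hq : Function.Surjective q)
    {j : X →ₗ⁅ℂ,𝔤⁆ Y} (hj : Function.Injective j) (hex : ∀ y, q y = 0 ↔ ∃ x, j x = y)
    (hX : LieFree (nNeg b) (StarDual θ X)) {E E' : LieSubmodule ℂ 𝔤 Z} (hE : E ≤ E')
    {μ : Dual ℂ H} {g : E' →ₗ⁅ℂ,𝔤⁆ Verma b μ} (hg : Function.Surjective g)
    (hk : ∀ m : E', g m = 0 ↔ (m : Z) ∈ E) {S : LieSubmodule ℂ 𝔤 Y} (hS : IsLift q E S) :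
    ∃ S', S ≤ S' ∧ IsLift q E' S' := by
  obtain ⟨hS1, hS2⟩ := hS
  set pS := LieSubmodule.Quotient.mk' S with hpS
  set pE := LieSubmodule.Quotient.mk' E with hpE
  have hpS0 : ∀ y, pS y = 0 ↔ y ∈ S := fun y => LieSubmodule.Quotient.mk_eq_zero _
  have hpE0 : ∀ y, pE y = 0 ↔ y ∈ E := fun y => LieSubmodule.Quotient.mk_eq_zero _
  have hpSs : Function.Surjective pS := LieSubmodule.Quotient.surjective_mk' S
  have hpEs : Function.Surjective pE := LieSubmodule.Quotient.surjective_mk' E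
  obtain ⟨q', hq'⟩ := exists_factor_of_surjective pS hpSs (pE.comp q)
    (fun y hy => (hpE0 _).mpr ((hS2 _).mpr ⟨y, (hpS0 y).mp hy, rfl⟩))
  have hq'' : ∀ y, q' (pS y) = pE (q y) := hq'
  have hq's : Function.Surjective q' := fun z => by
    obtain ⟨z, rfl⟩ := hpEs z
    obtain ⟨y, rfl⟩ := hq z
    exact ⟨pS y, hq'' y⟩
  have hj' : Function.Injective (pS.comp j) := by
    rw [injective_iff_map_eq_zero]
    intro x hx
    have h1 := hS1 (j x) ((hpS0 _).mp hx) ((hex _).mpr ⟨x, rfl⟩)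
    exact hj (h1.trans (map_zero j).symm)
  have hex' : ∀ y, q' y = 0 ↔ ∃ x, (pS.comp j) x = y := by
    intro y
    constructor
    · intro h
      obtain ⟨y, rfl⟩ := hpSs y
      rw [hq'', hpE0] at h
      obtain ⟨s, hs, hsq⟩ := (hS2 _).mp h
      obtain ⟨x, hx⟩ := (hex (y - s)).mp (by rw [map_sub, hsq, sub_self])
      refine ⟨x, ?_⟩
      change pS (j x) = pS y
      rw [hx, map_sub, (hpS0 s).mpr hs, sub_zero]
    · rintro ⟨x, rfl⟩
      change q' (pS (j x)) = 0
      rw [hq'', (hex _).mpr ⟨x, rfl⟩, map_zero]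
  obtain ⟨χ, hχ⟩ := exists_factor_of_surjective g hg (pE.comp E'.incl)
    (fun m hm => (hpE0 _).mpr ((hk m).mp hm))
  have hχ' : ∀ m : E', χ (g m) = pE m := hχ
  obtain ⟨y₁, hy₁, hqy₁⟩ := ((isHighest_vermaGen b μ).map χ).exists_lift (θ := θ)
    (hY.of_surjective pS hpSs) hq's hj' hex' hX
  obtain ⟨φ, hφ⟩ := exists_verma_hom hy₁
  have hqφ : ∀ w, q' (φ w) = χ w := fun w =>
    LieModuleHom.congr_fun (verma_hom_ext (f := q'.comp φ) (g := χ)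
      ((congrArg q' hφ).trans hqy₁)) w
  refine ⟨LieSubmodule.comap pS φ.range, fun y hy => ?_, fun y hy h0 => ?_,
    fun z => ⟨fun hz => ?_, ?_⟩⟩
  · rw [LieSubmodule.mem_comap, LieModuleHom.mem_range]
    exact ⟨0, by rw [map_zero, (hpS0 y).mpr hy]⟩
  · rw [LieSubmodule.mem_comap, LieModuleHom.mem_range] at hy
    obtain ⟨w, hw⟩ := hy
    obtain ⟨d, rfl⟩ := hg w
    have h1 : pE d = 0 := by rw [← hχ', ← hqφ, hw, hq'', h0, map_zero]
    rw [(hk d).mpr ((hpE0 _).mp h1), map_zero] at hw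
    exact hS1 y ((hpS0 y).mp hw.symm) h0
  · obtain ⟨y, hy⟩ := hpSs (φ (g ⟨z, hz⟩))
    have h1 : pE (z - q y) = 0 := by
      rw [map_sub, ← hq'', hy, hqφ, hχ', sub_self]
    obtain ⟨s, hs, hsq⟩ := (hS2 _).mp ((hpE0 _).mp h1)
    refine ⟨y + s, ?_, by rw [map_add, hsq, add_sub_cancel]⟩
    rw [LieSubmodule.mem_comap, LieModuleHom.mem_range]
    exact ⟨g ⟨z, hz⟩, by rw [map_add, (hpS0 s).mpr hs, add_zero, hy]⟩
  · rintro ⟨y, hy, rfl⟩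
    rw [LieSubmodule.mem_comap, LieModuleHom.mem_range] at hy
    obtain ⟨w, hw⟩ := hy
    obtain ⟨d, rfl⟩ := hg w
    have h1 : pE (q y - d) = 0 := by rw [map_sub, ← hq'', ← hw, hqφ, hχ', sub_self]
    rw [← sub_add_cancel (q y) (d : Z)]
    exact E'.add_mem (hE ((hpE0 _).mp h1)) d.2

/-- A surjection onto a module with a Verma filtration splits if the dual of its kernel is free
over `U(𝔫₋)`. -/
theorem Filtration.exists_section (F : Filtration (𝔤 := 𝔤) (Verma b) Z)
    (hY : IsOTilde b Y) {q : Y →ₗ⁅ℂ,𝔤⁆ Z} (hq : Function.Surjective q)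
    {j : X →ₗ⁅ℂ,𝔤⁆ Y} (hj : Function.Injective j) (hex : ∀ y, q y = 0 ↔ ∃ x, j x = y)
    (hX : LieFree (nNeg b) (StarDual θ X)) : ∃ s : Z →ₗ⁅ℂ,𝔤⁆ Y, ∀ z, q (s z) = z := by
  have hstep : ∀ k (S : LieSubmodule ℂ 𝔤 Y), IsLift q (F.step k) S →
      ∃ S', S ≤ S' ∧ IsLift q (F.step (k + 1)) S' := by
    intro k S hS
    by_cases hk : k ∈ F.proper
    · obtain ⟨g, hg, hgk⟩ := exists_proj F ⟨k, hk⟩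
      exact hS.exists_extend hY hq hj hex hX (F.monotone (Nat.le_succ k)) hg hgk
    · exact ⟨S, le_rfl, by rwa [F.step_eq k hk]⟩
  choose next hle hnext using hstep
  have h0 : IsLift q (F.step 0) ⊥ := by
    rw [F.step_zero]
    refine ⟨fun y hy _ => (LieSubmodule.mem_bot y).mp hy, fun z => ?_⟩
    rw [LieSubmodule.mem_bot]
    constructor
    · rintro rfl
      exact ⟨0, LieSubmodule.zero_mem _, map_zero q⟩
    · rintro ⟨y, hy, rfl⟩
      rw [(LieSubmodule.mem_bot y).mp hy, map_zero]
  let T : ∀ k, {S : LieSubmodule ℂ 𝔤 Y // IsLift q (F.step k) S} := fun k =>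
    Nat.rec ⟨⊥, h0⟩ (fun k S => ⟨next k S.1 S.2, hnext k S.1 S.2⟩) k
  have hT : Monotone fun k => (T k).1 := monotone_nat_of_le_succ fun k => hle k (T k).1 (T k).2
  -- The lifts form an increasing chain on which `q` is injective. Preimages in their union are
  -- therefore unique, which makes the chosen section linear and equivariant.
  have huniq : ∀ k l y y', y ∈ (T k).1 → y' ∈ (T l).1 → q y = q y' → y = y' := by
    intro k l y y' hy hy' h
    rw [← sub_eq_zero]
    refine (T (max k l)).2.1 _ ((T (max k l)).1.sub_mem (hT (le_max_left k l) hy)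
      (hT (le_max_right k l) hy')) ?_
    rw [map_sub, h, sub_self]
  have hex : ∀ z, ∃ y, (∃ k, y ∈ (T k).1) ∧ q y = z := by
    intro z
    obtain ⟨k, hk⟩ := F.exhaustive z
    obtain ⟨y, hy, hyz⟩ := ((T k).2.2 z).mp hk
    exact ⟨y, ⟨k, hy⟩, hyz⟩
  choose s hs hqs using hex
  refine ⟨{ toFun := s
            map_add' := fun x y => ?_
            map_smul' := fun c x => ?_
            map_lie' := fun {x z} => ?_ }, hqs⟩
  · obtain ⟨k, hk⟩ := hs (x + y)
    obtain ⟨l, hl⟩ := hs x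
    obtain ⟨m, hm⟩ := hs y
    refine huniq k (max l m) _ _ hk ((T (max l m)).1.add_mem (hT (le_max_left l m) hl)
      (hT (le_max_right l m) hm)) ?_
    rw [map_add, hqs, hqs, hqs]
  · obtain ⟨k, hk⟩ := hs (c • x)
    obtain ⟨l, hl⟩ := hs x
    refine huniq k l _ _ hk ((T l).1.smul_mem c hl) ?_
    rw [map_smul, hqs, hqs]; rfl
  · obtain ⟨k, hk⟩ := hs ⁅x, z⁆
    obtain ⟨l, hl⟩ := hs z
    refine huniq k l _ _ hk ((T l).1.lie_mem hl) ?_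
    rw [LieModuleHom.map_lie, hqs, hqs]

end Lifting

/-! ### Splitting tensor products with filtered modules -/

section Decompositions

variable {V : Type*} [AddCommGroup V] [Module ℂ V]
  {P : Type*} {E : P → Type*} [∀ k, AddCommGroup (E k)] [∀ k, Module ℂ (E k)]

/-- A family of linear maps that exhibits its target as the direct sum of the sources. -/
structure IsDecomp (t : ∀ k, E k →ₗ[ℂ] V) : Prop where
  independent : ∀ (s : Finset P) (e : ∀ k, E k), ∑ k ∈ s, t k (e k) = 0 → ∀ k ∈ s, e k = 0
  span : ⨆ k, LinearMap.range (t k) = ⊤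

lemma IsDecomp.bijective [DecidableEq P] {t : ∀ k, E k →ₗ[ℂ] V} (h : IsDecomp t) :
    Function.Bijective (DirectSum.toModule ℂ P V t) := by
  classical
  constructor
  · rw [injective_iff_map_eq_zero]
    intro d hd
    have h1 : ∑ k ∈ DFinsupp.support d, t k (d k) = 0 := by
      rw [← hd]
      conv_rhs => rw [← DirectSum.sum_support_of d, map_sum]
      refine Finset.sum_congr rfl fun k _ => ?_
      exact (DirectSum.toModule_lof ℂ k (d k)).symm
    have h2 := h.independent _ _ h1
    refine DFinsupp.ext fun k => ?_
    by_cases hk : k ∈ DFinsupp.support d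
    · exact h2 k hk
    · exact DFinsupp.notMem_support_iff.mp hk
  · rw [← LinearMap.range_eq_top, eq_top_iff, ← h.span]
    refine iSup_le fun k => ?_
    rintro _ ⟨e, rfl⟩
    exact ⟨DirectSum.lof ℂ P E k e, DirectSum.toModule_lof ℂ k e⟩

lemma IsDecomp.comp_equiv {t : ∀ k, E k →ₗ[ℂ] V} (h : IsDecomp t)
    {E' : P → Type*} [∀ k, AddCommGroup (E' k)] [∀ k, Module ℂ (E' k)]
    {W : Type*} [AddCommGroup W] [Module ℂ W]
    (e : ∀ k, E' k ≃ₗ[ℂ] E k) (f : V ≃ₗ[ℂ] W) :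
    IsDecomp fun k => f.toLinearMap ∘ₗ t k ∘ₗ (e k).toLinearMap where
  independent s d hd k hk := by
    have h1 : f (∑ k ∈ s, t k (e k (d k))) = 0 := by
      rw [map_sum]; exact hd
    have h2 := h.independent s _ (f.map_eq_zero_iff.mp h1) k hk
    exact (e k).map_eq_zero_iff.mp h2
  span := by
    have h1 : ∀ k, LinearMap.range (f.toLinearMap ∘ₗ t k ∘ₗ (e k).toLinearMap) =
        (LinearMap.range (t k)).map f.toLinearMap := fun k => by
      rw [LinearMap.range_comp, LinearMap.range_comp_of_range_eq_top _ (LinearEquiv.range (e k))]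
    simp_rw [h1]
    rw [← Submodule.map_iSup, h.span, Submodule.map_top]
    exact LinearEquiv.range f

lemma IsDecomp.comp {Q : Type*} {E' : P → Q → Type*} [∀ p q, AddCommGroup (E' p q)]
    [∀ p q, Module ℂ (E' p q)] {t : ∀ k, E k →ₗ[ℂ] V} (h : IsDecomp t)
    {r : ∀ p q, E' p q →ₗ[ℂ] E p} (hr : ∀ p, IsDecomp (r p)) :
    IsDecomp (P := P × Q) (E := fun k => E' k.1 k.2) fun k => t k.1 ∘ₗ r k.1 k.2 where
  independent s e hs := by
    classical
    let e' : ∀ p q, E' p q := fun p q => if (p, q) ∈ s then e (p, q) else 0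
    have h1 : ∑ p ∈ s.image Prod.fst, t p (∑ q ∈ s.image Prod.snd, r p q (e' p q)) = 0 := by
      rw [← hs]
      simp_rw [map_sum]
      rw [← Finset.sum_product (f := fun k : P × Q => t k.1 (r k.1 k.2 (e' k.1 k.2)))]
      refine (Finset.sum_subset_zero_on_sdiff (fun k hk => ?_) (fun k hk => ?_)
        (fun k hk => ?_)).symm
      · exact Finset.mem_product.mpr ⟨Finset.mem_image_of_mem _ hk, Finset.mem_image_of_mem _ hk⟩
      · simp only [e', if_neg (Finset.mem_sdiff.mp hk).2, map_zero]
      · simp only [e', if_pos hk]; rfl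
    rintro ⟨p, q⟩ hk
    have h2 := h.independent _ _ h1 p (Finset.mem_image_of_mem Prod.fst hk)
    have h3 := (hr p).independent _ _ h2 q (Finset.mem_image_of_mem Prod.snd hk)
    simp only [e', if_pos hk] at h3
    exact h3
  span := by
    rw [iSup_prod, ← h.span]
    refine iSup_congr fun p => ?_
    simp_rw [LinearMap.range_comp]
    refine (Submodule.map_iSup (t p) fun q => LinearMap.range (r p q)).symm.trans ?_
    rw [(hr p).span, Submodule.map_top]

end Decompositions

section TensorSplitting

variable {𝔤 : Type*} [LieRing 𝔤] [LieAlgebra ℂ 𝔤]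
  {M : Type*} [AddCommGroup M] [Module ℂ M] [LieRingModule 𝔤 M] [LieModule ℂ 𝔤 M]
  {N : Type*} [AddCommGroup N] [Module ℂ N] [LieRingModule 𝔤 N] [LieModule ℂ 𝔤 N]
  {K : Type*} [AddCommGroup K] [Module ℂ K] [LieRingModule 𝔤 K] [LieModule ℂ 𝔤 K]
  (Z : Type*) [AddCommGroup Z] [Module ℂ Z] [LieRingModule 𝔤 Z] [LieModule ℂ 𝔤 Z]

omit [LieModule ℂ 𝔤 M] in
lemma exists_lieEquiv_directSum {P : Type*} {E : P → Type*} [∀ k, AddCommGroup (E k)]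
    [∀ k, Module ℂ (E k)] [∀ k, LieRingModule 𝔤 (E k)] [∀ k, LieModule ℂ 𝔤 (E k)]
    (t : ∀ k, E k →ₗ⁅ℂ,𝔤⁆ M) (ht : IsDecomp fun k => (t k : E k →ₗ[ℂ] M)) :
    Nonempty (M ≃ₗ⁅ℂ,𝔤⁆ ⨁ k, E k) := by
  classical
  let f : (⨁ k, E k) →ₗ⁅ℂ,𝔤⁆ M :=
    { DirectSum.toModule ℂ P M fun k => (t k : E k →ₗ[ℂ] M) with
      map_lie' := fun {x d} => by
        change DirectSum.toModule ℂ P M (fun k => (t k : E k →ₗ[ℂ] M)) ⁅x, d⁆ =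
          ⁅x, DirectSum.toModule ℂ P M (fun k => (t k : E k →ₗ[ℂ] M)) d⁆
        induction d using DirectSum.induction_on with
        | zero => simp
        | add a c ha hc => rw [lie_add, map_add, ha, hc, map_add, lie_add]
        | of k e =>
          have h1 : ⁅x, DirectSum.of E k e⁆ = DirectSum.lof ℂ P E k ⁅x, e⁆ :=
            ((DirectSum.lieModuleOf ℂ P 𝔤 E k).map_lie x e).symm
          have h2 : DirectSum.of E k e = DirectSum.lof ℂ P E k e := rfl
          rw [h1, h2, DirectSum.toModule_lof, DirectSum.toModule_lof]
          exact (t k).map_lie x e }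
  exact ⟨(lieEquivOfBijective f ht.bijective).symm⟩

/-- Tensoring a morphism with the identity. -/
def lieRTensor (f : M →ₗ⁅ℂ,𝔤⁆ N) : M ⊗[ℂ] Z →ₗ⁅ℂ,𝔤⁆ N ⊗[ℂ] Z :=
  TensorProduct.LieModule.map f LieModuleHom.id

lemma lieRTensor_comp (f : M →ₗ⁅ℂ,𝔤⁆ N) (g : N →ₗ⁅ℂ,𝔤⁆ K) (t : M ⊗[ℂ] Z) :
    lieRTensor Z g (lieRTensor Z f t) = lieRTensor Z (g.comp f) t :=
  (LinearMap.rTensor_comp_apply Z (g : N →ₗ[ℂ] K) (f : M →ₗ[ℂ] N) t).symm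

lemma lieRTensor_injective {f : M →ₗ⁅ℂ,𝔤⁆ N} (hf : Function.Injective f) :
    Function.Injective (lieRTensor Z f) :=
  Module.Flat.rTensor_preserves_injective_linearMap (M := Z) (f : M →ₗ[ℂ] N) hf

lemma lieRTensor_surjective {f : M →ₗ⁅ℂ,𝔤⁆ N} (hf : Function.Surjective f) :
    Function.Surjective (lieRTensor Z f) :=
  LinearMap.rTensor_surjective (g := (f : M →ₗ[ℂ] N)) Z hf

lemma lieRTensor_exact {j : K →ₗ⁅ℂ,𝔤⁆ M} {q : M →ₗ⁅ℂ,𝔤⁆ N} (hq : Function.Surjective q)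
    (hex : ∀ m, q m = 0 ↔ ∃ k, j k = m) (t : M ⊗[ℂ] Z) :
    lieRTensor Z q t = 0 ↔ ∃ s, lieRTensor Z j s = t :=
  rTensor_exact Z (f := (j : K →ₗ[ℂ] M)) (g := (q : M →ₗ[ℂ] N)) hex hq t

variable {Λ : Type*} {X : Λ → Type*}
    [∀ μ, AddCommGroup (X μ)] [∀ μ, Module ℂ (X μ)]
    [∀ μ, LieRingModule 𝔤 (X μ)] [∀ μ, LieModule ℂ 𝔤 (X μ)]

/-- If a filtration splits after tensoring, the tensor product is the direct sum of the tensored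
subquotients. -/
lemma Filtration.exists_decomp (F : Filtration (𝔤 := 𝔤) X M)
    (hsplit : ∀ (k : F.proper) (g : F.step (k + 1) →ₗ⁅ℂ,𝔤⁆ X (F.label k)), Function.Surjective g →
      (∀ m : F.step (k + 1), g m = 0 ↔
        ∃ x, LieSubmodule.inclusion (F.monotone (Nat.le_succ k)) x = m) →
      ∃ s : X (F.label k) ⊗[ℂ] Z →ₗ⁅ℂ,𝔤⁆ F.step (k + 1) ⊗[ℂ] Z, ∀ e, lieRTensor Z g (s e) = e) :
    ∃ t : ∀ k : F.proper, X (F.label k) ⊗[ℂ] Z →ₗ⁅ℂ,𝔤⁆ M ⊗[ℂ] Z,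
      IsDecomp fun k => (t k : X (F.label k) ⊗[ℂ] Z →ₗ[ℂ] M ⊗[ℂ] Z) := by
  choose g hg hk using exists_proj F
  have hex : ∀ (k : F.proper) (m : F.step (k + 1)), g k m = 0 ↔
      ∃ x, LieSubmodule.inclusion (F.monotone (Nat.le_succ k)) x = m := by
    intro k m
    rw [hk]
    constructor
    · intro hm
      exact ⟨⟨m, hm⟩, rfl⟩
    · rintro ⟨x, rfl⟩
      exact x.2
  choose s hs using fun k => hsplit k (g k) (hg k) (hex k)
  let A : ℕ → Submodule ℂ (M ⊗[ℂ] Z) := fun k =>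
    LinearMap.range (lieRTensor Z (F.step k).incl : F.step k ⊗[ℂ] Z →ₗ[ℂ] M ⊗[ℂ] Z)
  have hincl : ∀ {k l : ℕ} (h : k ≤ l) (a : F.step k ⊗[ℂ] Z), lieRTensor Z (F.step l).incl
      (lieRTensor Z (LieSubmodule.inclusion (F.monotone h)) a) = lieRTensor Z (F.step k).incl a :=
    fun h a => lieRTensor_comp Z _ _ a
  have hmono : Monotone A := by
    rintro k l hkl _ ⟨a, rfl⟩
    exact ⟨_, hincl hkl a⟩
  refine ⟨fun k => (lieRTensor Z (F.step (k + 1)).incl).comp (s k), ⟨?_, ?_⟩⟩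
  -- An element whose image lies in the previous term comes from the kernel of `g k` tensored with
  -- `Z`, so applying `g k` to its section value gives zero.
  · refine independent_of_exhaustive hmono (fun k e => ⟨s k e, rfl⟩) ?_
    rintro k e ⟨a, ha⟩
    have h1 : lieRTensor Z (LieSubmodule.inclusion (F.monotone (Nat.le_succ k))) a = s k e :=
      lieRTensor_injective Z (F.step (k + 1)).injective_incl ((hincl (Nat.le_succ k) a).trans ha)
    rw [← hs k e, ← h1]
    exact (lieRTensor_exact Z (hg k) (hex k) _).mpr ⟨a, rfl⟩
  · refine iSup_range_of_exhaustive (A := A) ?_ ?_ ?_ ?_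
    · rw [eq_bot_iff]
      rintro _ ⟨a, rfl⟩
      have : a = 0 := by
        induction a using TensorProduct.induction_on with
        | zero => rfl
        | add a c ha hc => rw [ha, hc, add_zero]
        | tmul m z =>
          have hm : m = 0 := by
            have h := F.step_zero.le m.2
            exact Subtype.ext ((LieSubmodule.mem_bot (m : M)).mp h)
          rw [hm, TensorProduct.zero_tmul]
      rw [this, map_zero]
      exact Submodule.zero_mem _
    · intro a
      induction a using TensorProduct.induction_on with
      | zero => exact ⟨0, Submodule.zero_mem _⟩
      | add a c ha hc =>
        obtain ⟨i, hi⟩ := ha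
        obtain ⟨j, hj⟩ := hc
        exact ⟨max i j, Submodule.add_mem _ (hmono (le_max_left i j) hi)
          (hmono (le_max_right i j) hj)⟩
      | tmul m z =>
        obtain ⟨i, hi⟩ := F.exhaustive m
        exact ⟨i, ⟨(⟨m, hi⟩ : F.step i) ⊗ₜ z, rfl⟩⟩
    · rintro k _ ⟨a, rfl⟩
      refine ⟨lieRTensor Z (g k) a, ?_⟩
      obtain ⟨c, hc⟩ := (lieRTensor_exact Z (hg k) (hex k)
        (a - s k (lieRTensor Z (g k) a))).mp (by rw [map_sub, hs, sub_self])
      refine ⟨c, ?_⟩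
      have h1 := congrArg (lieRTensor Z (F.step (k + 1)).incl) hc
      rw [hincl (Nat.le_succ (k : ℕ)), map_sub] at h1
      exact h1
    · intro k hk
      refine le_antisymm ?_ (hmono (Nat.le_succ k))
      rintro _ ⟨a, rfl⟩
      exact ⟨lieRTensor Z (LieSubmodule.inclusion (F.step_eq k hk).le) a, lieRTensor_comp Z _ _ a⟩

/-- The filtration induced on one of its terms. -/
def Filtration.truncate (F : Filtration (𝔤 := 𝔤) X M) (k : ℕ) :
    Filtration (𝔤 := 𝔤) X (F.step k) where
  step i := (F.step i).comap (F.step k).incl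
  step_zero := by
    rw [F.step_zero, LieSubmodule.eq_bot_iff]
    intro m hm
    have h : (m : M) ∈ (⊥ : LieSubmodule ℂ 𝔤 M) := hm
    exact Subtype.ext ((LieSubmodule.mem_bot (m : M)).mp h)
  monotone i j hij m hm := F.monotone hij hm
  exhaustive m := ⟨k, m.2⟩
  proper := {i | i ∈ F.proper ∧ i < k}
  label i := F.label ⟨i, i.2.1⟩
  step_eq i hi := by
    by_cases h : i ∈ F.proper
    · have hik : k ≤ i := not_lt.mp fun h' => hi ⟨h, h'⟩
      apply LieSubmodule.ext
      intro m
      exact ⟨fun _ => F.monotone hik m.2, fun _ => F.monotone (hik.trans (Nat.le_succ i)) m.2⟩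
    · rw [F.step_eq i h]
  subquotient := by
    rintro ⟨i, hi, hik⟩
    rw [subquotient_iff]
    obtain ⟨g, hg, hgk⟩ := exists_proj F ⟨i, hi⟩
    let f : (F.step (i + 1)).comap (F.step k).incl →ₗ⁅ℂ,𝔤⁆ F.step (i + 1) :=
      { toFun := fun m => ⟨(m : F.step k), m.2⟩
        map_add' := fun _ _ => rfl
        map_smul' := fun _ _ => rfl
        map_lie' := rfl }
    refine ⟨g.comp f, fun x => ?_, fun m => hgk (f m)⟩
    obtain ⟨m, rfl⟩ := hg x
    exact ⟨⟨⟨m, F.monotone hik m.2⟩, m.2⟩, rfl⟩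

end TensorSplitting

/-! ### Decomposition of tensor products of Verma and dual Verma filtered modules -/

section Tilting

variable {𝔤 : Type*} [LieRing 𝔤] [LieAlgebra ℂ 𝔤] [FiniteDimensional ℂ 𝔤] [IsSemisimple ℂ 𝔤]
  {H : LieSubalgebra ℂ 𝔤} [H.IsCartanSubalgebra] {b : (rootSystem H).Base}
  {θ : ChevalleyAntiAut H}
  {M : Type*} [AddCommGroup M] [Module ℂ M] [LieRingModule 𝔤 M] [LieModule ℂ 𝔤 M]
  {N : Type*} [AddCommGroup N] [Module ℂ N] [LieRingModule 𝔤 N] [LieModule ℂ 𝔤 N]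

variable (b) in
lemma isVermaFiltered_verma (μ : Dual ℂ H) : IsVermaFiltered b (Verma b μ) := by
  refine isVermaFiltered_iff.mpr ⟨isOTilde_verma b μ,
    LieFree.of_bijective (fun _ : Unit => vermaGen b μ) ?_⟩
  have hb := verma_bijective b μ
  refine ucomb_bijective (fun s e hs i hi => ?_) ?_
  · have hs' : s = {i} := Finset.eq_singleton_iff_unique_mem.mpr ⟨hi, fun _ _ => rfl⟩
    rw [hs', Finset.sum_singleton] at hs
    apply hb.injective
    change _ = uact (nNeg b) _ 0 _
    rw [map_zero]
    exact hs
  · rw [iSup_const]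
    exact LinearMap.range_eq_top.mpr hb.surjective

lemma IsVermaFiltered.tensor_right (hM : IsVermaFiltered b M) (hN : IsOTilde b N) :
    IsVermaFiltered b (M ⊗[ℂ] N) :=
  (IsVermaFiltered.tensor hN hM).of_equiv (tensorComm 𝔤 N M)

lemma lieFree_star_tensor_right (hM : IsOTilde b M) (hN : IsOTilde b N)
    (h : LieFree (nNeg b) (StarDual θ M)) : LieFree (nNeg b) (StarDual θ (M ⊗[ℂ] N)) := by
  obtain ⟨e⟩ := nonempty_star_tensor θ hM hN
  have h1 : LieFree (nNeg b) (StarDual θ M ⊗[ℂ] StarDual θ N) :=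
    (isFreeOver_tensor _ h).of_equiv (tensorComm 𝔤 (StarDual θ N) (StarDual θ M)).toLinearEquiv
      fun x m => (tensorComm 𝔤 (StarDual θ N) (StarDual θ M)).map_lie (x : 𝔤) m
  exact h1.of_equiv e.toLinearEquiv fun x m => e.map_lie (x : 𝔤) m

lemma isOTilde_step {Λ : Type*} {X : Λ → Type*}
    [∀ μ, AddCommGroup (X μ)] [∀ μ, Module ℂ (X μ)]
    [∀ μ, LieRingModule 𝔤 (X μ)] [∀ μ, LieModule ℂ 𝔤 (X μ)] (hM : IsOTilde b M)
    (F : Filtration (𝔤 := 𝔤) X M) (k : ℕ) : IsOTilde b (F.step k) :=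
  hM.of_injective (F.step k).incl (F.step k).injective_incl

/-- Each step tensored with `N` splits: the quotient `Δ ⊗ N` is Verma filtered because `Δ` is, and
the dual of the kernel is free because `N^⋆` is. -/
lemma exists_decomp_verma (hM : IsOTilde b M) (hN : IsDualVermaFiltered b θ N)
    (F : Filtration (𝔤 := 𝔤) (Verma b) M) :
    ∃ t : ∀ k : F.proper, Verma b (F.label k) ⊗[ℂ] N →ₗ⁅ℂ,𝔤⁆ M ⊗[ℂ] N,
      IsDecomp fun k => (t k : Verma b (F.label k) ⊗[ℂ] N →ₗ[ℂ] M ⊗[ℂ] N) := by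
  have hN' := isDualVermaFiltered_iff.mp hN
  refine F.exists_decomp N fun k g hg hex => ?_
  obtain ⟨F'⟩ := ((isVermaFiltered_verma b (F.label k)).tensor_right hN.1).2
  exact F'.exists_section ((isOTilde_step hM F _).tensor hN.1) (lieRTensor_surjective N hg)
    (lieRTensor_injective N (LieSubmodule.inclusion_injective _)) (lieRTensor_exact N hg hex)
    (lieFree_star_tensor (θ := θ) (isOTilde_step hM F k) hN.1 hN'.2)

/-- The roles are exchanged: the quotient `∇ ⊗ M` is Verma filtered because `M` is. The dual of the
kernel `G.step k ⊗ M` is free because `G.step k` inherits a dual Verma filtration by truncation. -/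
lemma exists_decomp_dualVerma (hN : IsOTilde b N) (hM : IsVermaFiltered b M)
    (G : Filtration (𝔤 := 𝔤) (DualVerma b θ) N) :
    ∃ t : ∀ k : G.proper, DualVerma b θ (G.label k) ⊗[ℂ] M →ₗ⁅ℂ,𝔤⁆ N ⊗[ℂ] M,
      IsDecomp fun k => (t k : DualVerma b θ (G.label k) ⊗[ℂ] M →ₗ[ℂ] N ⊗[ℂ] M) := by
  refine G.exists_decomp M fun k g hg hex => ?_
  obtain ⟨F'⟩ := (hM.tensor (isOTilde_verma b (G.label k)).star).2
  exact F'.exists_section ((isOTilde_step hN G _).tensor hM.1) (lieRTensor_surjective M hg)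
    (lieRTensor_injective M (LieSubmodule.inclusion_injective _)) (lieRTensor_exact M hg hex)
    (lieFree_star_tensor_right (θ := θ) (isOTilde_step hN G k) hM.1
      ((G.truncate k).lieFree_star (isOTilde_step hN G k)))

/-- The tensor product of a Verma filtered and a dual Verma filtered module is the direct sum of
the tensor products of the subquotients. -/
theorem nonempty_tensor_equiv (hM : IsOTilde b M) (hN : IsOTilde b N)
    (F : Filtration (𝔤 := 𝔤) (Verma b) M) (G : Filtration (𝔤 := 𝔤) (DualVerma b θ) N) :
    Nonempty ((M ⊗[ℂ] N) ≃ₗ⁅ℂ, 𝔤⁆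
      ⨁ p : F.proper × G.proper, Verma b (F.label p.1) ⊗[ℂ] DualVerma b θ (G.label p.2)) := by
  obtain ⟨t, ht⟩ := exists_decomp_verma hM ⟨hN, ⟨G⟩⟩ F
  choose r hr using fun i : F.proper =>
    exists_decomp_dualVerma hN (isVermaFiltered_verma b (F.label i)) G
  refine exists_lieEquiv_directSum (fun p : F.proper × G.proper =>
    (t p.1).comp (((tensorComm 𝔤 N (Verma b (F.label p.1))).toLieModuleHom.comp
      (r p.1 p.2)).comp
        (tensorComm 𝔤 (Verma b (F.label p.1)) (DualVerma b θ (G.label p.2))).toLieModuleHom)) ?_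
  -- The decomposition of `N ⊗ Δ(λᵢ)` is carried to `Δ(λᵢ) ⊗ N` by flips and substituted into that
  -- of `M ⊗ N`.
  exact ht.comp (fun i => (hr i).comp_equiv
    (fun j => (tensorComm 𝔤 (Verma b (F.label i)) (DualVerma b θ (G.label j))).toLinearEquiv)
    (tensorComm 𝔤 N (Verma b (F.label i))).toLinearEquiv)

end Tilting

end CatO

end

/-! ### The main theorem -/

open CatO in
theorem proposition2p6 {𝔤 : Type*} [LieRing 𝔤] [LieAlgebra ℂ 𝔤] [FiniteDimensional ℂ 𝔤]
    [LieAlgebra.IsSemisimple ℂ 𝔤] {H : LieSubalgebra ℂ 𝔤} [H.IsCartanSubalgebra]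
    (b : (LieAlgebra.IsKilling.rootSystem H).Base) (θ : ChevalleyAntiAut H)
    {M : Type*} [AddCommGroup M] [Module ℂ M] [LieRingModule 𝔤 M] [LieModule ℂ 𝔤 M]
    {N : Type*} [AddCommGroup N] [Module ℂ N] [LieRingModule 𝔤 N] [LieModule ℂ 𝔤 N] :
    (IsOTilde b M → IsVermaFiltered b N → IsVermaFiltered b (M ⊗[ℂ] N)) ∧
    (IsOTilde b M → IsDualVermaFiltered b θ N → IsDualVermaFiltered b θ (M ⊗[ℂ] N)) ∧
    (IsOTilde b M → IsTilting b θ N → IsTilting b θ (M ⊗[ℂ] N)) ∧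
    (IsOTilde b M → IsOTilde b N → IsFreeOver (nNeg b) N →
      IsFreeOver (nNeg b) (M ⊗[ℂ] N)) ∧
    (IsVermaFiltered b M → IsDualVermaFiltered b θ N →
      IsTilting b θ (M ⊗[ℂ] N) ∧
      ∀ (F : Filtration (𝔤 := 𝔤) (Verma b) M) (G : Filtration (𝔤 := 𝔤) (DualVerma b θ) N),
        Nonempty ((M ⊗[ℂ] N) ≃ₗ⁅ℂ, 𝔤⁆
          ⨁ p : F.proper × G.proper, Verma b (F.label p.1) ⊗[ℂ] DualVerma b θ (G.label p.2))) := by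
  refine ⟨fun hM hN => IsVermaFiltered.tensor hM hN, fun hM hN => IsDualVermaFiltered.tensor hM hN,
    fun hM hN => ⟨IsVermaFiltered.tensor hM hN.1, IsDualVermaFiltered.tensor hM hN.2⟩,
    -- `IsFreeOver` and `LieFree` unfold to the same statement.
    fun _ _ h => isFreeOver_tensor _ h, fun hM hN => ⟨⟨hM.tensor_right hN.1,
      IsDualVermaFiltered.tensor hM.1 hN⟩, fun F G => nonempty_tensor_equiv hM.1 hN.1 F G⟩⟩
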